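/- Let $\mathcal{A}$ be a finite alphabet with the discrete topology, let $\eta\colon\mathbb{Z}^2\to\mathcal{A}$, and let $(T^{\vec u}f)(\vec x)=f(\vec x+\vec u)$ for $f\in\mathcal{A}^{\mathbb{Z}^2}$ and $\vec u,\vec x\in\mathbb{Z}^2$. For a finite set $S\subset\mathbb{Z}^2$ let $P_\eta(S)$ be the number of distinct restrictions $(T^{\vec u}\eta)|_S$, $\vec u\in\mathbb{Z}^2$, and let $R_{n,k}=\{0,\dots,n-1\}\times\{0,\dots,k-1\}$. Let $X_\eta$ be the closure of the orbit $\{T^{\vec u}\eta:\vec u\in\mathbb{Z}^2\}$ in the product topology on $\mathcal{A}^{\mathbb{Z}^2}$, with the $\mathbb{Z}^2$-action by the translations $T^{\vec u}$, and let $d$ be any metric on $X_\eta$ that induces its topology. A line $\ell\subset\mathbb{R}^2$ is called expansive for $X_\eta$ if there exist $r>0$ and $\delta>0$ such that any $f,g\in X_\eta$ with $d(T^{\vec u}f,T^{\vec u}g)<\delta$ for all $\vec u\in\mathbb{Z}^2$ at Euclidean distance less than $r$ from $\ell$ satisfy $f=g$; otherwise $\ell$ is called nonexpansive. If $P_\eta(R_{n,k})\le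 nk$ for some integers $n\ge 1$ and $1\le k\le 3$, then the dynamical system $X_\eta$ has at most one nonexpansive line up to translation; that is, any two nonexpansive lines are parallel (or equal). In particular, at most one line through the origin is nonexpansive. -/

import Mathlib

/-- The translate of a configuration: `(T^u f)(x) = f (x + u)`. -/
def shiftBy {A : Type*} (u : ℤ × ℤ) (f : ℤ × ℤ → A) : ℤ × ℤ → A :=
  fun x => f (x + u)

/-- The `n` by `k` rectangle `{0, …, n - 1} × {0, …, k - 1}` (width `n`, height `k`). -/
noncomputable def rectangle (n k : ℕ) : Finset (ℤ × ℤ) :=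
  Finset.Ico (0 : ℤ) n ×ˢ Finset.Ico (0 : ℤ) k

/-- The `S`-words of `η`: all restrictions to `S` of translates of `η`. -/
def words {A : Type*} (η : ℤ × ℤ → A) (S : Finset (ℤ × ℤ)) : Set (S → A) :=
  Set.range fun u : ℤ × ℤ => fun x : S => shiftBy u η x

/-- The complexity `P_η(S)`: the number of distinct `S`-words of `η`. For a finite alphabet the
set of `S`-words is finite, so that `Set.ncard` is its true cardinality. -/
noncomputable def complexity {A : Type*} (η : ℤ × ℤ → A) (S : Finset (ℤ × ℤ)) : ℕ :=
  (words η S).ncard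

/-- The orbit closure `X_η`, in the product topology on `ℤ × ℤ → A`. -/
def orbitClosure {A : Type*} [TopologicalSpace A] (η : ℤ × ℤ → A) : Set (ℤ × ℤ → A) :=
  closure (Set.range fun u : ℤ × ℤ => shiftBy u η)

theorem shiftBy_mem_orbitClosure {A : Type*} [TopologicalSpace A] (η : ℤ × ℤ → A)
    (u : ℤ × ℤ) {f : ℤ × ℤ → A} (hf : f ∈ orbitClosure η) :
    shiftBy u f ∈ orbitClosure η := by
  have hc : Continuous (shiftBy u : (ℤ × ℤ → A) → (ℤ × ℤ → A)) :=
    by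
    refine continuous_pi fun x => ?_
    exact continuous_apply (A := fun _ : ℤ × ℤ => A) (x + u)
  refine map_mem_closure hc hf ?_
  rintro _ ⟨v, rfl⟩
  refine ⟨u + v, ?_⟩
  funext x
  simp only [shiftBy, add_assoc]

/-- The translation action `T^u` of `ℤ²` on the orbit closure `X_η`. -/
def orbitClosureAction {A : Type*} [TopologicalSpace A] (η : ℤ × ℤ → A) (u : ℤ × ℤ)
    (f : orbitClosure η) : orbitClosure η :=
  ⟨shiftBy u f, shiftBy_mem_orbitClosure η u f.2⟩

/-- A lattice point, seen in the Euclidean plane. -/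
noncomputable def latticePoint (u : ℤ × ℤ) : EuclideanSpace ℝ (Fin 2) :=
  !₂[(u.1 : ℝ), (u.2 : ℝ)]

/-- A (not necessarily central) straight line in the Euclidean plane. -/
def IsLine (l : AffineSubspace ℝ (EuclideanSpace ℝ (Fin 2))) : Prop :=
  (l : Set (EuclideanSpace ℝ (Fin 2))).Nonempty ∧ Module.finrank ℝ l.direction = 1

/-- A line `l` is expansive for the maps `T^u` (`u ∈ ℤ²`) on the metric space `X` if there are
`r, δ > 0` such that `f = g` whenever `d(T^u f, T^u g) < δ` for all `u ∈ ℤ²` with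
`d(u, l) < r`. -/
def IsExpansiveLine {X : Type*} [MetricSpace X] (T : ℤ × ℤ → X → X)
    (l : AffineSubspace ℝ (EuclideanSpace ℝ (Fin 2))) : Prop :=
  IsLine l ∧ ∃ r : ℝ, 0 < r ∧ ∃ δ : ℝ, 0 < δ ∧ ∀ f g : X,
    (∀ u : ℤ × ℤ,
      Metric.infDist (latticePoint u) (l : Set (EuclideanSpace ℝ (Fin 2))) < r →
        dist (T u f) (T u g) < δ) → f = g

/-- A line is nonexpansive if it is not expansive. -/
def IsNonexpansiveLine {X : Type*} [MetricSpace X] (T : ℤ × ℤ → X → X)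
    (l : AffineSubspace ℝ (EuclideanSpace ℝ (Fin 2))) : Prop :=
  IsLine l ∧ ¬ IsExpansiveLine T l

/-! Everything reduces to periodicity of `η`. If `η` has a nonzero period `h`, so has every element
of the orbit closure. A wide enough strip about a line not parallel to `h` meets every class `z +
ℤh`, so agreement on the strip is agreement everywhere (`direction_eq_span_of_nonexpansive`). Hence
every nonexpansive line is parallel to `h`, and the substance is `exists_period_of_complexity_le`,
proved by contradiction.

Algebra: low complexity gives a linear relation satisfied by all patterns (`exists_relation`), and
Frobenius congruences turn it into a product of differences that kills `η` (`exists_kills`). In a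
shortest product the directions are independent and each one ties the maximum of the relation's
support (`exists_minimal_kills`). Three rows leave room for only two non-horizontal directions
(`killing_directions`).

Dynamics: a configuration killed by differences along `h`, `a` and `b` is periodic along `h` when
half-planes bounded in the directions `a` and `b` are expansive (`drift`). For aperiodic `η` this
yields pairs of distinct configurations that agree on a half-plane. In a smallest slab of low
complexity such a pair forces a tied maximum (`IsMinimalSlab.tie`). One slanted direction is thereby
excluded. Two of them make the slab a hexagon with slanted edges `(a, 1)` and `(b, 1)`
(`exists_hexSystem`), and a second use of `drift` gives a pair that agrees below a horizontal line
(`HexSystem.exists_bottom_pair`).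

Contradiction: minimality leaves a single ambiguous word at each edge, and that word is invariant
along the edge. In a pair agreeing below a horizontal line, the row of first difference and the two
rows under it are therefore successive shifts by `a` or by `b`, for each member
(`HexSystem.exists_slope`). The two common rows then determine the third one, so the members do not
differ there (`HexSystem.not_bottom_pair`). -/

/-! ### Patterns, limits and the counting of words -/

/-- Every finite pattern of `f` occurs in `η`. -/
def Occ {A : Type*} (η f : ℤ × ℤ → A) : Prop :=
  ∀ B : Finset (ℤ × ℤ), ∃ u, ∀ z ∈ B, f z = η (z + u)

theorem Occ.refl {A : Type*} (η : ℤ × ℤ → A) : Occ η η := fun _ => ⟨0, by simp⟩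

theorem Occ.shift {A : Type*} {η f : ℤ × ℤ → A} (hf : Occ η f) (u : ℤ × ℤ) :
    Occ η (fun z => f (z + u)) := by
  intro B
  obtain ⟨v, hv⟩ := hf (B.image (· + u))
  refine ⟨u + v, fun z hz => ?_⟩
  exact (hv (z + u) (Finset.mem_image_of_mem _ hz)).trans (by rw [add_assoc])

theorem Occ.word_mem {A : Type*} {η f : ℤ × ℤ → A} (hf : Occ η f) (S : Finset (ℤ × ℤ))
    (u : ℤ × ℤ) : (fun s : S => f (s + u)) ∈ words η S := by
  obtain ⟨v, hv⟩ := hf.shift u S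
  exact ⟨v, funext fun s => (hv s s.2).symm⟩

/-- Compactness of the full shift without topology: at each site the finite alphabet lets the
ultrafilter select one symbol, and finitely many sites can be treated at once. -/
theorem exists_ultralimit {A : Type*} [Finite A] (U : Ultrafilter ℕ) (F : ℕ → ℤ × ℤ → A) :
    ∃ f : ℤ × ℤ → A, ∀ B : Finset (ℤ × ℤ), ∀ᶠ n in (U : Filter ℕ), ∀ z ∈ B, F n z = f z := by
  have key : ∀ z, ∃ a, ∀ᶠ n in (U : Filter ℕ), F n z = a := by
    intro z
    by_contra! h
    obtain ⟨n, hn⟩ := (Filter.eventually_all.2 h).exists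
    exact hn _ rfl
  choose f hf using key
  exact ⟨f, fun B => (Filter.eventually_all_finset B).2 fun z _ => hf z⟩

theorem Occ.of_limit {A : Type*} {η f : ℤ × ℤ → A} {U : Ultrafilter ℕ} {F : ℕ → ℤ × ℤ → A}
    (hF : ∀ n, Occ η (F n))
    (hf : ∀ B : Finset (ℤ × ℤ), ∀ᶠ n in (U : Filter ℕ), ∀ z ∈ B, F n z = f z) : Occ η f := by
  intro B
  obtain ⟨n, hn⟩ := (hf B).exists
  obtain ⟨u, hu⟩ := hF n B
  exact ⟨u, fun z hz => by rw [← hn z hz, hu z hz]⟩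

theorem words_finite {A : Type*} [Finite A] (η : ℤ × ℤ → A) (S : Finset (ℤ × ℤ)) :
    (words η S).Finite := Set.toFinite _

/-- Restriction of words to a smaller set. -/
def restrictWord {A : Type*} {T S : Finset (ℤ × ℤ)} (h : T ⊆ S) (w : S → A) : T → A :=
  fun t => w ⟨t, h t.2⟩

theorem words_restrict {A : Type*} (η : ℤ × ℤ → A) {T S : Finset (ℤ × ℤ)} (h : T ⊆ S) :
    words η T = restrictWord h '' words η S := by
  ext w
  constructor
  · rintro ⟨u, rfl⟩
    exact ⟨_, ⟨u, rfl⟩, rfl⟩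
  · rintro ⟨_, ⟨u, rfl⟩, rfl⟩
    exact ⟨u, rfl⟩

/-- Every `T`-word that does not come from `V` has an extension outside `V`, so passing from `T` to
`S` gains at least as many words as `V` loses under restriction. -/
theorem excess {A : Type*} [Finite A] (η : ℤ × ℤ → A) {T S : Finset (ℤ × ℤ)} (h : T ⊆ S)
    (V : Set (S → A)) (hV : V ⊆ words η S) :
    V.ncard + complexity η T ≤ complexity η S + (restrictWord h '' V).ncard := by
  have h1 : (words η T).ncard ≤ (restrictWord h '' V).ncard
      + (restrictWord h '' (words η S \ V)).ncard := by
    refine (Set.ncard_le_ncard ?_ (Set.toFinite _)).trans (Set.ncard_union_le _ _)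
    rw [words_restrict η h, ← Set.image_union]
    apply Set.image_mono
    intro x hx
    by_cases hxV : x ∈ V
    · exact Or.inl hxV
    · exact Or.inr ⟨hx, hxV⟩
  have h2 : (restrictWord h '' (words η S \ V)).ncard ≤ (words η S \ V).ncard :=
    Set.ncard_image_le (Set.toFinite _)
  have h3 : (words η S \ V).ncard + V.ncard = (words η S).ncard :=
    Set.ncard_sdiff_add_ncard_of_subset hV (Set.toFinite _)
  unfold complexity
  omega

/-- Words with several extensions are counted by the growth of the complexity. -/
theorem ambiguous_count {A : Type*} [Finite A] (η : ℤ × ℤ → A) {T S : Finset (ℤ × ℤ)}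
    (h : T ⊆ S) (W : Set (T → A))
    (hW : ∀ w ∈ W, ∃ f g, Occ η f ∧ Occ η g ∧ (∀ t : T, f t = w t) ∧ (∀ t : T, g t = w t) ∧
      ∃ s ∈ S, f s ≠ g s) :
    W.ncard + complexity η T ≤ complexity η S := by
  have : Inhabited (ℤ × ℤ → A) := ⟨η⟩
  choose! f g hf hg hfw hgw hne using hW
  let σ : (T → A) → (S → A) := fun w s => f w s
  let τ : (T → A) → (S → A) := fun w s => g w s
  have hσ : ∀ w ∈ W, restrictWord h (σ w) = w := fun w hw => funext fun t => hfw w hw t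
  have hτ : ∀ w ∈ W, restrictWord h (τ w) = w := fun w hw => funext fun t => hgw w hw t
  have hsub : σ '' W ∪ τ '' W ⊆ words η S := by
    rintro _ (⟨w, hw, rfl⟩ | ⟨w, hw, rfl⟩)
    · simpa using (hf w hw).word_mem S 0
    · simpa using (hg w hw).word_mem S 0
  have hdis : Disjoint (σ '' W) (τ '' W) := by
    rw [Set.disjoint_left]
    rintro _ ⟨w, hw, rfl⟩ ⟨w', hw', hww⟩
    have : w' = w := by rw [← hτ w' hw', hww, hσ w hw]
    subst this
    obtain ⟨s, hs, hs'⟩ := hne w' hw'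
    exact hs' (congrFun hww ⟨s, hs⟩).symm
  have himg : restrictWord h '' (σ '' W ∪ τ '' W) ⊆ W := by
    rintro _ ⟨_, (⟨w, hw, rfl⟩ | ⟨w, hw, rfl⟩), rfl⟩
    · rwa [hσ w hw]
    · rwa [hτ w hw]
  have e := excess η h _ hsub
  have c1 : (σ '' W).ncard = W.ncard := Set.InjOn.ncard_image
    fun a ha b hb hab => by rw [← hσ a ha, ← hσ b hb, hab]
  have c2 : (τ '' W).ncard = W.ncard := Set.InjOn.ncard_image
    fun a ha b hb hab => by rw [← hτ a ha, ← hτ b hb, hab]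
  rw [Set.ncard_union_eq hdis (Set.toFinite _) (Set.toFinite _), c1, c2] at e
  have := Set.ncard_le_ncard himg (Set.toFinite _)
  omega

theorem complexity_empty {A : Type*} (η : ℤ × ℤ → A) : complexity η ∅ = 1 := by
  unfold complexity
  rw [Set.ncard_eq_one]
  refine ⟨fun s => (Finset.notMem_empty _ s.2).elim, ?_⟩
  ext w
  simp only [words, Set.mem_range, Set.mem_singleton_iff]
  constructor
  · rintro _
    funext s
    exact (Finset.notMem_empty _ s.2).elim
  · rintro rfl
    exact ⟨0, funext fun s => (Finset.notMem_empty _ s.2).elim⟩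

/-- Patterns on `T` that extend in two ways to `S` agree when the complexity grows by one. -/
theorem ambiguous_unique {A : Type*} [Finite A] {η : ℤ × ℤ → A} {T S : Finset (ℤ × ℤ)}
    (h : T ⊆ S) (hc : complexity η S ≤ complexity η T + 1) {f g f' g' : ℤ × ℤ → A}
    (hf : Occ η f) (hg : Occ η g) (hf' : Occ η f') (hg' : Occ η g')
    (hfg : ∀ t ∈ T, f t = g t) (hfg' : ∀ t ∈ T, f' t = g' t)
    (hne : ∃ s ∈ S, f s ≠ g s) (hne' : ∃ s ∈ S, f' s ≠ g' s) : ∀ t ∈ T, f t = f' t := by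
  by_contra! hcon
  obtain ⟨t, ht, htne⟩ := hcon
  have hw : (fun t : T => f t) ≠ fun t : T => f' t := fun e => htne (congrFun e ⟨t, ht⟩)
  have := ambiguous_count η h {(fun t : T => f t), (fun t : T => f' t)} (by
    rintro w (rfl | rfl)
    · exact ⟨f, g, hf, hg, fun _ => rfl, fun t => (hfg t t.2).symm, hne⟩
    · exact ⟨f', g', hf', hg', fun _ => rfl, fun t => (hfg' t t.2).symm, hne'⟩)
  rw [Set.ncard_pair hw] at this
  omega

/-- Three extensions of one word would raise the complexity by two. -/
theorem extensions_le_two {A : Type*} [Finite A] {η : ℤ × ℤ → A} {T S : Finset (ℤ × ℤ)}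
    (h : T ⊆ S) (hc : complexity η S ≤ complexity η T + 1) {f g k : ℤ × ℤ → A}
    (hf : Occ η f) (hg : Occ η g) (hk : Occ η k)
    (hfg : ∀ t ∈ T, f t = g t) (hfk : ∀ t ∈ T, f t = k t) (hne : ∃ s ∈ S, f s ≠ g s) :
    (∀ s ∈ S, k s = f s) ∨ (∀ s ∈ S, k s = g s) := by
  by_contra! hcon
  obtain ⟨⟨s1, hs1, hs1'⟩, ⟨s2, hs2, hs2'⟩⟩ := hcon
  obtain ⟨s, hs, hs'⟩ := hne
  let wf : S → A := fun s => f s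
  let wg : S → A := fun s => g s
  let wk : S → A := fun s => k s
  have n1 : wf ≠ wg := fun e => hs' (congrFun e ⟨s, hs⟩)
  have n2 : wf ≠ wk := fun e => hs1' (congrFun e ⟨s1, hs1⟩).symm
  have n3 : wg ≠ wk := fun e => hs2' (congrFun e ⟨s2, hs2⟩).symm
  have hsub : ({wf, wg, wk} : Set (S → A)) ⊆ words η S := by
    rintro w (rfl | rfl | rfl)
    · simpa using hf.word_mem S 0
    · simpa using hg.word_mem S 0
    · simpa using hk.word_mem S 0
  have e := excess η h _ hsub
  have himg : restrictWord h '' {wf, wg, wk} ⊆ {restrictWord h wf} := by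
    rintro _ ⟨w, (rfl | rfl | rfl), rfl⟩
    · rfl
    · exact funext fun t => (hfg t t.2).symm
    · exact funext fun t => (hfk t t.2).symm
  have := Set.ncard_le_ncard himg (Set.toFinite _)
  rw [Set.ncard_singleton] at this
  have c3 : ({wf, wg, wk} : Set (S → A)).ncard = 3 := by
    rw [Set.ncard_eq_three]
    exact ⟨wf, wg, wk, n1, n2, n3, rfl⟩
  omega

/-- If the complexity does not grow from `T` to `S`, patterns on `T` determine those on `S`. -/
theorem determined_of_complexity_le {A : Type*} [Finite A] {η : ℤ × ℤ → A}
    {T S : Finset (ℤ × ℤ)} (h : T ⊆ S) (hc : complexity η S ≤ complexity η T)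
    {f g : ℤ × ℤ → A} (hf : Occ η f) (hg : Occ η g) (hfg : ∀ t ∈ T, f t = g t) :
    ∀ s ∈ S, f s = g s := by
  by_contra! hcon
  have := ambiguous_count η h {(fun t : T => f t)} (by
    rintro w rfl
    exact ⟨f, g, hf, hg, fun _ => rfl, fun t => (hfg t t.2).symm, hcon⟩)
  rw [Set.ncard_singleton] at this
  omega

theorem complexity_translate {A : Type*} (η : ℤ × ℤ → A) (S : Finset (ℤ × ℤ)) (v : ℤ × ℤ) :
    complexity η (S.image (· + v)) = complexity η S := by
  classical
  have hm : ∀ s : S, (s : ℤ × ℤ) + v ∈ S.image (· + v) := fun s =>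
    Finset.mem_image_of_mem _ s.2
  let φ : ((S.image (· + v) : Finset _) → A) → (S → A) := fun w s => w ⟨s + v, hm s⟩
  have hφ : Function.Injective φ := by
    intro w w' hww
    funext ⟨t, ht⟩
    obtain ⟨s, hs, rfl⟩ := Finset.mem_image.1 ht
    exact congrFun hww ⟨s, hs⟩
  have : φ '' words η (S.image (· + v)) = words η S := by
    ext w
    constructor
    · rintro ⟨_, ⟨u, rfl⟩, rfl⟩
      refine ⟨v + u, funext fun s => ?_⟩
      simp [φ, shiftBy, add_assoc]
    · rintro ⟨u, rfl⟩
      refine ⟨_, ⟨u - v, rfl⟩, funext fun s => ?_⟩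
      simp [φ, shiftBy, add_assoc]
  unfold complexity
  rw [← this, Set.ncard_image_of_injective _ hφ]

/-! ### Linear relations and the Morse–Hedlund theorem -/

/-- A linear relation satisfied by all patterns on a set of low complexity. -/
theorem exists_relation {A R : Type*} [Finite A] [CommRing R] [Nontrivial R]
    (η : ℤ × ℤ → A) (S : Finset (ℤ × ℤ)) (hS : complexity η S ≤ S.card) (φ : A → R) :
    ∃ (F : ℤ × ℤ → R) (c : R), (∃ s ∈ S, F s ≠ 0) ∧ (∀ s ∉ S, F s = 0) ∧
      ∀ f, Occ η f → ∀ z, ∑ s ∈ S, F s * φ (f (s + z)) = c := by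
  classical
  have := (words_finite η S).fintype
  -- There are `card S + 1` unknowns, the coefficients and the constant `G none`, against one
  -- equation per word, hence at most `card S` equations.
  let M : ((Option S) → R) →ₗ[R] (words η S → R) :=
    { toFun := fun G w => ∑ s : S, G (some s) * φ (w.1 s) - G none
      map_add' := by
        intro G H
        funext w
        simp only [Pi.add_apply, add_mul, Finset.sum_add_distrib]
        ring
      map_smul' := by
        intro r G
        funext w
        simp only [Pi.smul_apply, smul_eq_mul, RingHom.id_apply, mul_sub, Finset.mul_sum, mul_assoc] }
  have hM : ¬ Function.Injective M := by
    intro hi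
    have := card_le_of_injective R M hi
    rw [Fintype.card_option, Fintype.card_coe, ← Nat.card_eq_fintype_card, Nat.card_coe_set_eq] at this
    unfold complexity at hS
    omega
  have : ∃ G, G ≠ 0 ∧ M G = 0 := by
    by_contra! hcon
    refine hM ((injective_iff_map_eq_zero M).2 fun G hG => ?_)
    by_contra hG0
    exact hcon G hG0 hG
  obtain ⟨G, hG0, hG⟩ := this
  have hrel : ∀ w : words η S, ∑ s : S, G (some s) * φ (w.1 s) = G none := fun w =>
    sub_eq_zero.1 (congrFun hG w)
  refine ⟨fun z => if h : z ∈ S then G (some ⟨z, h⟩) else 0, G none, ?_, ?_, ?_⟩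
  · by_contra! hcon
    apply hG0
    have h1 : ∀ s : S, G (some s) = 0 := fun s => by simpa using hcon s s.2
    funext o
    cases o with
    | some s => exact h1 s
    | none =>
      have := hrel ⟨_, (Occ.refl η).word_mem S 0⟩
      simp only [h1, zero_mul, Finset.sum_const_zero] at this
      exact this.symm
  · intro s hs
    simp [hs]
  · intro f hf z
    rw [← hrel ⟨_, hf.word_mem S z⟩, ← Finset.sum_coe_sort S]
    refine Finset.sum_congr rfl fun s _ => ?_
    simp

/-- The theorem of Morse and Hedlund for bi-infinite sequences. -/
theorem morse_hedlund {B : Type*} [Finite B] (u : ℤ → B) (n : ℕ)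
    (hn : (Set.range fun x : ℤ => fun i : Fin n => u (x + i)).ncard ≤ n) :
    ∃ q : ℕ, 0 < q ∧ q ≤ (Set.range fun x : ℤ => fun i : Fin n => u (x + i)).ncard ∧
      ∀ x, u (x + q) = u x := by
  induction n with
  | zero =>
    exfalso
    rw [Nat.le_zero, Set.ncard_eq_zero (Set.toFinite _)] at hn
    exact (Set.range_nonempty _).ne_empty hn
  | succ n ih =>
    let w : (m : ℕ) → ℤ → Fin m → B := fun m x i => u (x + i)
    change (Set.range (w (n+1))).ncard ≤ n + 1 at hn
    change ∃ q : ℕ, 0 < q ∧ q ≤ (Set.range (w (n+1))).ncard ∧ _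
    have hres : (fun v : Fin (n+1) → B => fun i : Fin n => v i.castSucc) ''
        Set.range (w (n+1)) = Set.range (w n) := by
      rw [← Set.range_comp]
      rfl
    have hle : (Set.range (w n)).ncard ≤ (Set.range (w (n+1))).ncard := by
      rw [← hres]; exact Set.ncard_image_le (Set.toFinite _)
    rcases hle.lt_or_eq with hlt | heq
    · obtain ⟨q, h0, h1, h2⟩ := ih (by change (Set.range (w n)).ncard ≤ n; exact Nat.le_of_lt_succ (hlt.trans_le hn))
      exact ⟨q, h0, h1.trans hle, h2⟩
    · have hinj : Set.InjOn (fun v : Fin (n+1) → B => fun i : Fin n => v i.castSucc)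
          (Set.range (w (n+1))) := by
        apply Set.injOn_of_ncard_image_eq _ (Set.toFinite _)
        rw [hres, heq]
      -- Without growth from `n` to `n + 1` a word has only one continuation, so the sequence is
      -- deterministic to the right.
      have hdet : ∀ x y, w n x = w n y → w (n+1) x = w (n+1) y := fun x y h =>
        hinj ⟨x, rfl⟩ ⟨y, rfl⟩ h
      have hstep : ∀ x y, w (n+1) x = w (n+1) y → w (n+1) (x+1) = w (n+1) (y+1) := by
        intro x y h
        apply hdet
        funext i
        have := congrFun h i.succ
        simp only [w, Fin.val_succ, Nat.cast_add, Nat.cast_one] at this ⊢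
        rw [add_assoc, add_assoc, add_comm (1:ℤ)]
        exact this
      have hfwd : ∀ (k : ℕ) x y, w (n+1) x = w (n+1) y → w (n+1) (x+k) = w (n+1) (y+k) := by
        intro k
        induction k with
        | zero => intro x y h; simpa using h
        | succ k ihk =>
          intro x y h
          have := hstep _ _ (ihk x y h)
          push_cast
          rwa [← add_assoc, ← add_assoc]
      set N := (Set.range (w (n+1))).ncard with hN
      have hpig : ∀ x : ℤ, ∃ q : ℕ, 0 < q ∧ q ≤ N ∧ ∀ k : ℕ, u (x + N + k + q) = u (x + N + k) := by
        intro x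
        have : ∃ i ∈ Finset.range (N+1), ∃ j ∈ Finset.range (N+1), i ≠ j ∧
            w (n+1) (x + (i:ℕ)) = w (n+1) (x + (j:ℕ)) := by
          have hc : (Set.toFinite (Set.range (w (n+1)))).toFinset.card < (Finset.range (N+1)).card := by
            rw [← Set.ncard_eq_toFinset_card _ (Set.toFinite _)]
            simp [hN]
          refine Finset.exists_ne_map_eq_of_card_lt_of_maps_to hc ?_
          intro i _
          simp
        obtain ⟨i, hi, j, hj, hij, h⟩ := this
        rw [Finset.mem_range] at hi hj
        wlog hlt : i < j generalizing i j
        · exact this j hj i hi (Ne.symm hij) h.symm (by omega)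
        refine ⟨j - i, by omega, by omega, fun k => ?_⟩
        have := congrFun (hfwd (N + k - i) _ _ h) 0
        simp only [w, Fin.val_zero, Nat.cast_zero, add_zero] at this
        rw [show x + N + k + (j - i : ℕ) = x + j + (N + k - i : ℕ) by omega, ← this]
        congr 1
        omega
      -- So far `q` depends on the starting point. Since `q ≤ N`, starting to the left of one
      -- failure `y q` of each candidate rules all of them out.
      by_contra! hcon
      choose! y hy using hcon
      obtain ⟨q, h0, hq, h⟩ := hpig (-(∑ q ∈ Finset.range (N+1), |y q|) - N)
      have hb : |y q| ≤ ∑ q ∈ Finset.range (N+1), |y q| :=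
        Finset.single_le_sum (f := fun q => |y q|) (fun _ _ => abs_nonneg _)
          (Finset.mem_range.2 (by omega))
      have := h (y q + ∑ q ∈ Finset.range (N+1), |y q|).toNat
      have hnn := neg_abs_le (y q)
      rw [Int.toNat_of_nonneg (by linarith)] at this
      refine hy q h0 hq ?_
      convert this using 2 <;> ring

/-! ### Differences, recurrence and the drift theorem -/

/-- The difference operator in direction `u`. -/
def shiftDiff {G : Type*} [AddCommGroup G] (u : ℤ × ℤ) (w : ℤ × ℤ → G) : ℤ × ℤ → G :=
  fun z => w (z + u) - w z

theorem shiftDiff_comm {G : Type*} [AddCommGroup G] (u u' : ℤ × ℤ) (w : ℤ × ℤ → G) :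
    shiftDiff u (shiftDiff u' w) = shiftDiff u' (shiftDiff u w) := by
  funext z
  simp only [shiftDiff, add_right_comm z u u']
  abel

theorem shiftDiff_translate {G : Type*} [AddCommGroup G] (u v : ℤ × ℤ) (w : ℤ × ℤ → G) :
    shiftDiff u (fun z => w (z + v)) = fun z => shiftDiff u w (z + v) := by
  funext z
  simp only [shiftDiff, add_right_comm z u v]

theorem eq_of_step_on_ordConnected {G : Type*} {I : Set ℤ} (hI : I.OrdConnected) (g : ℤ → G)
    (h : ∀ i ∈ I, i + 1 ∈ I → g (i + 1) = g i) {i j : ℤ} (hi : i ∈ I) (hj : j ∈ I) :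
    g i = g j := by
  wlog hij : i ≤ j generalizing i j
  · exact (this hj hi (by omega)).symm
  revert hj
  induction j, hij using Int.leInduction with
  | base => intro _; rfl
  | succ m hm ih =>
    intro hm'
    have hmI : m ∈ I := hI.out hi hm' ⟨hm, by omega⟩
    rw [ih hmI, h m hmI hm']

theorem periodic_nsmul {B : Type*} {w : ℤ × ℤ → B} {h : ℤ × ℤ} (hw : ∀ z, w (z + h) = w z)
    (n : ℕ) (z : ℤ × ℤ) : w (z + n • h) = w z := by
  induction n with
  | zero => simp
  | succ n ih => rw [succ_nsmul, ← add_assoc, hw, ih]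

theorem periodic_zsmul {B : Type*} {w : ℤ × ℤ → B} {h : ℤ × ℤ} (hw : ∀ z, w (z + h) = w z)
    (n : ℤ) (z : ℤ × ℤ) : w (z + n • h) = w z := by
  obtain ⟨m, rfl | rfl⟩ := n.eq_nat_or_neg
  · rw [natCast_zsmul]; exact periodic_nsmul hw m z
  · rw [neg_smul, natCast_zsmul, ← periodic_nsmul hw m (z + -(m • h))]; simp

/-- If recurrences of bounded length propagate along an increasing family of regions that
exhausts the plane, the configuration is periodic. -/
theorem periodic_of_recurrence {B : Type*} [Finite B] (w : ℤ × ℤ → B) (h : ℤ × ℤ)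
    (W : Finset (ℤ × ℤ)) (Q : Set (ℤ × ℤ)) (hQ : ∀ z ∈ Q, z + h ∈ Q)
    (hex : ∀ z, ∃ N : ℕ, z + N • h ∈ Q)
    (hdet : ∀ j j' : ℤ, (∀ z ∈ W, w (z + j • h) = w (z + j' • h)) →
      ∀ z ∈ Q, w (z + j • h) = w (z + j' • h)) (z : ℤ × ℤ) :
    w (z + (Nat.card (W → B)).factorial • h) = w z := by
  classical
  have := Fintype.ofFinite B
  set K := Nat.card (W → B) with hK
  rw [Nat.card_eq_fintype_card] at hK
  have hQn : ∀ (n : ℕ), ∀ z ∈ Q, z + n • h ∈ Q := by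
    intro n
    induction n with
    | zero => simp
    | succ n ih => intro z hz; rw [succ_nsmul, ← add_assoc]; exact hQ _ (ih z hz)
  obtain ⟨N, hN⟩ := hex z
  -- The patterns are read at `-(N + i) • h`: going back beyond `N` makes the recurrence, known only
  -- on translates of `Q`, reach `z` itself.
  obtain ⟨i, hi, j, hj, hij, he⟩ := Finset.exists_ne_map_eq_of_card_lt_of_maps_to
    (s := Finset.range (K + 1)) (t := (Finset.univ : Finset (W → B)))
    (f := fun i s => w (s + (-(N + i : ℤ)) • h)) (by simp [hK]) (by simp)
  rw [Finset.mem_range] at hi hj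
  wlog hlt : j < i generalizing i j
  · exact this j hj i hi (Ne.symm hij) he.symm (by omega)
  have hd := hdet _ _ (fun z hz => congrFun he ⟨z, hz⟩)
  have hper : ∀ y ∈ Q, w (y + (-(N + i : ℤ)) • h + (i - j) • h) = w (y + (-(N + i : ℤ)) • h) := by
    intro y hy
    rw [hd y hy, ← natCast_zsmul, add_assoc, ← add_smul]
    congr 3
    push_cast [hlt.le]
    ring
  have hper2 : ∀ (n : ℕ), ∀ y ∈ Q, w (y + (-(N + i : ℤ)) • h + n • (i - j) • h)
      = w (y + (-(N + i : ℤ)) • h) := by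
    intro n
    induction n with
    | zero => simp
    | succ n ih =>
      intro y hy
      have := hper (y + n • (i - j) • h) (by rw [smul_smul]; exact hQn _ _ hy)
      rw [succ_nsmul, ← add_assoc, ← ih y hy, add_right_comm _ _ (n • (i - j) • h),
        this]
  -- The recurrence time `i - j ≤ K` depends on `z`; the factorial makes the period uniform.
  obtain ⟨m, hm⟩ := Nat.dvd_factorial (show 0 < i - j by omega) (show i - j ≤ K by omega)
  have := hper2 m (z + N • h + i • h) (hQn _ _ hN)
  rw [smul_smul, mul_comm m, ← hm] at this
  have e : z + N • h + i • h + (-(N + i : ℤ)) • h = z := by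
    rw [neg_smul, add_smul, natCast_zsmul, natCast_zsmul]; abel
  rwa [e] at this

/-- Compactness: determinacy by an infinite region is determinacy by a bounded part of it. -/
theorem exists_radius {A : Type*} [Finite A] (η : ℤ × ℤ → A) (N : ℤ × ℤ → ℕ)
    (R : Set (ℤ × ℤ)) (K : (ℤ × ℤ → A) → Prop) (B : Finset (ℤ × ℤ))
    (hK : ∀ f g, (∀ z ∈ B, f z = g z) → K f → K g)
    (h : ∀ f g, Occ η f → Occ η g → K f → (∀ z ∈ R, f z = g z) → f 0 = g 0) :
    ∃ ρ : ℕ, ∀ f g, Occ η f → Occ η g → K f → (∀ z ∈ R, N z ≤ ρ → f z = g z) → f 0 = g 0 := by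
  by_contra! hcon
  choose F G hF hG hKF hFG hne using hcon
  let U : Ultrafilter ℕ := Filter.hyperfilter ℕ
  obtain ⟨f, hf⟩ := exists_ultralimit U F
  obtain ⟨g, hg⟩ := exists_ultralimit U G
  have hU : ∀ n : ℕ, ∀ᶠ m in (U : Filter ℕ), n ≤ m := fun n =>
    (Nat.hyperfilter_le_atTop : (U : Filter ℕ) ≤ _) (Filter.eventually_ge_atTop n)
  obtain ⟨n, h1, h2, h3⟩ := ((hf B).and ((hf {0}).and (hg {0}))).exists
  refine hne n ?_
  rw [h2 0 (by simp), h3 0 (by simp)]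
  refine h f g (Occ.of_limit hF hf) (Occ.of_limit hG hg) (hK _ _ h1 (hKF n)) fun z hz => ?_
  obtain ⟨m, h4, h5, h6⟩ := ((hU (N z)).and ((hf {z}).and (hg {z}))).exists
  rw [← h5 z (by simp), ← h6 z (by simp)]
  exact hFG m z hz h4

theorem functional_apply (P : ℤ × ℤ →+ ℤ) (z : ℤ × ℤ) :
    P z = z.1 * P (1, 0) + z.2 * P (0, 1) := by
  conv_lhs => rw [show z = z.1 • ((1, 0) : ℤ × ℤ) + z.2 • ((0, 1) : ℤ × ℤ) by ext <;> simp]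
  rw [map_add, map_zsmul, map_zsmul, smul_eq_mul, smul_eq_mul]

/-- The hypotheses make `P` and `Q` linearly independent, so `(P, Q)` embeds the set in a finite
square. -/
theorem finite_parallelogram (P Q : ℤ × ℤ →+ ℤ) {a b : ℤ × ℤ} (hPa : P a = 0)
    (hQa : Q a ≠ 0) (hPb : P b ≠ 0) (M : ℤ) : {z | |P z| ≤ M ∧ |Q z| ≤ M}.Finite := by
  have hinj : Function.Injective fun z => (P z, Q z) := by
    have : Function.Injective (P.prod Q) := by
      rw [injective_iff_map_eq_zero]
      intro z hz
      rw [AddMonoidHom.prod_apply, Prod.mk_eq_zero] at hz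
      obtain ⟨h1, h2⟩ := hz
      rw [functional_apply] at *
      set p1 := P (1, 0)
      set p2 := P (0, 1)
      set q1 := Q (1, 0)
      set q2 := Q (0, 1)
      have hdet : p1 * q2 - p2 * q1 ≠ 0 := by
        intro h0
        apply mul_ne_zero hQa hPb
        linear_combination (a.2 * b.1 - a.1 * b.2) * h0 + (b.1 * q1 + b.2 * q2) * hPa
      have e1 : (p1 * q2 - p2 * q1) * z.1 = 0 := by linear_combination q2 * h1 - p2 * h2
      have e2 : (p1 * q2 - p2 * q1) * z.2 = 0 := by linear_combination p1 * h2 - q1 * h1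
      ext
      · exact (mul_eq_zero.1 e1).resolve_left hdet
      · exact (mul_eq_zero.1 e2).resolve_left hdet
    exact this
  refine Set.Finite.subset (Set.Finite.preimage hinj.injOn
    ((Set.finite_Icc (-M) M).prod (Set.finite_Icc (-M) M))) ?_
  rintro z ⟨h1, h2⟩
  exact ⟨abs_le.1 h1, abs_le.1 h2⟩

theorem mixed_diff {G : Type*} [AddCommGroup G] {a b : ℤ × ℤ} {δ : ℤ × ℤ → G}
    (h : ∀ z, shiftDiff a (shiftDiff b δ) z = 0) (z : ℤ × ℤ) :
    δ (z + a + b) - δ (z + a) = δ (z + b) - δ z := sub_eq_zero.1 (h z)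

/-- Vanishing grows from a bounded parallelogram, first in `Q` inside the strip `|P| ≤ M`, then in
`P`. As the mixed difference is zero, `δ` is constant along `b` on a new level of `Q` and along `a`
on a new level of `P`. Only one representative of each progression has to be determined, and on a
level of `P` it can be chosen next to a multiple `i • h`, where `hP` applies. -/
theorem vanish_on_quadrant {G : Type*} [AddCommGroup G] {P Q : ℤ × ℤ →+ ℤ} {a b h : ℤ × ℤ}
    {δ : ℤ × ℤ → G} (hPa : P a = 0) (hQb : Q b = 0) (hQa : 0 < Q a) (hPb : 0 < P b)
    (hPh : 0 < P h) (hQh : 0 < Q h) (hδ : ∀ z, shiftDiff a (shiftDiff b δ) z = 0) {ρ M : ℤ}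
    (hQ : ∀ z, (∀ w, Q w < 0 → |P w| ≤ ρ → |Q w| ≤ ρ → δ (z + w) = 0) → δ z = 0)
    (hP : ∀ (i : ℕ) (z : ℤ × ℤ), 0 ≤ P z - i * P h → P z - i * P h < P h → 0 ≤ Q z - i * Q h →
      Q z - i * Q h < Q a → (∀ w, P w < 0 → |P w| ≤ ρ → |Q w| ≤ ρ → δ (z + w) = 0) → δ z = 0)
    (hM1 : ρ + P b ≤ M) (hM2 : Q a ≤ M) (hρ : 0 ≤ ρ)
    (h0 : ∀ z, |P z| ≤ M → |Q z| ≤ M → δ z = 0) (z : ℤ × ℤ) (hz1 : -M ≤ P z) (hz2 : -M ≤ Q z) :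
    δ z = 0 := by
  have h1 : ∀ q : ℤ, M + 1 ≤ q → ∀ z, |P z| ≤ M → -M ≤ Q z → Q z < q → δ z = 0 := by
    intro q hq
    induction q, hq using Int.leInduction with
    | base => intro z hz1 hz2 hz3; exact h0 z hz1 (abs_le.2 ⟨hz2, by omega⟩)
    | succ q hq ih =>
      intro z hz1 hz2 hz3
      by_cases hzq : Q z < q
      · exact ih z hz1 hz2 hzq
      have hzq : Q z = q := by omega
      have hc := eq_of_step_on_ordConnected (I := {i | |P z + i * P b| ≤ M})
        (by
          constructor
          intro x hx y hy t ht
          simp only [Set.mem_ofPred_eq, abs_le] at *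
          constructor <;> nlinarith [ht.1, ht.2])
        (fun i => δ (z + i • b)) (i := 0) (j := -(P z / P b))
        (by
          intro i hi hi'
          simp only [Set.mem_ofPred_eq] at hi hi'
          have := mixed_diff hδ (z + i • b - a)
          have y1 : δ (z + i • b - a) = 0 := by
            apply ih
            · simpa only [map_add, map_sub, map_zsmul, smul_eq_mul, hPa, sub_zero] using hi
            all_goals
              simp only [map_add, map_sub, map_zsmul, smul_eq_mul, hQb]
              linarith
          have y2 : δ (z + i • b - a + b) = 0 := by
            apply ih
            · rw [add_one_mul, ← add_assoc] at hi'
              simpa only [map_add, map_sub, map_zsmul, smul_eq_mul, hPa, sub_zero] using hi'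
            all_goals
              simp only [map_add, map_sub, map_zsmul, smul_eq_mul, hQb]
              linarith
          rw [y1, y2, sub_add_cancel, sub_zero, sub_eq_zero] at this
          rw [← this, add_smul, one_smul, add_assoc])
        (by simpa using hz1)
        (by
          have e1 := Int.emod_add_mul_ediv (P z) (P b)
          have e2 := Int.emod_nonneg (P z) hPb.ne'
          have e3 := Int.emod_lt_of_pos (P z) hPb
          rw [Set.mem_ofPred_eq, abs_le]
          constructor <;> linarith)
      simp only [zero_smul, add_zero] at hc
      rw [hc]
      have e1 := Int.emod_add_mul_ediv (P z) (P b)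
      have e2 := Int.emod_nonneg (P z) hPb.ne'
      have e3 := Int.emod_lt_of_pos (P z) hPb
      -- The representative satisfies `0 ≤ P < P b`, so its window of radius `ρ` stays in the strip
      -- because `ρ + P b ≤ M`.
      refine hQ _ fun w hw1 hw2 hw3 => ih _ ?_ ?_ ?_
      · rw [abs_le] at hw2 ⊢
        simp only [map_add, map_zsmul, smul_eq_mul]
        constructor <;> linarith
      · rw [abs_le] at hw3
        simp only [map_add, map_zsmul, smul_eq_mul, hQb]
        linarith
      · simp only [map_add, map_zsmul, smul_eq_mul, hQb]
        linarith
  have h2 : ∀ p : ℤ, M + 1 ≤ p → ∀ z, -M ≤ P z → P z < p → -M ≤ Q z → δ z = 0 := by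
    intro p hp
    induction p, hp using Int.leInduction with
    | base =>
      intro z hz1 hz2 hz3
      refine h1 (max (M + 1) (Q z + 1)) (le_max_left _ _) z (abs_le.2 ⟨hz1, by omega⟩) hz3 ?_
      have := le_max_right (M + 1) (Q z + 1)
      omega
    | succ p hp ih =>
      intro z hz1 hz2 hz3
      by_cases hzp : P z < p
      · exact ih z hz1 hzp hz3
      have hzp : P z = p := by omega
      have f1 := Int.emod_add_mul_ediv p (P h)
      have f2 := Int.emod_nonneg p hPh.ne'
      have f3 := Int.emod_lt_of_pos p hPh
      have f4 : 0 ≤ p / P h := Int.ediv_nonneg (by omega) hPh.le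
      set i := p / P h with hi
      have e1 := Int.emod_add_mul_ediv (Q z - i * Q h) (Q a)
      have e2 := Int.emod_nonneg (Q z - i * Q h) hQa.ne'
      have e3 := Int.emod_lt_of_pos (Q z - i * Q h) hQa
      have f5 : 0 ≤ i * Q h := mul_nonneg f4 hQh.le
      have hc := eq_of_step_on_ordConnected (I := {i | -M ≤ Q z + i * Q a})
        (by
          constructor
          intro x hx y hy t ht
          simp only [Set.mem_ofPred_eq] at *
          nlinarith [ht.1, ht.2])
        (fun i => δ (z + i • a)) (i := 0) (j := -((Q z - i * Q h) / Q a))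
        (by
          intro i hi hi'
          simp only [Set.mem_ofPred_eq] at hi hi'
          have := mixed_diff hδ (z + i • a - b)
          have y1 : δ (z + i • a - b) = 0 := by
            apply ih
            all_goals
              simp only [map_add, map_sub, map_zsmul, smul_eq_mul, hPa, hQb]
              linarith
          have y2 : δ (z + i • a - b + a) = 0 := by
            apply ih
            all_goals
              simp only [map_add, map_sub, map_zsmul, smul_eq_mul, hPa, hQb]
              linarith
          rw [y1, y2, add_right_comm, sub_add_cancel, sub_zero, sub_zero] at this
          rw [add_smul, one_smul, ← add_assoc, this])
        (by simpa using hz3)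
        (by
          rw [Set.mem_ofPred_eq]
          linarith)
      simp only [zero_smul, add_zero] at hc
      rw [hc]
      obtain ⟨n, hn⟩ := Int.eq_ofNat_of_zero_le f4
      refine hP n _ ?_ ?_ ?_ ?_ fun w hw1 hw2 hw3 => ih _ ?_ ?_ ?_
      · simp only [map_add, map_zsmul, smul_eq_mul, hPa, ← hn]; linarith
      · simp only [map_add, map_zsmul, smul_eq_mul, hPa, ← hn]; linarith
      · simp only [map_add, map_zsmul, smul_eq_mul, ← hn]; linarith
      · simp only [map_add, map_zsmul, smul_eq_mul, ← hn]; linarith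
      all_goals
        rw [abs_le] at hw2 hw3
        simp only [map_add, map_zsmul, smul_eq_mul, hPa]
        linarith
  refine h2 (max (M + 1) (P z + 1)) (le_max_left _ _) z hz1 ?_ hz2
  have := le_max_right (M + 1) (P z + 1)
  omega

theorem Occ.of_translate {A : Type*} {η f : ℤ × ℤ → A} {u : ℤ × ℤ}
    (h : Occ (fun z => η (z + u)) f) : Occ η f := by
  intro B
  obtain ⟨v, hv⟩ := h B
  exact ⟨v + u, fun z hz => (hv z hz).trans (congrArg η (add_assoc _ _ _))⟩

/-- `vanish_on_quadrant` is applied to the difference `δ` of two translates of `ι ∘ η` by multiples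
of `h`. Its mixed difference vanishes because `β`, the mixed difference of `ι ∘ η`, is `h`-periodic.
Determinacy from `exP` needs a nonzero value of `β` nearby, and periodicity supplies one at every
multiple of `h`. -/
theorem drift_of_pos {A : Type*} [Finite A] {η : ℤ × ℤ → A} {ι : A → ℤ}
    (hι : Function.Injective ι) {P Q : ℤ × ℤ →+ ℤ} {a b h : ℤ × ℤ} (hPa : P a = 0)
    (hQb : Q b = 0) (hQa : 0 < Q a) (hPb : 0 < P b) (hPh : 0 < P h) (hQh : 0 < Q h)
    (kill : ∀ z, shiftDiff h (shiftDiff a (shiftDiff b (ι ∘ η))) z = 0)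
    (bad : shiftDiff a (shiftDiff b (ι ∘ η)) 0 ≠ 0)
    (exP : ∀ f g, Occ η f → Occ η g → (∃ z, shiftDiff a (shiftDiff b (ι ∘ f)) z ≠ 0) →
      (∀ z, P z < 0 → f z = g z) → f = g)
    (exQ : ∀ f g, Occ η f → Occ η g → (∀ z, Q z < 0 → f z = g z) → f = g) :
    ∃ J : ℕ, 0 < J ∧ ∀ z, η (z + J • h) = η z := by
  classical
  let N : ℤ × ℤ → ℕ := fun w => max (P w).natAbs (Q w).natAbs
  have hN : ∀ w (r : ℕ), N w ≤ r → |P w| ≤ r ∧ |Q w| ≤ r := by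
    intro w r hr
    rw [max_le_iff] at hr
    rw [Int.abs_eq_natAbs, Int.abs_eq_natAbs]
    omega
  obtain ⟨ρ₁, hρ₁⟩ := exists_radius η N {w | Q w < 0} (fun _ => True) ∅ (fun _ _ _ _ => trivial)
    (fun f g hf hg _ h => congrFun (exQ f g hf hg h) 0)
  -- `C` contains all offsets from the points of the cell at `i • h` considered in `hP` to `i • h`
  -- itself, where `β` does not vanish.
  let C : Finset (ℤ × ℤ) := (finite_parallelogram P Q hPa hQa.ne' hPb.ne' (P h + Q a)).toFinset
  have hC : ∀ w, |P w| ≤ P h + Q a → |Q w| ≤ P h + Q a → w ∈ C := fun w h1 h2 => by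
    simpa [C] using ⟨h1, h2⟩
  obtain ⟨ρ₂, hρ₂⟩ := exists_radius η N {w | P w < 0}
    (fun f => ∃ w ∈ C, shiftDiff a (shiftDiff b (ι ∘ f)) w ≠ 0)
    (C ∪ C.image (· + a) ∪ (C.image (· + b) ∪ C.image (· + a + b)))
    (by
      rintro f g hfg ⟨w, hw, hne⟩
      refine ⟨w, hw, ?_⟩
      simp only [shiftDiff, Function.comp_apply] at hne ⊢
      rwa [← hfg w (by simp [hw]), ← hfg (w + a) (by simp [hw]), ← hfg (w + b) (by simp [hw]),
        ← hfg (w + a + b) (Finset.mem_union_right _ (Finset.mem_union_right _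
          (Finset.mem_image_of_mem _ hw)))])
    (fun f g hf hg ⟨w, _, hw⟩ h => congrFun (exP f g hf hg ⟨w, hw⟩ h) 0)
  set ρ := max ρ₁ ρ₂
  set M : ℤ := ρ + P b + Q a
  refine ⟨_, Nat.factorial_pos _, periodic_of_recurrence η h
    (finite_parallelogram P Q hPa hQa.ne' hPb.ne' M).toFinset {z | -M ≤ P z ∧ -M ≤ Q z} ?_ ?_ ?_⟩
  · rintro z ⟨h1, h2⟩
    simp only [Set.mem_ofPred_eq, map_add]
    constructor <;> linarith
  · intro z
    refine ⟨(P z).natAbs + (Q z).natAbs, ?_⟩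
    simp only [Set.mem_ofPred_eq, map_add, map_nsmul]
    simp only [nsmul_eq_mul]
    have k1 := neg_abs_le (P z)
    have k2 := neg_abs_le (Q z)
    have k3 := abs_nonneg (P z)
    have k4 := abs_nonneg (Q z)
    push_cast
    have hM0 : 0 ≤ M := by omega
    constructor <;> nlinarith
  · intro j j' hjj z hz
    let δ : ℤ × ℤ → ℤ := fun z => (ι ∘ η) (z + j • h) - (ι ∘ η) (z + j' • h)
    have hzero : ∀ y, δ y = 0 → η (y + j • h) = η (y + j' • h) := fun y hy =>
      hι (sub_eq_zero.1 hy)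
    have hzero' : ∀ y, η (y + j • h) = η (y + j' • h) → δ y = 0 := fun y hy =>
      sub_eq_zero.2 (congrArg ι hy)
    set β := shiftDiff a (shiftDiff b (ι ∘ η)) with hβ
    have hβp : ∀ z, β (z + h) = β z := fun z => sub_eq_zero.1 (kill z)
    refine hzero z (vanish_on_quadrant (δ := δ) hPa hQb hQa hPb hPh hQh ?_ (ρ := ρ) (M := M) ?_ ?_
      ?_ ?_ ?_ ?_ z hz.1 hz.2)
    · intro y
      have e : shiftDiff a (shiftDiff b δ) y = β (y + j • h) - β (y + j' • h) := by
        have t1 : ∀ i : ℤ, y + a + b + i • h = y + i • h + a + b := fun i => by abel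
        have t2 : ∀ i : ℤ, y + a + i • h = y + i • h + a := fun i => by abel
        have t3 : ∀ i : ℤ, y + b + i • h = y + i • h + b := fun i => by abel
        simp only [δ, hβ, shiftDiff, t1, t2, t3]
        ring
      rw [e, periodic_zsmul hβp, periodic_zsmul hβp, sub_self]
    · intro y hy
      refine hzero' y ?_
      have := hρ₁ _ _ ((Occ.refl η).shift (y + j • h)) ((Occ.refl η).shift (y + j' • h)) trivial
        (fun w hw hwN => ?_)
      · simpa using this
      · obtain ⟨h1, h2⟩ := hN w _ (hwN.trans (le_max_left ρ₁ ρ₂))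
        have := hzero _ (hy w hw h1 h2)
        rwa [add_comm y w, add_assoc, add_assoc] at this
    · intro i y y1 y2 y3 y4 hy
      refine hzero' y ?_
      have := hρ₂ _ _ ((Occ.refl η).shift (y + j • h)) ((Occ.refl η).shift (y + j' • h))
        ⟨i • h - y, hC _ ?_ ?_, ?_⟩ (fun w hw hwN => ?_)
      · simpa using this
      · simp only [map_sub, map_nsmul, abs_le]
        simp only [nsmul_eq_mul]
        constructor <;> linarith
      · simp only [map_sub, map_nsmul, abs_le]
        simp only [nsmul_eq_mul]
        constructor <;> linarith
      · have e : shiftDiff a (shiftDiff b (ι ∘ fun z => η (z + (y + j • h)))) =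
            fun z => β (z + (y + j • h)) := by
          rw [hβ, ← shiftDiff_translate, ← shiftDiff_translate]
          rfl
        rw [e]
        change β (i • h - y + (y + j • h)) ≠ 0
        rw [show i • h - y + (y + j • h) = 0 + i • h + j • h by abel, periodic_zsmul hβp,
          periodic_nsmul hβp]
        exact bad
      · obtain ⟨h1, h2⟩ := hN w _ (hwN.trans (le_max_right ρ₁ ρ₂))
        have := hzero _ (hy w hw h1 h2)
        rwa [add_comm y w, add_assoc, add_assoc] at this
    · omega
    · omega
    · omega
    · intro y y1 y2
      exact hzero' y (hjj y (by simpa using ⟨y1, y2⟩))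

theorem shiftDiff_neg {G : Type*} [AddCommGroup G] (u : ℤ × ℤ) (w : ℤ × ℤ → G) (z : ℤ × ℤ) :
    shiftDiff (-u) w z = -shiftDiff u w (z - u) := by
  simp [shiftDiff, sub_eq_add_neg]

/-- A configuration killed by three differences is periodic along a direction in which two
expansive half-planes move forward. -/
theorem drift {A : Type*} [Finite A] {η : ℤ × ℤ → A} {ι : A → ℤ}
    (hι : Function.Injective ι) (P Q : ℤ × ℤ →+ ℤ) (a b h : ℤ × ℤ) (hPa : P a = 0)
    (hQb : Q b = 0) (hQa : Q a ≠ 0) (hPb : P b ≠ 0) (hPh : 0 < P h) (hQh : 0 < Q h)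
    (kill : ∀ z, shiftDiff h (shiftDiff a (shiftDiff b (ι ∘ η))) z = 0)
    (bad : ∃ z, shiftDiff a (shiftDiff b (ι ∘ η)) z ≠ 0)
    (exP : ∀ f g, Occ η f → Occ η g → (∃ z, shiftDiff a (shiftDiff b (ι ∘ f)) z ≠ 0) →
      (∀ z, P z < 0 → f z = g z) → f = g)
    (exQ : ∀ f g, Occ η f → Occ η g → (∀ z, Q z < 0 → f z = g z) → f = g) :
    ∃ J : ℕ, 0 < J ∧ ∀ z, η (z + J • h) = η z := by
  have negA : ∀ (f : ℤ × ℤ → A) z, shiftDiff (-a) (shiftDiff b (ι ∘ f)) z =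
      -shiftDiff a (shiftDiff b (ι ∘ f)) (z - a) := fun f z => shiftDiff_neg _ _ _
  have negB : ∀ (f : ℤ × ℤ → A) z, shiftDiff a (shiftDiff (-b) (ι ∘ f)) z =
      -shiftDiff a (shiftDiff b (ι ∘ f)) (z - b) := fun f z => by
    rw [shiftDiff_comm, shiftDiff_neg, shiftDiff_comm]
  wlog hQa' : 0 < Q a generalizing a
  · refine this (-a) (by simpa using hPa) (by simpa using hQa) ?_ ?_ ?_ ?_ ?_
      (by simp; omega)
    · intro z
      have e : shiftDiff (-a) (shiftDiff b (ι ∘ η)) =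
        fun z => -shiftDiff a (shiftDiff b (ι ∘ η)) (z - a) := funext (negA η)
      have := kill (z - a)
      simp only [shiftDiff] at this
      rw [e]
      simp only [shiftDiff, sub_eq_add_neg, add_right_comm z h (-a)] at this ⊢
      linarith
    · obtain ⟨z, hz⟩ := bad
      exact ⟨z + a, by rw [negA]; simpa using hz⟩
    · rintro f g hf hg ⟨z, hz⟩ h
      exact exP f g hf hg ⟨z - a, by rw [negA] at hz; simpa using hz⟩ h
    · intro f z; rw [negA]; simp
    · intro f z
      rw [shiftDiff_comm, shiftDiff_neg, shiftDiff_comm]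
  wlog hPb' : 0 < P b generalizing b
  · refine this (-b) (by simpa using hQb) (by simpa using hPb) ?_ ?_ ?_ ?_ ?_
      (by simp; omega)
    · intro z
      have e : shiftDiff a (shiftDiff (-b) (ι ∘ η)) =
        fun z => -shiftDiff a (shiftDiff b (ι ∘ η)) (z - b) := funext (negB η)
      have := kill (z - b)
      rw [e]
      simp only [shiftDiff, sub_eq_add_neg, add_right_comm z h (-b)] at this ⊢
      linarith
    · obtain ⟨z, hz⟩ := bad
      exact ⟨z + b, by rw [negB]; simpa using hz⟩
    · rintro f g hf hg ⟨z, hz⟩ h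
      exact exP f g hf hg ⟨z - b, by rw [negB] at hz; simpa using hz⟩ h
    · intro f z; rw [shiftDiff_neg]
    · intro f z; rw [shiftDiff_comm, shiftDiff_neg, shiftDiff_comm]
  obtain ⟨z₀, hz₀⟩ := bad
  obtain ⟨J, hJ, hper⟩ := drift_of_pos (η := fun z => η (z + z₀)) hι hPa hQb hQa' hPb' hPh hQh
    (fun z => by
      have := kill (z + z₀)
      rw [show (ι ∘ fun z => η (z + z₀)) = fun z => (ι ∘ η) (z + z₀) from rfl,
        shiftDiff_translate, shiftDiff_translate, shiftDiff_translate]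
      exact this)
    (by
      rw [show (ι ∘ fun z => η (z + z₀)) = fun z => (ι ∘ η) (z + z₀) from rfl,
        shiftDiff_translate, shiftDiff_translate]
      simpa using hz₀)
    (fun f g hf hg => exP f g hf.of_translate hg.of_translate)
    (fun f g hf hg => exQ f g hf.of_translate hg.of_translate)
  refine ⟨J, hJ, fun z => ?_⟩
  have := hper (z - z₀)
  rwa [sub_add_cancel, sub_add_eq_add_sub, sub_add_cancel] at this

/-! ### Dilation of annihilators in the group ring -/

/-- The group ring of `ℤ × ℤ` acting on integer configurations by translations. -/
noncomputable def translateAction :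
    AddMonoidAlgebra ℤ (ℤ × ℤ) →ₐ[ℤ] Module.End ℤ (ℤ × ℤ → ℤ) :=
  AddMonoidAlgebra.lift ℤ _ _
    { toFun := fun u =>
        { toFun := fun w z => w (z + u.toAdd)
          map_add' := fun _ _ => rfl
          map_smul' := fun _ _ => rfl }
      map_one' := by
        ext w z
        simp
      map_mul' := by
        intro a b
        ext w z
        simp [add_assoc] }

/-- The monomial with exponent `u`. -/
noncomputable def monom (u : ℤ × ℤ) : AddMonoidAlgebra ℤ (ℤ × ℤ) := AddMonoidAlgebra.single u 1

theorem monom_add (u u' : ℤ × ℤ) : monom (u + u') = monom u * monom u' := by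
  simp [monom, AddMonoidAlgebra.single_mul_single]

theorem monom_nsmul (n : ℕ) (u : ℤ × ℤ) : monom (n • u) = monom u ^ n := by
  simp [monom, AddMonoidAlgebra.single_pow]

theorem translateAction_monom (u : ℤ × ℤ) (w : ℤ × ℤ → ℤ) (z : ℤ × ℤ) :
    translateAction (monom u) w z = w (z + u) := by
  simp [translateAction, monom, AddMonoidAlgebra.lift_single]

theorem translateAction_intCast (c : ℤ) (w : ℤ × ℤ → ℤ) (z : ℤ × ℤ) :
    translateAction (c : AddMonoidAlgebra ℤ (ℤ × ℤ)) w z = c * w z := by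
  rw [map_intCast, Module.End.intCast_apply]
  simp

theorem translateAction_sum {I : Type*} (S : Finset I) (c : I → ℤ) (e : I → ℤ × ℤ)
    (w : ℤ × ℤ → ℤ) (z : ℤ × ℤ) :
    translateAction (∑ s ∈ S, (c s : AddMonoidAlgebra ℤ (ℤ × ℤ)) * monom (e s)) w z
      = ∑ s ∈ S, c s * w (z + e s) := by
  rw [map_sum, LinearMap.sum_apply, Finset.sum_apply]
  refine Finset.sum_congr rfl fun s _ => ?_
  rw [map_mul, Module.End.mul_apply, translateAction_intCast, translateAction_monom]

/-- The `q`-th power is additive modulo `q`, and Fermat's congruence fixes the integer coefficients.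
-/
theorem frobenius_congruence {I : Type*} (S : Finset I) (c : I → ℤ) (e : I → ℤ × ℤ) {q : ℕ}
    (hq : q.Prime) : ∃ r, (∑ s ∈ S, (c s : AddMonoidAlgebra ℤ (ℤ × ℤ)) * monom (e s)) ^ q
      = ∑ s ∈ S, (c s : AddMonoidAlgebra ℤ (ℤ × ℤ)) * monom (q • e s)
        + (q : AddMonoidAlgebra ℤ (ℤ × ℤ)) * r := by
  classical
  have := Fact.mk hq
  induction S using Finset.induction_on with
  | empty => exact ⟨0, by simp [hq.ne_zero]⟩
  | insert a S ha ih =>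
    obtain ⟨r, hr⟩ := ih
    rw [Finset.sum_insert ha, Finset.sum_insert ha]
    obtain ⟨r', hr'⟩ := exists_add_pow_prime_eq hq
      ((c a : AddMonoidAlgebra ℤ (ℤ × ℤ)) * monom (e a))
      (∑ s ∈ S, (c s : AddMonoidAlgebra ℤ (ℤ × ℤ)) * monom (e s))
    obtain ⟨k, hk⟩ : (q : ℤ) ∣ c a ^ q - c a := by
      rw [← ZMod.intCast_zmod_eq_zero_iff_dvd _ q]
      simp [ZMod.pow_card]
    have hk' : (c a : AddMonoidAlgebra ℤ (ℤ × ℤ)) ^ q = c a + q * (k : AddMonoidAlgebra ℤ (ℤ × ℤ)) := by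
      rw [← Int.cast_pow, sub_eq_iff_eq_add.1 hk]
      push_cast
      ring
    rw [hr', hr, mul_pow, hk', monom_nsmul]
    generalize ∑ s ∈ S, (c s : AddMonoidAlgebra ℤ (ℤ × ℤ)) * monom (q • e s) = Y
    generalize ∑ s ∈ S, (c s : AddMonoidAlgebra ℤ (ℤ × ℤ)) * monom (e s) = Z
    exact ⟨k * monom (e a) ^ q + r + c a * monom (e a) * Z * r', by ring⟩

theorem annihilate_pow {f : AddMonoidAlgebra ℤ (ℤ × ℤ)} {v : ℤ × ℤ → ℤ}
    (hf : translateAction f v = 0) (g : AddMonoidAlgebra ℤ (ℤ × ℤ)) :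
    translateAction (g * f) v = 0 := by
  rw [map_mul, Module.End.mul_apply, hf, map_zero]

/-- By `frobenius_congruence` the dilated sum is a multiple of `q`, and the bound on `v` makes it
smaller than `q` in absolute value. -/
theorem annihilate_dilate_prime {I : Type*} (S : Finset I) (c : I → ℤ) (e : I → ℤ × ℤ)
    {v : ℤ × ℤ → ℤ} {B : ℤ} (hv : ∀ z, |v z| ≤ B) {q : ℕ} (hq : q.Prime)
    (hqB : ∑ s ∈ S, |c s| * B < q) (h : ∀ z, ∑ s ∈ S, c s * v (z + e s) = 0) (z : ℤ × ℤ) :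
    ∑ s ∈ S, c s * v (z + q • e s) = 0 := by
  obtain ⟨r, hr⟩ := frobenius_congruence S c e hq
  have h0 : translateAction (∑ s ∈ S, (c s : AddMonoidAlgebra ℤ (ℤ × ℤ)) * monom (e s)) v = 0 := by
    funext z
    rw [translateAction_sum]
    exact h z
  have h1 : translateAction
      ((∑ s ∈ S, (c s : AddMonoidAlgebra ℤ (ℤ × ℤ)) * monom (e s)) ^ q) v = 0 := by
    rw [← Nat.sub_add_cancel hq.one_le, pow_succ]
    exact annihilate_pow h0 _
  rw [hr, map_add, LinearMap.add_apply, map_mul, Module.End.mul_apply] at h1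
  have h2 := congrFun h1 z
  rw [Pi.add_apply, translateAction_sum, ← Int.cast_natCast, translateAction_intCast,
    Pi.zero_apply] at h2
  refine Int.eq_zero_of_abs_lt_dvd (m := q) ⟨-translateAction r v z, by linarith⟩ ?_
  refine lt_of_le_of_lt ((Finset.abs_sum_le_sum_abs _ _).trans (Finset.sum_le_sum fun s _ => ?_)) hqB
  rw [abs_mul]
  exact mul_le_mul_of_nonneg_left (hv _) (abs_nonneg _)

theorem annihilate_dilate {I : Type*} (S : Finset I) (c : I → ℤ) (e : I → ℤ × ℤ)
    {v : ℤ × ℤ → ℤ} {B : ℤ} (hv : ∀ z, |v z| ≤ B)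
    (h : ∀ z, ∑ s ∈ S, c s * v (z + e s) = 0) (m : ℕ) (hm : m ≠ 0)
    (hmq : ∀ q : ℕ, q.Prime → q ∣ m → ∑ s ∈ S, |c s| * B < q) (z : ℤ × ℤ) :
    ∑ s ∈ S, c s * v (z + m • e s) = 0 := by
  induction m using induction_on_primes generalizing z with
  | zero => exact absurd rfl hm
  | one => simpa using h z
  | prime_mul q m hq ih =>
    have := annihilate_dilate_prime S c (fun s => m • e s) hv hq (hmq q hq (dvd_mul_right _ _))
      (ih (right_ne_zero_of_mul hm) fun q' hq' hd => hmq q' hq' (hd.mul_left _)) z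
    simpa only [mul_smul] using this

/-! ### Products of differences that kill a configuration -/

/-- The configuration `l` kills `v`: the iterated differences along `l` vanish. -/
def Kills (v : ℤ × ℤ → ℤ) (l : List (ℤ × ℤ)) : Prop := l.foldr shiftDiff v = 0

theorem translateAction_prod_sub (w : ℤ × ℤ → ℤ) (a : ℤ × ℤ) (l : List (ℤ × ℤ)) :
    ∃ t, ∀ z, translateAction (l.map fun b => monom a - monom b).prod w z
      = (l.map fun b => a - b).foldr shiftDiff w (z + t) := by
  induction l with
  | nil => exact ⟨0, by simp⟩
  | cons b l ih =>
    obtain ⟨t, ht⟩ := ih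
    refine ⟨b + t, fun z => ?_⟩
    rw [List.map_cons, List.prod_cons, map_mul, Module.End.mul_apply, map_sub,
      LinearMap.sub_apply, Pi.sub_apply, translateAction_monom, translateAction_monom, ht, ht,
      List.map_cons, List.foldr_cons, shiftDiff]
    congr 2
    · abel_nf
    · abel_nf

/-- Since `r` is divisible by every prime up to the bound in `annihilate_dilate`, the dilations by
`1 + i * r` all annihilate `v`. Hence so does `∑ c s X^s p(X^(r s))` for every polynomial `p`.
Choosing `p` with roots `X^(r s)` for `s ≠ s₀` leaves one term, a product of binomials `X^(r s₀) -
X^(r s)`, which are differences up to translation. -/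
theorem exists_kills {v : ℤ × ℤ → ℤ} {B : ℤ} (hv : ∀ z, |v z| ≤ B) (S : Finset (ℤ × ℤ))
    (c : ℤ × ℤ → ℤ) (hc : ∃ s ∈ S, c s ≠ 0) (h : ∀ z, ∑ s ∈ S, c s * v (z + s) = 0) :
    ∃ l : List (ℤ × ℤ), (∀ u ∈ l, u ≠ 0) ∧ Kills v l := by
  classical
  obtain ⟨s₀, hs₀, hcs₀⟩ := hc
  set C := ∑ s ∈ S, |c s| * B with hC
  set r := C.toNat.factorial with hr
  have hr0 : r ≠ 0 := Nat.factorial_ne_zero _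
  have hdil : ∀ i : ℕ, translateAction (∑ s ∈ S, (c s : AddMonoidAlgebra ℤ (ℤ × ℤ)) * monom s
      * monom (r • s) ^ i) v = 0 := by
    intro i
    have h1 : ∀ z, ∑ s ∈ S, c s * v (z + (1 + i * r) • s) = 0 := by
      refine annihilate_dilate S c id hv h (1 + i * r) (by omega) ?_
      intro q hq hqd
      by_contra hlt
      have : q ∣ r := hq.dvd_factorial.2 (by omega)
      have := (Nat.dvd_add_left (this.mul_left i)).1 hqd
      exact hq.one_lt.ne' (Nat.dvd_one.1 this)
    funext z
    have h2 := translateAction_sum S c (fun s => (1 + i * r) • s) v z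
    rw [h1] at h2
    rw [Pi.zero_apply, ← h2, Finset.sum_congr rfl fun s _ => ?_]
    rw [add_smul, one_smul, monom_add, mul_assoc, ← monom_nsmul, smul_smul]
  have hpoly : ∀ p : Polynomial (AddMonoidAlgebra ℤ (ℤ × ℤ)), translateAction
      (∑ s ∈ S, (c s : AddMonoidAlgebra ℤ (ℤ × ℤ)) * monom s * p.eval (monom (r • s))) v = 0 := by
    intro p
    induction p using Polynomial.induction_on' with
    | add p q hp hq =>
      simp only [Polynomial.eval_add, mul_add, Finset.sum_add_distrib, map_add,
        LinearMap.add_apply, hp, hq, add_zero]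
    | monomial n a =>
      have := annihilate_pow (hdil n) a
      rw [Finset.mul_sum] at this
      simp only [Polynomial.eval_monomial]
      rw [← this]
      congr 2
      exact Finset.sum_congr rfl fun s _ => by ring
  have hL := hpoly (((S.erase s₀).toList.map fun s => Polynomial.X - Polynomial.C (monom (r • s))).prod)
  rw [Finset.sum_eq_single_of_mem s₀ hs₀] at hL
  · refine ⟨(S.erase s₀).toList.map fun s => r • s₀ - r • s, ?_, ?_⟩
    · intro u hu
      rw [List.mem_map] at hu
      obtain ⟨s, hs, rfl⟩ := hu
      rw [Finset.mem_toList, Finset.mem_erase] at hs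
      rw [← smul_sub]
      exact smul_ne_zero hr0 (sub_ne_zero.2 hs.1.symm)
    · have e : (((S.erase s₀).toList.map fun s => Polynomial.X - Polynomial.C
          (monom (r • s))).prod).eval (monom (r • s₀)) =
          (((S.erase s₀).toList.map (r • ·)).map fun b => monom (r • s₀) - monom b).prod := by
        rw [Polynomial.eval_list_prod, List.map_map, List.map_map]
        congr 2
        funext s
        simp
      obtain ⟨t, ht⟩ := translateAction_prod_sub v (r • s₀) ((S.erase s₀).toList.map (r • ·))
      rw [e, map_mul, Module.End.mul_apply, map_mul, Module.End.mul_apply] at hL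
      funext z
      have := congrFun hL (z - t - s₀)
      rw [translateAction_intCast, translateAction_monom, ht, sub_add_cancel, sub_add_cancel,
        List.map_map] at this
      exact (mul_eq_zero.1 this).resolve_left hcs₀
  · intro s hs hne
    rw [Polynomial.eval_list_prod, List.prod_eq_zero, mul_zero]
    rw [List.map_map, List.mem_map]
    exact ⟨s, by simp [hs, hne], by simp⟩

open scoped Pointwise in
-- The constant cancels when the relation is subtracted from its translate by `e`; with `e` outside
-- `S - S` the two supports are disjoint and no coefficient is lost.
theorem exists_kills_of_relation {v : ℤ × ℤ → ℤ} {B : ℤ} (hv : ∀ z, |v z| ≤ B)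
    (S : Finset (ℤ × ℤ)) (F : ℤ × ℤ → ℤ) (hF : ∃ s ∈ S, F s ≠ 0) (hF0 : ∀ s ∉ S, F s = 0) (c : ℤ)
    (h : ∀ z, ∑ s ∈ S, F s * v (s + z) = c) :
    ∃ l : List (ℤ × ℤ), (∀ u ∈ l, u ≠ 0) ∧ Kills v l := by
  classical
  obtain ⟨e, he⟩ := Infinite.exists_notMem_finset (S - S)
  have hdis : ∀ s ∈ S, s - e ∉ S := fun s hs hse =>
    he (by simpa using Finset.sub_mem_sub hs hse)
  refine exists_kills hv (S ∪ S.image (· + e)) (fun s => F (s - e) - F s) ?_ ?_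
  · obtain ⟨s, hs, hne⟩ := hF
    exact ⟨s, by simp [hs], by rw [hF0 _ (hdis s hs)]; simpa using hne⟩
  · intro z
    simp only [sub_mul, Finset.sum_sub_distrib]
    rw [← Finset.sum_subset (Finset.subset_union_right (s₁ := S)),
      ← Finset.sum_subset (Finset.subset_union_left (s₂ := S.image (· + e))),
      Finset.sum_image fun _ _ _ _ => add_right_cancel]
    · have h1 := h (z + e)
      have h2 := h z
      simp only [add_sub_cancel_right]
      rw [← h2] at h1
      rw [sub_eq_zero]
      convert h1 using 4
      · abel
      · rw [add_comm]
    · intro s _ hs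
      rw [hF0 s hs, zero_mul]
    · intro s _ hs
      rw [hF0 (s - e), zero_mul]
      intro h
      exact hs (by simpa using Finset.mem_image_of_mem (· + e) h)

theorem shiftDiff_eq_zero_iff {G : Type*} [AddCommGroup G] {u : ℤ × ℤ} {w : ℤ × ℤ → G} :
    shiftDiff u w = 0 ↔ ∀ z, w (z + u) = w z := by
  rw [funext_iff]
  exact forall_congr' fun z => sub_eq_zero

theorem finite_range_shiftDiff {w : ℤ × ℤ → ℤ} (hw : (Set.range w).Finite) (u : ℤ × ℤ) :
    (Set.range (shiftDiff u w)).Finite := by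
  refine (hw.image2 (fun x y => x - y) hw).subset ?_
  rintro _ ⟨z, rfl⟩
  exact ⟨_, ⟨z + u, rfl⟩, _, ⟨z, rfl⟩, rfl⟩

theorem finite_range_foldr {v : ℤ × ℤ → ℤ} (hv : (Set.range v).Finite) (l : List (ℤ × ℤ)) :
    (Set.range (l.foldr shiftDiff v)).Finite := by
  induction l with
  | nil => exact hv
  | cons u l ih => exact finite_range_shiftDiff ih u

/-- If the difference is itself `u`-periodic, `w` is linear along `u`, and finitely many values
force slope zero. -/
theorem shiftDiff_eq_zero_of_sq {w : ℤ × ℤ → ℤ} (hw : (Set.range w).Finite) {u : ℤ × ℤ}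
    (h : shiftDiff u (shiftDiff u w) = 0) : shiftDiff u w = 0 := by
  funext z
  by_contra hne
  have h1 := shiftDiff_eq_zero_iff.1 h
  have h2 : ∀ n : ℕ, w (z + n • u) = w z + n * shiftDiff u w z := by
    intro n
    induction n with
    | zero => simp
    | succ n ih =>
      have := periodic_nsmul h1 n z
      rw [succ_nsmul, ← add_assoc]
      rw [shiftDiff, ih, sub_eq_iff_eq_add] at this
      rw [this]
      push_cast
      ring
  refine Set.infinite_of_injective_forall_mem (s := Set.range w) (f := fun n : ℕ => w (z + n • u))
    ?_ (fun n => ⟨_, rfl⟩) hw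
  intro m n hmn
  simp only [h2, add_right_inj] at hmn
  exact_mod_cast mul_right_cancel₀ hne hmn

theorem Kills.perm {v : ℤ × ℤ → ℤ} {l l' : List (ℤ × ℤ)} (h : Kills v l) (hp : l.Perm l') :
    Kills v l' := by
  have : LeftCommutative (shiftDiff : ℤ × ℤ → (ℤ × ℤ → ℤ) → _) := ⟨shiftDiff_comm⟩
  unfold Kills at *
  rw [← hp.foldr_eq, h]

theorem Kills.swap {v : ℤ × ℤ → ℤ} {a b : ℤ × ℤ} {l : List (ℤ × ℤ)} (h : Kills v (a :: b :: l)) :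
    Kills v (b :: a :: l) := h.perm (List.Perm.swap _ _ _)

theorem Kills.swap_tail {v : ℤ × ℤ → ℤ} {a b c : ℤ × ℤ} {l : List (ℤ × ℤ)}
    (h : Kills v (a :: b :: c :: l)) : Kills v (a :: c :: b :: l) :=
  h.perm ((List.Perm.swap _ _ _).cons _)

theorem Kills.cons {v : ℤ × ℤ → ℤ} {l : List (ℤ × ℤ)} (h : Kills v l) (u : ℤ × ℤ) :
    Kills v (u :: l) := by
  unfold Kills at *
  rw [List.foldr_cons, h]
  funext z
  simp [shiftDiff]

theorem Kills.zsmul {v : ℤ × ℤ → ℤ} {u : ℤ × ℤ} {l : List (ℤ × ℤ)} (h : Kills v (u :: l))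
    (k : ℤ) : Kills v (k • u :: l) :=
  shiftDiff_eq_zero_iff.2 (periodic_zsmul (shiftDiff_eq_zero_iff.1 h) k)

/-- Both directions can be replaced by their common multiple, which then occurs twice and is reduced
by `shiftDiff_eq_zero_of_sq`. -/
theorem Kills.merge {v : ℤ × ℤ → ℤ} (hv : (Set.range v).Finite) {u u' : ℤ × ℤ}
    {l : List (ℤ × ℤ)} (h : Kills v (u :: u' :: l)) {k k' : ℤ} (hk : k • u = k' • u') :
    Kills v (k • u :: l) := by
  have h1 := h.zsmul k
  have h2 := (h1.perm (List.Perm.swap _ _ _)).zsmul k'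
  rw [← hk] at h2
  exact shiftDiff_eq_zero_of_sq (finite_range_foldr hv l) h2

theorem exists_common_multiple {u u' : ℤ × ℤ} (hu : u ≠ 0) (hu' : u' ≠ 0)
    (hd : u.1 * u'.2 = u'.1 * u.2) : ∃ k k' : ℤ, k ≠ 0 ∧ k' ≠ 0 ∧ k • u = k' • u' := by
  obtain ⟨a, b⟩ := u
  obtain ⟨c, d⟩ := u'
  simp only [ne_eq, Prod.mk_eq_zero, not_and] at *
  by_cases ha : a = 0
  · subst ha
    have hb : b ≠ 0 := hu rfl
    have hc : c = 0 := by simpa [hb, eq_comm] using hd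
    subst hc
    refine ⟨d, b, hu' rfl, hb, ?_⟩
    ext <;> simp [mul_comm]
  · have hc : c ≠ 0 := by
      rintro rfl
      exact hu' rfl (by simpa [ha] using hd)
    refine ⟨c, a, hc, ha, ?_⟩
    ext <;> simp <;> linarith

/-- Modulo `u` the strip `|P| ≤ N` is finite, and the unique maximal point `t` lets the relation
compute each higher level from lower ones, so `periodic_of_recurrence` applies. That `J` is chosen
before `ζ` matters in `exists_period_beyond_strip`. -/
theorem exists_period_of_unique_max {V : Set ℤ} (hV : V.Finite) {u : ℤ × ℤ} (hu : u ≠ 0)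
    (S : Finset (ℤ × ℤ)) (F : ℤ × ℤ → ℤ) {t : ℤ × ℤ} (ht : t ∈ S) (hFt : F t ≠ 0)
    (P : ℤ × ℤ →+ ℤ) (hPu : P u = 0) (hmax : ∀ s ∈ S, F s ≠ 0 → s ≠ t → P s < P t) {h : ℤ × ℤ}
    (hh : 0 < P h) : ∃ J : ℕ, 0 < J ∧ ∀ ζ : ℤ × ℤ → ℤ, (∀ z, ζ z ∈ V) →
      (∀ z, ζ (z + u) = ζ z) → (∃ c, ∀ z, ∑ s ∈ S, F s * ζ (s + z) = c) →
      ∀ z, ζ (z + J • h) = ζ z := by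
  classical
  -- `Q` is the scalar product with `u`; it serves to choose representatives modulo `u`.
  let Q : ℤ × ℤ →+ ℤ := u.1 • AddMonoidHom.fst ℤ ℤ + u.2 • AddMonoidHom.snd ℤ ℤ
  have hQu : Q u ≠ 0 := by
    simp only [Q, AddMonoidHom.add_apply, AddMonoidHom.smul_apply, AddMonoidHom.coe_fst,
      AddMonoidHom.coe_snd, smul_eq_mul]
    intro h0
    apply hu
    ext
    · simp; nlinarith [sq_nonneg u.1, sq_nonneg u.2]
    · simp; nlinarith [sq_nonneg u.1, sq_nonneg u.2]
  set N := ∑ s ∈ S, |P t - P s|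
  have hN0 : 0 ≤ N := Finset.sum_nonneg fun _ _ => abs_nonneg _
  have hN : ∀ s ∈ S, P t - P s ≤ N := fun s hs => (le_abs_self _).trans
    (Finset.single_le_sum (f := fun s => |P t - P s|) (fun _ _ => abs_nonneg _) hs)
  have hfin := finite_parallelogram P Q hPu hQu hh.ne' (N + |Q u|)
  have := hV.to_subtype
  refine ⟨(Nat.card (hfin.toFinset → V)).factorial, Nat.factorial_pos _, ?_⟩
  rintro ζ hζ hper ⟨c, hrel⟩
  have hper' := periodic_of_recurrence (fun z => (⟨ζ z, hζ z⟩ : V)) h hfin.toFinset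
    {z | -N ≤ P z} (by
      intro z hz
      simp only [Set.mem_ofPred_eq, map_add] at *
      linarith) (by
      intro z
      refine ⟨(P z).natAbs, ?_⟩
      simp only [Set.mem_ofPred_eq, map_add, map_nsmul]
      rw [nsmul_eq_mul, Int.natCast_natAbs]
      nlinarith [neg_abs_le (P z), abs_nonneg (P z)]) (by
      intro j j' hjj z hz
      have hjj' : ∀ y, |P y| ≤ N → ζ (y + j • h) = ζ (y + j' • h) := by
        intro y hy
        have e1 := Int.emod_add_mul_ediv (Q y) (Q u)
        have e2 := Int.emod_nonneg (Q y) hQu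
        have e3 := Int.emod_lt_abs (Q y) hQu
        have := congrArg Subtype.val (hjj (y + (-(Q y / Q u)) • u) (by
          rw [Set.Finite.mem_toFinset]
          have h1 : P (y + (-(Q y / Q u)) • u) = P y := by
            rw [map_add, map_zsmul, hPu, smul_zero, add_zero]
          have h2 : Q (y + (-(Q y / Q u)) • u) = Q y % Q u := by
            rw [map_add, map_zsmul, smul_eq_mul]; linarith
          refine ⟨?_, ?_⟩
          · rw [h1]; have := abs_nonneg (Q u); linarith
          · rw [h2, abs_of_nonneg e2]; linarith))
        simp only [add_right_comm y _ (_ • h)] at this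
        rwa [periodic_zsmul hper, periodic_zsmul hper] at this
      have key : ∀ q : ℤ, N ≤ q → ∀ y, -N ≤ P y → P y ≤ q → ζ (y + j • h) = ζ (y + j' • h) := by
        intro q hq
        induction q, hq using Int.leInduction with
        | base => intro y h1 h2; exact hjj' y (abs_le.2 ⟨h1, h2⟩)
        | succ q hq ih =>
          intro y h1 h2
          by_cases h3 : P y ≤ q
          · exact ih y h1 h3
          have r1 := hrel (y + j • h - t)
          have r2 := hrel (y + j' • h - t)
          rw [← r2, ← Finset.add_sum_erase S _ ht, ← Finset.add_sum_erase S _ ht] at r1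
          have r3 : ∑ s ∈ S.erase t, F s * ζ (s + (y + j • h - t)) =
              ∑ s ∈ S.erase t, F s * ζ (s + (y + j' • h - t)) := by
            refine Finset.sum_congr rfl fun s hs => ?_
            rw [Finset.mem_erase] at hs
            by_cases hF : F s = 0
            · simp [hF]
            have := hmax s hs.2 hF hs.1
            have hNs := hN s hs.2
            have := ih (y + (s - t)) (by rw [map_add, map_sub]; linarith)
              (by rw [map_add, map_sub]; linarith)
            rw [show s + (y + j • h - t) = y + (s - t) + j • h by abel, this]
            congr 2
            abel
          rw [r3, add_left_inj, add_sub_cancel, add_sub_cancel] at r1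
          exact mul_left_cancel₀ hFt r1
      exact Subtype.ext (key (max N (P z)) (le_max_left _ _) z hz (le_max_right _ _)))
  exact fun z => congrArg Subtype.val (hper' z)

theorem relation_foldr {v : ℤ × ℤ → ℤ} {S : Finset (ℤ × ℤ)} {F : ℤ × ℤ → ℤ}
    (h : ∃ c, ∀ z, ∑ s ∈ S, F s * v (s + z) = c) (l : List (ℤ × ℤ)) :
    ∃ c, ∀ z, ∑ s ∈ S, F s * l.foldr shiftDiff v (s + z) = c := by
  induction l with
  | nil => exact h
  | cons u l ih =>
    obtain ⟨c, hc⟩ := ih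
    refine ⟨0, fun z => ?_⟩
    simp only [List.foldr_cons, shiftDiff, mul_sub, Finset.sum_sub_distrib, add_assoc, hc, sub_self]

/-- The difference of `v` along `a` has the independent periods `b` and `c`, hence a multiple of `a`
as a period; the repeated direction is then reduced by `Kills.merge`. -/
theorem periodic_of_kills_twice {v : ℤ × ℤ → ℤ} (hv : (Set.range v).Finite) {a b c : ℤ × ℤ}
    (ha : a ≠ 0) (hb : Kills v [a, b]) (hc : Kills v [a, c]) (hd : b.1 * c.2 ≠ c.1 * b.2) :
    ∃ h : ℤ × ℤ, h ≠ 0 ∧ ∀ z, v (z + h) = v z := by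
  have hb' := shiftDiff_eq_zero_iff.1 (hb.perm (List.Perm.swap _ _ _))
  have hc' := shiftDiff_eq_zero_iff.1 (hc.perm (List.Perm.swap _ _ _))
  have hD : b.1 * c.2 - c.1 * b.2 ≠ 0 := sub_ne_zero.2 hd
  set D := b.1 * c.2 - c.1 * b.2 with hDd
  have e : D • a = (a.1 * c.2 - a.2 * c.1) • b + (a.2 * b.1 - a.1 * b.2) • c := by
    ext
    · simp [hDd]; ring
    · simp [hDd]; ring
  refine ⟨D • a, smul_ne_zero hD ha, ?_⟩
  have hk : Kills v [D • a, a] := by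
    refine shiftDiff_eq_zero_iff.2 fun z => ?_
    rw [e, ← add_assoc, periodic_zsmul hc', periodic_zsmul hb']
  have := shiftDiff_eq_zero_iff.1 (hk.merge hv (k := 1) (k' := D) (by rw [one_smul]))
  rwa [one_smul] at this

/-- A killing list of minimal length: its directions are pairwise independent, and every
annihilator is tied at its extreme values in each of its directions. -/
theorem exists_minimal_kills {v : ℤ × ℤ → ℤ} (hv : (Set.range v).Finite)
    (hap : ∀ h : ℤ × ℤ, h ≠ 0 → ¬ ∀ z, v (z + h) = v z)
    (hex : ∃ l : List (ℤ × ℤ), (∀ u ∈ l, u ≠ 0) ∧ Kills v l) :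
    ∃ l : List (ℤ × ℤ), Kills v l ∧ (∀ u ∈ l, u ≠ 0) ∧ 2 ≤ l.length ∧
      (∀ l' : List (ℤ × ℤ), (∀ u ∈ l', u ≠ 0) → Kills v l' → l.length ≤ l'.length) ∧
      l.Pairwise (fun u u' => u.1 * u'.2 ≠ u'.1 * u.2) ∧
      ∀ (S : Finset (ℤ × ℤ)) (F : ℤ × ℤ → ℤ), (∃ c, ∀ z, ∑ s ∈ S, F s * v (s + z) = c) →
        ∀ u ∈ l, ∀ P : ℤ × ℤ →+ ℤ, P ≠ 0 → P u = 0 → ∀ t ∈ S, F t ≠ 0 →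
          ∃ s ∈ S, F s ≠ 0 ∧ s ≠ t ∧ P t ≤ P s := by
  classical
  have hex' : ∃ n, ∃ l : List (ℤ × ℤ), l.length = n ∧ (∀ u ∈ l, u ≠ 0) ∧ Kills v l :=
    ⟨_, hex.choose, rfl, hex.choose_spec⟩
  obtain ⟨l, hln, hl0, hlk⟩ := Nat.find_spec hex'
  have hmin : ∀ l' : List (ℤ × ℤ), (∀ u ∈ l', u ≠ 0) → Kills v l' → l.length ≤ l'.length :=
    fun l' h1 h2 => hln ▸ Nat.find_min' hex' ⟨l', rfl, h1, h2⟩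
  have hlen : 2 ≤ l.length := by
    match l, hlk, hl0 with
    | [], h, _ =>
      refine absurd (fun z => ?_) (hap (1, 0) (by simp))
      exact (congrFun h _).trans (congrFun h z).symm
    | [u], h, h0 => exact absurd (shiftDiff_eq_zero_iff.1 h) (hap u (h0 u (by simp)))
    | _ :: _ :: _, _, _ => simp
  have hpair : ∀ {u u' : ℤ × ℤ} {l' : List (ℤ × ℤ)}, l.Perm (u :: u' :: l') →
      u.1 * u'.2 ≠ u'.1 * u.2 := by
    intro u u' l' hp hd
    have hu : u ≠ 0 := hl0 u (hp.mem_iff.2 (by simp))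
    obtain ⟨k, k', hk, hk', e⟩ := exists_common_multiple hu
      (hl0 u' (hp.mem_iff.2 (by simp))) hd
    have := hmin _ ?_ ((hlk.perm hp).merge hv e)
    · rw [hp.length_eq] at this
      simp at this
    · intro w hw
      rw [List.mem_cons] at hw
      rcases hw with rfl | hw
      · exact smul_ne_zero hk hu
      · exact hl0 w (hp.mem_iff.2 (by simp [hw]))
  refine ⟨l, hlk, hl0, hlen, hmin, ?_, ?_⟩
  · rw [List.pairwise_iff_forall_sublist]
    intro a b hab
    obtain ⟨l', hl'⟩ := hab.exists_perm_append
    exact hpair hl'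
  · intro S F hrel u hu P hP hPu t ht hFt
    by_contra! hcon
    have hp := List.perm_cons_erase hu
    obtain ⟨u', l', hl'⟩ : ∃ u' l', l.erase u = u' :: l' := by
      apply List.exists_cons_of_length_pos
      have := hp.length_eq
      rw [List.length_cons] at this
      omega
    rw [hl'] at hp
    have hu' : u' ≠ 0 := hl0 u' (hp.mem_iff.2 (by simp))
    have hPu' : P u' ≠ 0 := by
      intro h0
      apply hP
      have hd := hpair hp
      rw [functional_apply] at hPu h0
      have e1 : (u.1 * u'.2 - u'.1 * u.2) * P (1, 0) = 0 := by
        linear_combination u'.2 * hPu - u.2 * h0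
      have e2 : (u.1 * u'.2 - u'.1 * u.2) * P (0, 1) = 0 := by
        linear_combination u.1 * h0 - u'.1 * hPu
      refine AddMonoidHom.ext fun z => ?_
      rw [functional_apply, (mul_eq_zero.1 e1).resolve_left (sub_ne_zero.2 hd),
        (mul_eq_zero.1 e2).resolve_left (sub_ne_zero.2 hd)]
      simp
    obtain ⟨ε, hε0, hε⟩ : ∃ ε : ℤ, ε ≠ 0 ∧ 0 < P (ε • u') := by
      rcases hPu'.lt_or_gt with h | h
      · exact ⟨-1, by simp, by simpa using h⟩
      · exact ⟨1, by simp, by simpa using h⟩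
    -- The difference of `v` along all directions but `u` is `u`-periodic and satisfies the
    -- relation. An untied maximum would give it a period along `u'`, and merging that with `u'`
    -- would produce a shorter list without `u`.
    obtain ⟨c, hc⟩ := relation_foldr hrel (u' :: l')
    obtain ⟨J, hJ, hper⟩ := exists_period_of_unique_max (finite_range_foldr hv (u' :: l'))
      (hl0 u hu) S F ht hFt P hPu (fun s hs hFs hst => hcon s hs hFs hst) hε
    replace hper := hper _ (fun z => ⟨z, rfl⟩) (shiftDiff_eq_zero_iff.1 (hlk.perm hp)) ⟨c, hc⟩
    have hk : Kills v (J • ε • u' :: u' :: l') := shiftDiff_eq_zero_iff.2 hper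
    have hm := hk.merge hv (k := 1) (k' := J * ε) (by
      rw [one_smul, mul_smul, natCast_zsmul])
    have := hmin _ ?_ hm
    · rw [hp.length_eq] at this
      simp at this
    · intro w hw
      rw [List.mem_cons] at hw
      rcases hw with rfl | hw
      · rw [one_smul]
        exact smul_ne_zero hJ.ne' (smul_ne_zero hε0 hu')
      · exact hl0 w (hp.mem_iff.2 (by simp [hw]))

/-! ### Three rows allow two slanted directions -/

/-- Adding the two inequalities gives `(s'.2 - s.2) * (x' - x) ≤ 0`: maximisers move to lower rows
as the slope parameter grows. -/
theorem row_antitone_of_max {s s' : ℤ × ℤ} {x x' : ℚ} (hx : x < x')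
    (h1 : (s'.1 : ℚ) - s'.2 * x ≤ s.1 - s.2 * x) (h2 : (s.1 : ℚ) - s.2 * x' ≤ s'.1 - s'.2 * x') :
    s'.2 ≤ s.2 := by
  have : (s'.2 : ℚ) ≤ s.2 := by nlinarith
  exact_mod_cast this

/-- A support meeting three rows has at most two slopes at which its maximum is tied. -/
theorem not_three_ties {S : Set (ℤ × ℤ)} (hS : ∀ s ∈ S, 0 ≤ s.2 ∧ s.2 ≤ 2) {T : Set ℚ}
    (hT : ∀ x ∈ T, ∃ s ∈ S, ∃ s' ∈ S, s.2 < s'.2 ∧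
      (∀ r ∈ S, (r.1 : ℚ) - r.2 * x ≤ s.1 - s.2 * x) ∧
      (∀ r ∈ S, (r.1 : ℚ) - r.2 * x ≤ s'.1 - s'.2 * x)) {x y z : ℚ} (hx : x ∈ T) (hy : y ∈ T)
    (hz : z ∈ T) (hxy : x < y) (hyz : y < z) : False := by
  obtain ⟨a, ha, a', ha', h1, h2, h3⟩ := hT x hx
  obtain ⟨b, hb, b', hb', h4, h5, h6⟩ := hT y hy
  obtain ⟨c, hc, c', hc', h7, h8, h9⟩ := hT z hz
  -- The ties would occupy rows `c.2 < c'.2 ≤ b.2 < b'.2 ≤ a.2 < a'.2`, at least four of them.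
  have k1 := row_antitone_of_max hxy (h2 b' hb') (h6 a ha)
  have k2 := row_antitone_of_max hyz (h5 c' hc') (h9 b hb)
  have := hS a' ha'
  have := hS c hc
  omega

theorem not_three_ties' {S : Set (ℤ × ℤ)} (hS : ∀ s ∈ S, 0 ≤ s.2 ∧ s.2 ≤ 2) {T : Set ℚ}
    (hT : ∀ x ∈ T, ∃ s ∈ S, ∃ s' ∈ S, s.2 < s'.2 ∧
      (∀ r ∈ S, (r.1 : ℚ) - r.2 * x ≤ s.1 - s.2 * x) ∧
      (∀ r ∈ S, (r.1 : ℚ) - r.2 * x ≤ s'.1 - s'.2 * x)) {x y z : ℚ} (hx : x ∈ T) (hy : y ∈ T)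
    (hz : z ∈ T) (hxy : x ≠ y) (hyz : y ≠ z) (hxz : x ≠ z) : False := by
  have := @not_three_ties S hS T hT
  rcases hxy.lt_or_gt with h1 | h1 <;> rcases hyz.lt_or_gt with h2 | h2 <;>
    rcases hxz.lt_or_gt with h3 | h3
  · exact this hx hy hz h1 h2
  · exact absurd (h1.trans h2) h3.not_gt
  · exact this hx hz hy h3 h2
  · exact this hz hx hy h3 h1
  · exact this hy hx hz h1 h3
  · exact this hy hz hx h2 h3
  · exact absurd (h2.trans h1) h3.not_gt
  · exact this hz hy hx h2 h1

/-- In a minimal killing list `not_three_ties'` leaves at most two slanted directions and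
independence at most one horizontal one. The last clause is what later provides the hypothesis `bad`
of `exists_nonexpansive_pair`. -/
theorem killing_directions {v : ℤ × ℤ → ℤ} (hv : (Set.range v).Finite)
    (hap : ∀ h : ℤ × ℤ, h ≠ 0 → ¬ ∀ z, v (z + h) = v z) (S : Finset (ℤ × ℤ)) (F : ℤ × ℤ → ℤ)
    (hS : ∀ s ∈ S, 0 ≤ s.2 ∧ s.2 ≤ 2) (hF : ∃ s ∈ S, F s ≠ 0) (hF0 : ∀ s ∉ S, F s = 0) (c : ℤ)
    (hrel : ∀ z, ∑ s ∈ S, F s * v (s + z) = c) :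
    (∃ (m : ℤ) (u : ℤ × ℤ), m ≠ 0 ∧ 0 < u.2 ∧ Kills v [(m, 0), u]) ∨
    ∃ (u₁ u₂ : ℤ × ℤ) (m : ℤ), 0 < u₁.2 ∧ 0 < u₂.2 ∧ u₁.1 * u₂.2 < u₂.1 * u₁.2 ∧ m ≠ 0 ∧
      Kills v [(m, 0), u₁, u₂] ∧ ∀ k j : ℤ, k ≠ 0 → j ≠ 0 →
        ¬ Kills v [(k, 0), j • u₁] ∧ ¬ Kills v [(k, 0), j • u₂] := by
  classical
  obtain ⟨B, hB⟩ : ∃ B : ℤ, ∀ z, |v z| ≤ B := by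
    obtain ⟨B, hB⟩ := (hv.image abs).bddAbove
    exact ⟨B, fun z => hB ⟨_, ⟨z, rfl⟩, rfl⟩⟩
  obtain ⟨l, hlk, hl0, hlen, hmin, hpair, htie⟩ := exists_minimal_kills hv hap
    (exists_kills_of_relation hB S F hF hF0 c hrel)
  set S' : Finset (ℤ × ℤ) := S.filter (F · ≠ 0) with hS'
  have hS'ne : S'.Nonempty := by
    obtain ⟨s, hs, hFs⟩ := hF
    exact ⟨s, by simp [hS', hs, hFs]⟩
  have htie' : ∀ u ∈ l, u.2 ≠ 0 → ∃ s ∈ (S' : Set (ℤ × ℤ)), ∃ s' ∈ (S' : Set (ℤ × ℤ)), s.2 < s'.2 ∧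
      (∀ r ∈ (S' : Set (ℤ × ℤ)), (r.1 : ℚ) - r.2 * (u.1 / u.2 : ℚ) ≤ s.1 - s.2 * (u.1 / u.2 : ℚ)) ∧
      (∀ r ∈ (S' : Set (ℤ × ℤ)), (r.1 : ℚ) - r.2 * (u.1 / u.2 : ℚ) ≤
        s'.1 - s'.2 * (u.1 / u.2 : ℚ)) := by
    intro u hu hu2
    have hu2' : (u.2 : ℚ) ≠ 0 := by exact_mod_cast hu2
    have habs : (0 : ℚ) < |(u.2 : ℚ)| := abs_pos.2 hu2'
    obtain ⟨t, ht, htmax⟩ := S'.exists_max_image (fun r => (r.1 : ℚ) - r.2 * (u.1 / u.2 : ℚ)) hS'ne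
    have htS : t ∈ S ∧ F t ≠ 0 := by simpa [hS'] using ht
    let P : ℤ × ℤ →+ ℤ := |u.2| • AddMonoidHom.fst ℤ ℤ - (SignType.sign u.2 * u.1) •
      AddMonoidHom.snd ℤ ℤ
    have hPq : ∀ z, (P z : ℚ) = |(u.2 : ℚ)| * (z.1 - z.2 * (u.1 / u.2 : ℚ)) := by
      intro z
      simp only [P, AddMonoidHom.sub_apply, AddMonoidHom.smul_apply, AddMonoidHom.coe_fst,
        AddMonoidHom.coe_snd, smul_eq_mul]
      rcases hu2.lt_or_gt with h | h
      · rw [sign_neg h, abs_of_neg h, abs_of_neg (by exact_mod_cast h)]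
        push_cast
        field_simp
        simp
        ring
      · rw [sign_pos h, abs_of_pos h, abs_of_pos (by exact_mod_cast h)]
        push_cast
        field_simp
        simp
    have hP0 : P ≠ 0 := by
      intro h
      have := hPq (1, 0)
      rw [h] at this
      simp at this
      exact habs.ne this
    have hPu : P u = 0 := by
      have := hPq u
      rw [mul_div_cancel₀ _ hu2', sub_self, mul_zero] at this
      exact_mod_cast this
    obtain ⟨s, hs, hFs, hst, hPs⟩ := htie S F ⟨c, hrel⟩ u hu P hP0 hPu t htS.1 htS.2
    have hsS : s ∈ S' := by simp [hS', hs, hFs]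
    have hPs' : (t.1 : ℚ) - t.2 * (u.1 / u.2 : ℚ) ≤ s.1 - s.2 * (u.1 / u.2 : ℚ) := by
      have : (P t : ℚ) ≤ P s := by exact_mod_cast hPs
      rw [hPq, hPq] at this
      exact le_of_mul_le_mul_left this habs
    have hsmax : ∀ r ∈ S', (r.1 : ℚ) - r.2 * (u.1 / u.2 : ℚ) ≤ s.1 - s.2 * (u.1 / u.2 : ℚ) :=
      fun r hr => (htmax r hr).trans hPs'
    have hrow : s.2 ≠ t.2 := by
      intro h
      apply hst
      have h1 := htmax s hsS
      simp only [h] at h1 hPs'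
      have : (s.1 : ℚ) = t.1 := by linarith
      exact Prod.ext (by exact_mod_cast this) h
    rcases hrow.lt_or_gt with h | h
    · exact ⟨s, hsS, t, ht, h, hsmax, htmax⟩
    · exact ⟨t, ht, s, hsS, h, htmax, hsmax⟩
  have hthree : ∀ a ∈ l, ∀ b ∈ l, ∀ c ∈ l, a.1 * b.2 ≠ b.1 * a.2 → b.1 * c.2 ≠ c.1 * b.2 →
      a.1 * c.2 ≠ c.1 * a.2 → a.2 ≠ 0 → b.2 ≠ 0 → c.2 ≠ 0 → False := by
    intro a ha b hb c hc hab hbc hac ha2 hb2 hc2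
    have hne : ∀ a b : ℤ × ℤ, a.2 ≠ 0 → b.2 ≠ 0 → a.1 * b.2 ≠ b.1 * a.2 →
        (a.1 / a.2 : ℚ) ≠ b.1 / b.2 := by
      intro a b ha hb hab h
      rw [div_eq_div_iff (by exact_mod_cast ha) (by exact_mod_cast hb)] at h
      exact hab (by exact_mod_cast h)
    refine not_three_ties' (S := (S' : Set (ℤ × ℤ))) (fun s hs => hS s ?_)
      (T := {x | ∃ u ∈ l, u.2 ≠ 0 ∧ (u.1 / u.2 : ℚ) = x}) ?_ ⟨a, ha, ha2, rfl⟩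
      ⟨b, hb, hb2, rfl⟩ ⟨c, hc, hc2, rfl⟩ (hne _ _ ha2 hb2 hab) (hne _ _ hb2 hc2 hbc)
      (hne _ _ ha2 hc2 hac)
    · exact (Finset.mem_filter.1 hs).1
    · rintro _ ⟨u, hu, hu2, rfl⟩
      exact htie' u hu hu2
  have hup : ∀ u : ℤ × ℤ, u.2 ≠ 0 → ∃ ε : ℤ, ε ≠ 0 ∧ 0 < (ε • u).2 := by
    intro u hu
    rcases hu.lt_or_gt with h | h
    · exact ⟨-1, by simp, by simpa using h⟩
    · exact ⟨1, by simp, by simpa using h⟩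
  have two : ∀ (a b : ℤ × ℤ) (m : ℤ), a.2 ≠ 0 → b.2 ≠ 0 → a.1 * b.2 ≠ b.1 * a.2 → m ≠ 0 →
      Kills v [(m, 0), a, b] → (∀ k j : ℤ, k ≠ 0 → j ≠ 0 →
        ¬ Kills v [(k, 0), j • a] ∧ ¬ Kills v [(k, 0), j • b]) →
      ∃ (u₁ u₂ : ℤ × ℤ) (m : ℤ), 0 < u₁.2 ∧ 0 < u₂.2 ∧ u₁.1 * u₂.2 < u₂.1 * u₁.2 ∧ m ≠ 0 ∧
        Kills v [(m, 0), u₁, u₂] ∧ ∀ k j : ℤ, k ≠ 0 → j ≠ 0 →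
        ¬ Kills v [(k, 0), j • u₁] ∧ ¬ Kills v [(k, 0), j • u₂] := by
    intro a b m ha hb hab hm hk hnk
    obtain ⟨ε, hε, ha'⟩ := hup a ha
    obtain ⟨ε', hε', hb'⟩ := hup b hb
    have hk' : Kills v [(m, 0), ε • a, ε' • b] :=
      ((hk.swap.zsmul ε).swap_tail.swap.zsmul ε').swap.swap_tail.swap
    have hnk' : ∀ k j : ℤ, k ≠ 0 → j ≠ 0 →
        ¬ Kills v [(k, 0), j • ε • a] ∧ ¬ Kills v [(k, 0), j • ε' • b] := by
      intro k j hk hj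
      rw [smul_smul, smul_smul]
      exact ⟨(hnk k _ hk (mul_ne_zero hj hε)).1, (hnk k _ hk (mul_ne_zero hj hε')).2⟩
    have hd : (ε • a).1 * (ε' • b).2 ≠ (ε' • b).1 * (ε • a).2 := by
      simp only [Prod.smul_fst, Prod.smul_snd, smul_eq_mul]
      intro h
      apply hab
      refine mul_left_cancel₀ (mul_ne_zero hε hε') ?_
      linear_combination h
    rcases hd.lt_or_gt with h | h
    · exact ⟨_, _, m, ha', hb', h, hm, hk', hnk'⟩
    · exact ⟨_, _, m, hb', ha', h, hm, hk'.perm ((List.Perm.swap _ _ _).cons _),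
        fun k j hk hj => (hnk' k j hk hj).symm⟩
  have hor : ∀ a b : ℤ × ℤ, a.1 * b.2 ≠ b.1 * a.2 → a.2 = 0 → b.2 ≠ 0 := by
    intro a b h ha hb
    simp [ha, hb] at h
  have hz : ∀ a ∈ l, a.2 = 0 → ∃ m : ℤ, m ≠ 0 ∧ a = (m, 0) := by
    intro a ha h
    refine ⟨a.1, fun h1 => hl0 a ha (Prod.ext h1 h), Prod.ext rfl h⟩
  have left : ∀ a ∈ l, ∀ b, a.2 = 0 → b.2 ≠ 0 → Kills v [a, b] →
      ∃ (m : ℤ) (u : ℤ × ℤ), m ≠ 0 ∧ 0 < u.2 ∧ Kills v [(m, 0), u] := by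
    intro a ha b ha2 hb2 hk
    obtain ⟨m, hm, rfl⟩ := hz a ha ha2
    obtain ⟨ε, hε, hb'⟩ := hup b hb2
    exact ⟨m, ε • b, hm, hb', (hk.swap.zsmul ε).swap⟩
  match l, hlk, hl0, hlen, hmin, hpair, hthree, hz, left with
  | [a, b], hlk, hl0, _, _, hpair, _, _, left =>
    have hab : a.1 * b.2 ≠ b.1 * a.2 := by simpa using hpair
    by_cases ha : a.2 = 0
    · exact Or.inl (left a (by simp) b ha (hor a b hab ha) hlk)
    by_cases hb : b.2 = 0
    · exact Or.inl (left b (by simp) a hb ha hlk.swap)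
    -- No horizontal direction is present here; `(1, 0)` is added so that both lengths of the list
    -- give data of the same shape.
    refine Or.inr (two a b 1 ha hb hab one_ne_zero (hlk.cons _) fun k j hk hj => ⟨?_, ?_⟩)
    · intro h
      obtain ⟨h, h0, hp⟩ := periodic_of_kills_twice hv (smul_ne_zero hj (hl0 a (by simp)))
        (hlk.zsmul j) h.swap (by simpa using ⟨hk, hb⟩)
      exact hap h h0 hp
    · intro h
      obtain ⟨h, h0, hp⟩ := periodic_of_kills_twice hv (smul_ne_zero hj (hl0 b (by simp)))
        (hlk.swap.zsmul j) h.swap (by simpa using ⟨hk, ha⟩)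
      exact hap h h0 hp
  | [a, b, c], hlk, hl0, _, hmin, hpair, hthree, hz, _ =>
    obtain ⟨⟨hab, hac⟩, hbc⟩ : (a.1 * b.2 ≠ b.1 * a.2 ∧ a.1 * c.2 ≠ c.1 * a.2) ∧
        b.1 * c.2 ≠ c.1 * b.2 := by simpa using hpair
    have hnk : ∀ x : ℤ × ℤ, x ≠ 0 → ∀ k j : ℤ, k ≠ 0 → j ≠ 0 → ¬ Kills v [(k, 0), j • x] := by
      intro x hx k j hk hj h
      have := hmin _ (by
        intro u hu
        simp only [List.mem_cons, List.not_mem_nil, or_false] at hu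
        rcases hu with rfl | rfl
        · simpa using hk
        · exact smul_ne_zero hj hx) h
      simp at this
    have ha0 := hl0 a (by simp)
    have hb0 := hl0 b (by simp)
    have hc0 := hl0 c (by simp)
    by_cases ha : a.2 = 0
    · obtain ⟨m, hm, rfl⟩ := hz a (by simp) ha
      exact Or.inr (two b c m (hor _ _ hab ha) (hor _ _ hac ha) hbc hm hlk
        fun k j hk hj => ⟨hnk b hb0 k j hk hj, hnk c hc0 k j hk hj⟩)
    by_cases hb : b.2 = 0
    · obtain ⟨m, hm, rfl⟩ := hz b (by simp) hb
      exact Or.inr (two a c m ha (hor _ _ hbc hb) hac hm hlk.swap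
        fun k j hk hj => ⟨hnk a ha0 k j hk hj, hnk c hc0 k j hk hj⟩)
    by_cases hc : c.2 = 0
    · obtain ⟨m, hm, rfl⟩ := hz c (by simp) hc
      exact Or.inr (two a b m ha hb hab hm hlk.swap_tail.swap
        fun k j hk hj => ⟨hnk a ha0 k j hk hj, hnk b hb0 k j hk hj⟩)
    exact (hthree a (by simp) b (by simp) c (by simp) hab hbc hac ha hb hc).elim
  | a :: b :: c :: d :: l, _, _, _, _, hpair, hthree, _, _ =>
    exfalso
    have hp := List.pairwise_cons.1 hpair
    have hp2 := List.pairwise_cons.1 hp.2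
    have hp3 := List.pairwise_cons.1 hp2.2
    have hab := hp.1 b (by simp)
    have hac := hp.1 c (by simp)
    have had := hp.1 d (by simp)
    have hbc := hp2.1 c (by simp)
    have hbd := hp2.1 d (by simp)
    have hcd := hp3.1 d (by simp)
    by_cases ha : a.2 = 0
    · exact hthree b (by simp) c (by simp) d (by simp) hbc hcd hbd (hor _ _ hab ha)
        (hor _ _ hac ha) (hor _ _ had ha)
    by_cases hb : b.2 = 0
    · exact hthree a (by simp) c (by simp) d (by simp) hac hcd had ha
        (hor _ _ hbc hb) (hor _ _ hbd hb)
    by_cases hc : c.2 = 0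
    · exact hthree a (by simp) b (by simp) d (by simp) hab hbd had ha hb (hor _ _ hcd hc)
    exact hthree a (by simp) b (by simp) c (by simp) hab hbc hac ha hb hc

/-! ### Propagation of periods by linear relations -/

theorem shiftDiff_linear_relation {R : Type*} [CommRing R] {w : ℤ × ℤ → R} {S : Finset (ℤ × ℤ)}
    {F : ℤ × ℤ → R} {c : R} (h : ∀ z, ∑ s ∈ S, F s * w (s + z) = c) (u z : ℤ × ℤ) :
    ∑ s ∈ S, F s * shiftDiff u w (s + z) = 0 := by
  simp only [shiftDiff, mul_sub, Finset.sum_sub_distrib, add_assoc, h, sub_self]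

/-- A configuration satisfying a linear relation that is periodic on a strip wide enough for
the relation is periodic beyond the strip. -/
theorem exists_period_beyond_strip {V : Set ℤ} (hV : V.Finite) (S : Finset (ℤ × ℤ))
    (F : ℤ × ℤ → ℤ) (hF : ∃ s ∈ S, F s ≠ 0) (P Q : ℤ × ℤ →+ ℤ) (d e : ℤ × ℤ) (hPd : P d = 0)
    (hPe : P e = 1) (hQd : 0 < Q d) (hQe : Q e = 0) (hPQ : ∀ z, P z = 0 → Q z = 0 → z = 0)
    (lo w : ℤ) (hw : ∀ s ∈ S, F s ≠ 0 → lo ≤ P s ∧ P s ≤ lo + w) :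
    ∃ p₀ : ℕ, 0 < p₀ ∧ ∀ p, p₀ ∣ p → ∀ κ : ℤ × ℤ → ℤ, (∀ z, κ z ∈ V) →
      (∃ c, ∀ z, ∑ s ∈ S, F s * κ (s + z) = c) → ∀ m : ℤ,
      (∀ z, m ≤ P z → P z < m + w → κ (z + p • d) = κ z) → ∀ z, m ≤ P z → κ (z + p • d) = κ z := by
  classical
  set V' : Set ℤ := Set.image2 (fun x y => x - y) V V
  have hV' : V'.Finite := hV.image2 _ hV
  obtain ⟨s₀, hs₀, hs₀max⟩ := (S.filter (F · ≠ 0)).exists_max_image P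
    (by obtain ⟨s, hs⟩ := hF; exact ⟨s, by simpa using hs⟩)
  set μ := P s₀ with hμ
  set S' := S.filter (fun s => F s ≠ 0 ∧ P s = μ) with hS'
  obtain ⟨t, ht, htmax⟩ := S'.exists_max_image Q ⟨s₀, by
    rw [Finset.mem_filter] at hs₀; simp [hS', hs₀.1, hs₀.2, hμ]⟩
  have ht' : t ∈ S ∧ F t ≠ 0 ∧ P t = μ := by simpa [hS'] using ht
  have he : e ≠ 0 := by
    rintro rfl
    simp at hPe
  obtain ⟨p₀, hp₀, huniv⟩ := exists_period_of_unique_max hV' he S' F ht ht'.2.1 Q hQe (by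
    intro s hs _ hst
    refine lt_of_le_of_ne (htmax s hs) fun hQ => hst (sub_eq_zero.1 (hPQ _ ?_ ?_))
    · rw [map_sub, (Finset.mem_filter.1 hs).2.2, ht'.2.2, sub_self]
    · rw [map_sub, hQ, sub_self]) hQd
  refine ⟨p₀, hp₀, ?_⟩
  rintro p ⟨k, rfl⟩ κ hκ ⟨c, hrel⟩ m hm
  have key : ∀ q : ℤ, m + w ≤ q → ∀ z, m ≤ P z → P z < q → κ (z + (p₀ * k) • d) = κ z := by
    intro q hq
    induction q, hq using Int.leInduction with
    | base => exact hm
    | succ q hq ih =>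
      intro z hz1 hz2
      by_cases hz3 : P z < q
      · exact ih z hz1 hz3
      have hzq : P z = q := by omega
      -- `π` projects along `e` onto the level `q`. Thus `ζ` is that level of `κ` spread over the
      -- plane, an `e`-periodic configuration.
      let π : ℤ × ℤ → ℤ × ℤ := fun z => z + (q - P z) • e
      have hπP : ∀ z, P (π z) = q := fun z => by simp only [π, map_add, map_zsmul, hPe]; simp
      have hπe : ∀ z, π (z + e) = π z := fun z => by
        simp only [π, map_add, hPe, sub_smul, add_smul, one_smul]; abel
      have hπd : ∀ (n : ℕ) z, π (z + n • d) = π z + n • d := fun n z => by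
        simp only [π, map_add, map_nsmul, hPd, smul_zero, add_zero]; abel
      have hπs : ∀ s ∈ S', ∀ z, π (s + z) = s + (z + (q - μ - P z) • e) := fun s hs z => by
        simp only [π, map_add, (Finset.mem_filter.1 hs).2.2, sub_smul, add_smul]; abel
      let ζ : ℤ × ℤ → ℤ := fun z => κ (π z)
      have hDζ : ∀ z, shiftDiff ((p₀ * k) • d) ζ z = shiftDiff ((p₀ * k) • d) κ (π z) := by
        intro z
        simp only [shiftDiff, ζ, hπd]
      -- On lower levels the difference vanishes by induction, so only the top level `S'` of the
      -- relation acts, and within `S'` the point `t` is the unique maximum of `Q`.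
      have hper := huniv (shiftDiff ((p₀ * k) • d) ζ)
        (fun z => ⟨_, hκ _, _, hκ _, rfl⟩) (fun z => by simp only [hDζ, hπe])
        ⟨0, fun z => by
          have := shiftDiff_linear_relation hrel ((p₀ * k) • d) (z + (q - μ - P z) • e)
          rw [← this]
          have hsub : S' ⊆ S := Finset.filter_subset _ _
          rw [← Finset.sum_subset hsub]
          · exact Finset.sum_congr rfl fun s hs => by rw [hDζ, hπs s hs]
          · intro s hs hs'
            by_cases hFs : F s = 0
            · rw [hFs, zero_mul]
            have h1 := hw s hs hFs
            have h2 : P s ≠ μ := fun h => hs' (by simp [hS', hs, hFs, h])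
            have h3 : P s ≤ μ := hs₀max s (by simp [hs, hFs])
            have h4 := hw t ht'.1 ht'.2.1
            have h5 : P (s + (z + (q - μ - P z) • e)) = P s + (q - μ) := by
              simp only [map_add, map_zsmul, hPe, smul_eq_mul]; ring
            have h6 : P s < μ := lt_of_le_of_ne h3 h2
            rw [shiftDiff, ih _ (by rw [h5]; omega) (by rw [h5]; omega), sub_self, mul_zero]⟩
      -- As `p` is a multiple of `p₀`, the difference along `p • d` has `p • d` as a period, so the
      -- square of that difference kills the bounded `ζ`.
      have hDD : shiftDiff ((p₀ * k) • d) (shiftDiff ((p₀ * k) • d) ζ) = 0 := by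
        refine shiftDiff_eq_zero_iff.2 fun z => ?_
        have := periodic_nsmul hper k z
        rwa [smul_smul, mul_comm k] at this
      have hD := congrFun (shiftDiff_eq_zero_of_sq (hV.subset (by
        rintro _ ⟨z, rfl⟩; exact hκ _)) hDD) z
      rw [hDζ] at hD
      have hπz : π z = z := by simp [π, hzq]
      rw [hπz] at hD
      exact sub_eq_zero.1 hD
  exact fun z hz => key (max (m + w) (P z + 1)) (le_max_left _ _) z hz
    (lt_of_lt_of_le (by omega) (le_max_right _ _))

/-- Two-sided version of `exists_period_beyond_strip`. -/
theorem exists_period_of_strip {V : Set ℤ} (hV : V.Finite) (S : Finset (ℤ × ℤ))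
    (F : ℤ × ℤ → ℤ) (hF : ∃ s ∈ S, F s ≠ 0) (P Q : ℤ × ℤ →+ ℤ) (d e : ℤ × ℤ) (hPd : P d = 0)
    (hPe : P e = 1) (hQd : 0 < Q d) (hQe : Q e = 0) (hPQ : ∀ z, P z = 0 → Q z = 0 → z = 0)
    (lo w : ℤ) (hw : ∀ s ∈ S, F s ≠ 0 → lo ≤ P s ∧ P s ≤ lo + w) :
    ∃ p₀ : ℕ, 0 < p₀ ∧ ∀ p, p₀ ∣ p → ∀ κ : ℤ × ℤ → ℤ, (∀ z, κ z ∈ V) →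
      (∃ c, ∀ z, ∑ s ∈ S, F s * κ (s + z) = c) → ∀ m : ℤ,
      (∀ z, m ≤ P z → P z < m + w → κ (z + p • d) = κ z) → ∀ z, κ (z + p • d) = κ z := by
  obtain ⟨p₁, hp₁, h₁⟩ := exists_period_beyond_strip hV S F hF P Q d e hPd hPe hQd hQe hPQ lo w hw
  obtain ⟨p₂, hp₂, h₂⟩ := exists_period_beyond_strip hV S F hF (-P) Q d (-e) (by simpa using hPd)
    (by simpa using hPe) hQd (by simpa using hQe) (fun z h1 h2 => hPQ z (by simpa using h1) h2)
    (-(lo + w)) w (fun s hs hFs => by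
      have := hw s hs hFs
      simp only [AddMonoidHom.neg_apply]
      omega)
  refine ⟨p₁ * p₂, Nat.mul_pos hp₁ hp₂, fun p hp κ hκ hrel m hm z => ?_⟩
  by_cases hz : m ≤ P z
  · exact h₁ p ((dvd_mul_right _ _).trans hp) κ hκ hrel m hm z hz
  · refine h₂ p ((dvd_mul_left _ _).trans hp) κ hκ hrel (-(m + w) + 1) (fun y hy1 hy2 => ?_) z ?_
    · simp only [AddMonoidHom.neg_apply] at hy1 hy2
      exact hm y (by omega) (by omega)
    · simp only [AddMonoidHom.neg_apply]
      have := hw _ hF.choose_spec.1 hF.choose_spec.2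
      omega

/-- A solution of a linear recurrence that vanishes on a window as long as the order of the
recurrence vanishes. -/
theorem eq_zero_of_window {R : Type*} [CommRing R] [IsDomain R] (L : ℕ) (a : ℤ → R)
    (ha : ∃ i : ℤ, 0 ≤ i ∧ i < L ∧ a i ≠ 0) (e : ℤ → R)
    (h : ∀ x, ∑ i ∈ Finset.Ico (0 : ℤ) L, a i * e (i + x) = 0) (x₀ : ℤ)
    (h0 : ∀ x, x₀ ≤ x → x < x₀ + L - 1 → e x = 0) (x : ℤ) : e x = 0 := by
  classical
  have hne : ((Finset.Ico (0 : ℤ) L).filter (a · ≠ 0)).Nonempty := by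
    obtain ⟨i, h1, h2, h3⟩ := ha
    exact ⟨i, by simp [h1, h2, h3]⟩
  obtain ⟨t, ht, htmax⟩ := Finset.exists_max_image _ id hne
  obtain ⟨b, hb, hbmin⟩ := Finset.exists_min_image _ id hne
  simp only [Finset.mem_filter, Finset.mem_Ico, id_eq] at ht htmax hb hbmin
  have solve : ∀ r : ℤ, 0 ≤ r → r < L → a r ≠ 0 → ∀ y,
      (∀ i : ℤ, 0 ≤ i → i < L → a i ≠ 0 → i ≠ r → e (i + y) = 0) → e (r + y) = 0 := by
    intro r hr0 hr1 hr2 y hy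
    have := h y
    rw [Finset.sum_eq_single_of_mem r (by simp [hr0, hr1])] at this
    · exact (mul_eq_zero.1 this).resolve_left hr2
    · intro i hi hir
      rw [Finset.mem_Ico] at hi
      by_cases hai : a i = 0
      · rw [hai, zero_mul]
      · rw [hy i hi.1 hi.2 hai hir, mul_zero]
  have up : ∀ q : ℤ, x₀ + L - 1 ≤ q → ∀ y, x₀ ≤ y → y < q → e y = 0 := by
    intro q hq
    induction q, hq using Int.leInduction with
    | base => exact h0
    | succ q hq ih =>
      intro y h1 h2
      by_cases h3 : y < q
      · exact ih y h1 h3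
      have := solve t ht.1.1 ht.1.2 ht.2 (y - t) (fun i hi0 hi1 hi2 hi3 => by
        have := htmax i ⟨⟨hi0, hi1⟩, hi2⟩
        exact ih _ (by omega) (by omega))
      rwa [add_sub_cancel] at this
  have down : ∀ q : ℤ, q ≤ x₀ → ∀ y, q ≤ y → e y = 0 := by
    intro q hq
    induction q, hq using Int.leInductionDown with
    | base =>
      intro y hy
      exact up (max (x₀ + L - 1) (y + 1)) (le_max_left _ _) y hy
        (lt_of_lt_of_le (by omega) (le_max_right _ _))
    | pred q hq ih =>
      intro y h1
      by_cases h3 : q ≤ y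
      · exact ih y h3
      have := solve b hb.1.1 hb.1.2 hb.2 (y - b) (fun i hi0 hi1 hi2 hi3 => by
        have := hbmin i ⟨⟨hi0, hi1⟩, hi2⟩
        exact ih _ (by omega))
      rwa [add_sub_cancel] at this
  exact down (min x₀ x) (min_le_left _ _) x (min_le_right _ _)

/-- If all windows of `f` along a horizontal strip have two continuations, the strip is
periodic. -/
theorem period_of_ambiguous {A : Type*} [Finite A] {η f : ℤ × ℤ → A} {T S : Finset (ℤ × ℤ)}
    (hTS : T ⊆ S) {m L : ℕ} (hc : complexity η S ≤ complexity η T + m) (hL : m ≤ L)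
    (hamb : ∀ x : ℤ, ∃ f' g', Occ η f' ∧ Occ η g' ∧ (∀ t ∈ T, f' t = f (t + (x, 0))) ∧
      (∀ t ∈ T, g' t = f (t + (x, 0))) ∧ ∃ s ∈ S, f' s ≠ g' s)
    {J : Type*} [Finite J] (o : J → ℤ × ℤ) (hT : ∀ j, ∀ i : ℕ, i < L → o j + ((i : ℤ), 0) ∈ T) :
    ∃ q : ℕ, 0 < q ∧ q ≤ m ∧ ∀ (x : ℤ) (j : J), f (o j + (x + q, 0)) = f (o j + (x, 0)) := by
  set W : Set (T → A) := Set.range fun x : ℤ => fun t : T => f ((t : ℤ × ℤ) + (x, 0)) with hW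
  have hWm : W.ncard ≤ m := by
    have := ambiguous_count η hTS W (by
      rintro w ⟨x, rfl⟩
      obtain ⟨f', g', h1, h2, h3, h4, h5⟩ := hamb x
      exact ⟨f', g', h1, h2, fun t => h3 t t.2, fun t => h4 t t.2, h5⟩)
    omega
  let u : ℤ → J → A := fun x j => f (o j + (x, 0))
  have hrange : (Set.range fun x : ℤ => fun i : Fin L => u (x + i)) =
      (fun (w : T → A) (i : Fin L) (j : J) => w ⟨_, hT j i i.2⟩) '' W := by
    rw [hW, ← Set.range_comp]
    congr 1
    funext x i j
    simp only [u, Function.comp_apply, add_assoc, Prod.mk_add_mk, add_zero]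
    rw [add_comm x]
  have hle : (Set.range fun x : ℤ => fun i : Fin L => u (x + i)).ncard ≤ m := by
    rw [hrange]
    exact (Set.ncard_image_le (Set.toFinite _)).trans hWm
  obtain ⟨q, h1, h2, h3⟩ := morse_hedlund u L (hle.trans hL)
  exact ⟨q, h1, h2.trans hle, fun x j => congrFun (h3 x) j⟩

/-! ### Horizontal periods and reflections -/

/-- The first row in which two configurations differ. -/
theorem exists_first_row {A : Type*} {f g : ℤ × ℤ → A} (P : ℤ × ℤ →+ ℤ)
    (h : ∀ z, P z < 0 → f z = g z) (hne : f ≠ g) :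
    ∃ z₀, f z₀ ≠ g z₀ ∧ ∀ z, P z < P z₀ → f z = g z := by
  obtain ⟨z₁, hz₁⟩ := Function.ne_iff.1 hne
  have hex : ∃ n : ℕ, ∃ z, P z = n ∧ f z ≠ g z :=
    ⟨(P z₁).toNat, z₁, (Int.toNat_of_nonneg (not_lt.1 fun hlt => hz₁ (h _ hlt))).symm, hz₁⟩
  classical
  obtain ⟨z₀, h0, hz₀⟩ := Nat.find_spec hex
  refine ⟨z₀, hz₀, fun z hz => ?_⟩
  by_contra hne
  have h1 : 0 ≤ P z := not_lt.1 fun hlt => hne (h _ hlt)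
  have := Nat.find_min' hex (m := (P z).toNat) ⟨z, (Int.toNat_of_nonneg h1).symm, hne⟩
  omega

theorem mem_rectangle {n k : ℕ} {z : ℤ × ℤ} :
    z ∈ rectangle n k ↔ (0 ≤ z.1 ∧ z.1 < n) ∧ 0 ≤ z.2 ∧ z.2 < k := by
  simp [rectangle, Finset.mem_product]

theorem card_rectangle (n k : ℕ) : (rectangle n k).card = n * k := by
  simp [rectangle, Finset.card_product]

theorem Occ.comp_equiv {A : Type*} {η f : ℤ × ℤ → A} (h : Occ η f) (σ : ℤ × ℤ ≃+ ℤ × ℤ) :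
    Occ (η ∘ σ) (f ∘ σ) := by
  classical
  intro B
  obtain ⟨u, hu⟩ := h (B.image σ)
  refine ⟨σ.symm u, fun z hz => ?_⟩
  simp only [Function.comp_apply, map_add, AddEquiv.apply_symm_apply]
  exact hu _ (Finset.mem_image_of_mem _ hz)

theorem complexity_comp_equiv {A : Type*} (η : ℤ × ℤ → A) (S : Finset (ℤ × ℤ))
    (σ : ℤ × ℤ ≃+ ℤ × ℤ) : complexity (η ∘ σ) S = complexity η (S.image σ) := by
  classical
  let φ : ({t // t ∈ S.image σ} → A) → (S → A) := fun w s => w ⟨σ s, Finset.mem_image_of_mem _ s.2⟩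
  have hφ : Function.Injective φ := by
    intro w w' hww
    funext ⟨t, ht⟩
    obtain ⟨s, hs, rfl⟩ := Finset.mem_image.1 ht
    exact congrFun hww ⟨s, hs⟩
  have : φ '' words η (S.image σ) = words (η ∘ σ) S := by
    ext w
    constructor
    · rintro ⟨_, ⟨u, rfl⟩, rfl⟩
      exact ⟨σ.symm u, funext fun s => by simp [φ, shiftBy]⟩
    · rintro ⟨u, rfl⟩
      exact ⟨_, ⟨σ u, rfl⟩, funext fun s => by simp [φ, shiftBy]⟩
  unfold complexity
  rw [← this, Set.ncard_image_of_injective _ hφ]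

/-- The reflection in the horizontal axis. -/
def flipVert : ℤ × ℤ ≃+ ℤ × ℤ := (AddEquiv.refl ℤ).prodCongr (AddEquiv.neg ℤ)

/-- The reflection in the vertical axis. -/
def flipHorz : ℤ × ℤ ≃+ ℤ × ℤ := (AddEquiv.neg ℤ).prodCongr (AddEquiv.refl ℤ)

@[simp] theorem flipVert_apply (z : ℤ × ℤ) : flipVert z = (z.1, -z.2) := rfl

@[simp] theorem flipHorz_apply (z : ℤ × ℤ) : flipHorz z = (-z.1, z.2) := rfl

theorem complexity_flipVert_rectangle {A : Type*} (η : ℤ × ℤ → A) (n k : ℕ) :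
    complexity (η ∘ flipVert) (rectangle n k) = complexity η (rectangle n k) := by
  classical
  rw [complexity_comp_equiv, ← complexity_translate η (rectangle n k) (0, 1 - k)]
  congr 1
  ext ⟨x, y⟩
  simp only [Finset.mem_image, mem_rectangle, flipVert_apply, Prod.exists, Prod.mk_add_mk, Prod.mk.injEq]
  constructor
  · rintro ⟨a, b, ⟨h1, h2⟩, rfl, rfl⟩
    exact ⟨a, k - 1 - b, by omega, by omega, by omega⟩
  · rintro ⟨a, b, ⟨h1, h2⟩, rfl, rfl⟩
    exact ⟨a, k - 1 - b, by omega, by omega, by omega⟩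

/-- The first differing row satisfies the recurrence given by the top row of the relation, so `f`
and `g` differ in each of its windows of length `n`. All `n` by `k` words of `f` just below are
therefore ambiguous. The complexity grows by less than `n` there, so the Morse–Hedlund theorem gives
these `k` rows a period, which the relation spreads to the plane. -/
theorem horizontal_period_of_agree_below {A : Type*} [Finite A] (η : ℤ × ℤ → A) {n k : ℕ}
    (hlow : complexity η (rectangle n (k + 1)) ≤ n * (k + 1))
    (hmin : n * k + 1 ≤ complexity η (rectangle n k)) :
    ∃ p : ℕ, 0 < p ∧ ∀ f g, Occ η f → Occ η g → (∀ z : ℤ × ℤ, z.2 < 0 → f z = g z) → f ≠ g →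
      ∀ z, f (z + ((p : ℤ), 0)) = f z := by
  classical
  obtain ⟨ι, hι⟩ : ∃ ι : A → ℤ, Function.Injective ι := by
    have := Countable.exists_injective_nat A
    obtain ⟨φ, hφ⟩ := this
    exact ⟨fun a => φ a, Nat.cast_injective.comp hφ⟩
  obtain ⟨F, c, hF, hF0, hrel⟩ := exists_relation η (rectangle n (k + 1))
    (by rw [card_rectangle]; exact hlow) ι
  have hV : (Set.range ι).Finite := Set.finite_range ι
  obtain ⟨p₀, hp₀, hT⟩ := exists_period_of_strip hV (rectangle n (k + 1)) F hF
    (AddMonoidHom.snd ℤ ℤ) (AddMonoidHom.fst ℤ ℤ) (1, 0) (0, 1) rfl rfl (by simp) rfl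
    (fun z h1 h2 => Prod.ext h2 h1) 0 k (fun s hs _ => by
      rw [mem_rectangle] at hs
      push_cast at hs
      simp only [AddMonoidHom.coe_snd]
      omega)
  -- The period `q ≤ n` of the strip depends on the pair; `n!` is a common multiple.
  refine ⟨p₀ * n.factorial, Nat.mul_pos hp₀ (Nat.factorial_pos _), ?_⟩
  intro f g hf hg hagree hne
  obtain ⟨z₀, hz₀, hfirst⟩ := exists_first_row (AddMonoidHom.snd ℤ ℤ) hagree hne
  simp only [AddMonoidHom.coe_snd] at hfirst
  set ρ := z₀.2 with hρ
  -- the top row of the relation annihilates the first difference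
  obtain ⟨s₁, hs₁, hs₁max⟩ := ((rectangle n (k + 1)).filter (F · ≠ 0)).exists_max_image Prod.snd
    (by obtain ⟨s, hs⟩ := hF; exact ⟨s, by simpa using hs⟩)
  simp only [Finset.mem_filter] at hs₁ hs₁max
  have hs₁r := mem_rectangle.1 hs₁.1
  let e : ℤ → ℤ := fun x => ι (f (x, ρ)) - ι (g (x, ρ))
  have hrec : ∀ x, ∑ i ∈ Finset.Ico (0 : ℤ) n, F (i, s₁.2) * e (i + x) = 0 := by
    intro x
    have h1 : ∑ s ∈ rectangle n (k + 1), F s * (ι (f (s + (x, ρ - s₁.2))) -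
        ι (g (s + (x, ρ - s₁.2)))) = 0 := by
      simp only [mul_sub, Finset.sum_sub_distrib, hrel f hf, hrel g hg, sub_self]
    rw [rectangle, Finset.sum_product_right, Finset.sum_eq_single_of_mem s₁.2] at h1
    · refine (Finset.sum_congr rfl fun i _ => ?_).trans h1
      simp [e]
    · rw [Finset.mem_Ico]; exact hs₁r.2
    · intro j hj hne
      refine Finset.sum_eq_zero fun i hi => ?_
      by_cases h0 : F (i, j) = 0
      · rw [h0, zero_mul]
      have hm : (i, j) ∈ rectangle n (k + 1) := by
        rw [rectangle, Finset.mem_product]; exact ⟨hi, hj⟩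
      have := hs₁max _ ⟨hm, h0⟩
      rw [hfirst ((i, j) + (x, ρ - s₁.2)) (by simp only [Prod.snd_add]; simp at this; omega),
        sub_self, mul_zero]
  have hwin : ∀ x : ℤ, ∃ i : ℤ, x ≤ i ∧ i < x + n ∧ f (i, ρ) ≠ g (i, ρ) := by
    intro x
    by_contra! hcon
    have := eq_zero_of_window n (fun i => F (i, s₁.2)) ⟨s₁.1, hs₁r.1.1, hs₁r.1.2, hs₁.2⟩ e hrec x
      (fun i hi1 hi2 => by simp only [e]; rw [hcon i hi1 (by omega), sub_self]) z₀.1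
    exact hz₀ (hι (sub_eq_zero.1 this))
  have hsub : rectangle n k ⊆ rectangle n (k + 1) := by
    intro z hz
    rw [mem_rectangle] at hz ⊢
    push_cast
    omega
  let f' : ℤ × ℤ → A := fun z => f (z + (0, ρ - k))
  obtain ⟨q, hq0, hqn, hq⟩ := period_of_ambiguous (η := η) (f := f') hsub (m := n) (L := n)
    (by rw [mul_add] at hlow; omega) le_rfl (fun x => by
      obtain ⟨i, hi1, hi2, hi3⟩ := hwin x
      refine ⟨_, _, hf.shift (x, ρ - k), hg.shift (x, ρ - k), fun t ht => ?_, fun t ht => ?_,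
        (i - x, k), ?_, ?_⟩
      · simp [f', add_assoc]
      · rw [mem_rectangle] at ht
        rw [← hfirst _ (by simp; omega)]
        simp [f', add_assoc]
      · rw [mem_rectangle]; push_cast; constructor <;> constructor <;> omega
      · simpa using hi3) (fun j : Fin k => ((0 : ℤ), (j : ℤ))) (fun j i hi => by
      have := j.2
      rw [mem_rectangle]
      exact ⟨⟨by simp, by simp; omega⟩, by simp, by simp⟩)
  have hd : (p₀ * n.factorial) • ((1, 0) : ℤ × ℤ) = (((p₀ * n.factorial : ℕ) : ℤ), 0) := by simp
  have := hT (p₀ * n.factorial) (dvd_mul_right _ _) (ι ∘ f) (fun z => ⟨_, rfl⟩)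
    ⟨c, hrel f hf⟩ (ρ - k) (by
      intro z hz1 hz2
      simp only [AddMonoidHom.coe_snd] at hz1 hz2
      rw [hd]
      have hstep : ∀ x : ℤ, (fun x : ℤ × ℤ => f (x.1, z.2)) ((x, 0) + ((q : ℤ), 0)) =
          (fun x : ℤ × ℤ => f (x.1, z.2)) (x, 0) := by
        intro x
        have := hq x ⟨(z.2 - (ρ - k)).toNat, by omega⟩
        simp only [f', Prod.mk_add_mk, zero_add, add_zero] at this
        rw [Int.toNat_of_nonneg (by omega), sub_add_cancel] at this
        simpa using this
      obtain ⟨m, hm⟩ := Nat.dvd_factorial hq0 hqn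
      have h := periodic_nsmul (w := fun x : ℤ × ℤ => f (x.1, z.2)) (h := ((q : ℤ), 0))
        (fun y => by simpa using hstep y.1) (p₀ * m) (z.1, 0)
      simp only [Function.comp_apply]
      congr 1
      convert h using 2
      ext
      · simp [hm]; ring
      · simp)
  intro z
  have h := this z
  rw [hd] at h
  exact hι h

/-- Two occurring configurations that agree on a horizontal half-plane are equal or
horizontally periodic. -/
theorem exists_horizontal_period {A : Type*} [Finite A] (η : ℤ × ℤ → A) {n k : ℕ}
    (hlow : complexity η (rectangle n (k + 1)) ≤ n * (k + 1))
    (hmin : n * k + 1 ≤ complexity η (rectangle n k)) :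
    ∃ p : ℕ, 0 < p ∧ ∀ f g, Occ η f → Occ η g →
      ((∀ z : ℤ × ℤ, z.2 < 0 → f z = g z) ∨ (∀ z : ℤ × ℤ, 0 < z.2 → f z = g z)) → f ≠ g →
      ∀ z, f (z + ((p : ℤ), 0)) = f z := by
  obtain ⟨p, hp, h⟩ := horizontal_period_of_agree_below η hlow hmin
  obtain ⟨p', hp', h'⟩ := horizontal_period_of_agree_below (η ∘ flipVert)
    (by rwa [complexity_flipVert_rectangle]) (by rwa [complexity_flipVert_rectangle])
  refine ⟨p * p', Nat.mul_pos hp hp', ?_⟩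
  rintro f g hf hg hfg hne z
  have key : ∀ {r : ℕ}, (∀ z, f (z + ((r : ℤ), 0)) = f z) → ∀ m : ℕ, f (z + (((m * r : ℕ) : ℤ), 0)) = f z := by
    intro r hr m
    have := periodic_nsmul hr m z
    simpa using this
  rcases hfg with hfg | hfg
  · rw [mul_comm]
    exact key (h f g hf hg hfg hne) _
  · refine key (fun z => ?_) _
    have := h' (f ∘ flipVert) (g ∘ flipVert) (hf.comp_equiv _) (hg.comp_equiv _)
      (fun z hz => hfg _ (by simpa using hz)) (fun he => hne ?_) (flipVert z)
    · rw [show z + ((p' : ℤ), 0) = (z.1 + p', z.2) by ext <;> simp]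
      simpa using this
    · funext z
      have := congrFun he (flipVert z)
      simpa using this

/-! ### Minimal slabs and their ties -/

/-- Row-convex sets contained in three consecutive rows. -/
def IsSlab (S : Finset (ℤ × ℤ)) : Prop :=
  (∀ s ∈ S, 0 ≤ s.2 ∧ s.2 ≤ 2) ∧
    ∀ s ∈ S, ∀ t ∈ S, ∀ x, s.2 = t.2 → s.1 ≤ x → x ≤ t.1 → (x, s.2) ∈ S

/-- A slab of low complexity all of whose smaller slabs have high complexity. -/
def IsMinimalSlab {A : Type*} (η : ℤ × ℤ → A) (S : Finset (ℤ × ℤ)) : Prop :=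
  IsSlab S ∧ complexity η S ≤ S.card ∧
    ∀ T, IsSlab T → T.card < S.card → T.card + 1 ≤ complexity η T

theorem exists_minimalSlab {A : Type*} {η : ℤ × ℤ → A} {S : Finset (ℤ × ℤ)} (hS : IsSlab S)
    (h : complexity η S ≤ S.card) : ∃ S, IsMinimalSlab η S := by
  classical
  have hex : ∃ n, ∃ S : Finset (ℤ × ℤ), S.card = n ∧ IsSlab S ∧ complexity η S ≤ S.card :=
    ⟨_, S, rfl, hS, h⟩
  obtain ⟨S₀, hc, hS₀, h₀⟩ := Nat.find_spec hex
  refine ⟨S₀, hS₀, h₀, fun T hT hlt => ?_⟩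
  by_contra hcon
  have := Nat.find_min' hex ⟨T, rfl, hT, by omega⟩
  omega

theorem isSlab_rectangle {n k : ℕ} (hk : k ≤ 3) : IsSlab (rectangle n k) := by
  refine ⟨fun s hs => ?_, fun s hs t ht x h1 h2 h3 => ?_⟩
  · rw [mem_rectangle] at hs; omega
  · rw [mem_rectangle] at *; dsimp only; omega

/-- An end of a row. -/
def IsRowEnd (S : Finset (ℤ × ℤ)) (t : ℤ × ℤ) : Prop :=
  t ∈ S ∧ ((∀ s ∈ S, s.2 = t.2 → s.1 ≤ t.1) ∨ ∀ s ∈ S, s.2 = t.2 → t.1 ≤ s.1)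

theorem IsSlab.erase {S : Finset (ℤ × ℤ)} (hS : IsSlab S) {t : ℤ × ℤ} (ht : IsRowEnd S t) :
    IsSlab (S.erase t) := by
  refine ⟨fun s hs => hS.1 s (Finset.mem_of_mem_erase hs), fun s hs r hr x h1 h2 h3 => ?_⟩
  rw [Finset.mem_erase] at *
  refine ⟨?_, hS.2 s hs.2 r hr.2 x h1 h2 h3⟩
  rintro rfl
  simp only [IsRowEnd] at ht
  rcases ht.2 with h | h
  · have := h r hr.2 h1.symm
    exact hr.1 (Prod.ext (by dsimp only; omega) h1.symm)
  · have := h s hs.2 rfl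
    exact hs.1 (Prod.ext (by dsimp only; omega) rfl)

/-- By minimality the slab without `t` already has at least `card S` words, as many as `S` can have,
so adding `t` creates no ambiguity. -/
theorem IsMinimalSlab.determined {A : Type*} [Finite A] {η : ℤ × ℤ → A} {S : Finset (ℤ × ℤ)}
    (hS : IsMinimalSlab η S) {t : ℤ × ℤ} (ht : IsRowEnd S t) {f g : ℤ × ℤ → A} (hf : Occ η f)
    (hg : Occ η g) (u : ℤ × ℤ) (h : ∀ s ∈ S, s ≠ t → f (s + u) = g (s + u)) :
    f (t + u) = g (t + u) := by
  have h1 := hS.2.2 _ (hS.1.erase ht) (Finset.card_erase_lt_of_mem ht.1)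
  rw [Finset.card_erase_add_one ht.1] at h1
  exact determined_of_complexity_le (Finset.erase_subset t S) (hS.2.1.trans h1) (hf.shift u)
    (hg.shift u) (fun s hs => h s (Finset.mem_of_mem_erase hs) (Finset.ne_of_mem_erase hs)) t ht.1

/-- A functional whose maximum on the slab is not tied between two rows is expansive. -/
theorem IsMinimalSlab.tie {A : Type*} [Finite A] {η : ℤ × ℤ → A} {S : Finset (ℤ × ℤ)}
    (hS : IsMinimalSlab η S) (P : ℤ × ℤ →+ ℤ) (hP : P (1, 0) ≠ 0) {f g : ℤ × ℤ → A}
    (hf : Occ η f) (hg : Occ η g) (hfg : ∀ z, P z < 0 → f z = g z) (hne : f ≠ g) :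
    ∃ s ∈ S, ∃ t ∈ S, s.2 < t.2 ∧ P s = P t ∧ ∀ r ∈ S, P r ≤ P s := by
  have hSne : S.Nonempty := by
    rw [Finset.nonempty_iff_ne_empty]
    rintro rfl
    have := hS.2.1
    rw [complexity_empty] at this
    simp at this
  obtain ⟨t, ht, htmax⟩ := S.exists_max_image P hSne
  obtain ⟨z₀, hz₀, hfirst⟩ := exists_first_row P hfg hne
  have hrow : ∀ s : ℤ × ℤ, s.2 = t.2 → P s - P t = (s.1 - t.1) * P (1, 0) := by
    intro s h
    rw [functional_apply P s, functional_apply P t, h]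
    ring
  have hend : IsRowEnd S t := by
    refine ⟨ht, ?_⟩
    rcases hP.lt_or_gt with h | h
    · right
      intro s hs h2
      have := hrow s h2
      have := htmax s hs
      nlinarith
    · left
      intro s hs h2
      have := hrow s h2
      have := htmax s hs
      nlinarith
  have hex : ∃ s ∈ S, s ≠ t ∧ P s = P t := by
    by_contra! hcon
    apply hz₀
    have := hS.determined hend hf hg (z₀ - t) (fun s hs hst => hfirst _ (by
      have := lt_of_le_of_ne (htmax s hs) (hcon s hs hst)
      rw [map_add, map_sub]
      omega))
    rwa [add_sub_cancel] at this
  obtain ⟨s, hs, hst, hPst⟩ := hex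
  have hrow2 : s.2 ≠ t.2 := by
    intro h
    have := hrow s h
    rw [hPst, sub_self, eq_comm, mul_eq_zero, or_iff_left hP, sub_eq_zero] at this
    exact hst (Prod.ext this h)
  rcases hrow2.lt_or_gt with h | h
  · exact ⟨s, hs, t, ht, h, hPst, fun r hr => hPst ▸ htmax r hr⟩
  · exact ⟨t, ht, s, hs, h, hPst.symm, htmax⟩

/-! ### Edges of a minimal slab -/

/-- The data of an edge of a minimal slab in direction `d`, extreme for the functional `P`. -/
structure IsEdge (S : Finset (ℤ × ℤ)) (P : ℤ × ℤ →+ ℤ) (d e : ℤ × ℤ) (w : ℤ) : Prop where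
  dir : P d = 0
  line : ∀ z, P z = 0 → ∃ n : ℤ, z = n • d
  left : IsRowEnd S e
  right : IsRowEnd S (e + d)
  slab : IsSlab ((S.erase e).erase (e + d))
  dne : d ≠ 0
  below : ∀ s ∈ (S.erase e).erase (e + d), P e - w ≤ P s ∧ P s < P e
  fill : ∀ i, P e - w ≤ i → i < P e → ∃ s ∈ (S.erase e).erase (e + d), P s = i

/-- `S` has at most `card S` words, and the slab with two points fewer has at least `card S - 1`. -/
theorem IsMinimalSlab.edge_step {A : Type*} [Finite A] {η : ℤ × ℤ → A} {S : Finset (ℤ × ℤ)}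
    (hS : IsMinimalSlab η S) {P : ℤ × ℤ →+ ℤ} {d e : ℤ × ℤ} {w : ℤ} (hE : IsEdge S P d e w) :
    complexity η S ≤ complexity η ((S.erase e).erase (e + d)) + 1 := by
  have hd : e + d ∈ S.erase e := by
    rw [Finset.mem_erase]
    exact ⟨by simpa using hE.dne, hE.right.1⟩
  have h1 := Finset.card_erase_add_one hE.left.1
  have h2 := Finset.card_erase_add_one hd
  have := hS.2.2 _ hE.slab (by omega)
  have := hS.2.1
  omega

section Edge

variable {A : Type*} [Finite A] {η : ℤ × ℤ → A} {S : Finset (ℤ × ℤ)} {P : ℤ × ℤ →+ ℤ}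
  {d e : ℤ × ℤ} {w : ℤ} {f g : ℤ × ℤ → A} {m : ℤ}

/-- Each end of the edge is determined by the other end and by points where `f` and `g` agree.
Agreement at one point of the line would hence spread along it in both directions. -/
theorem IsMinimalSlab.edge_ne (hS : IsMinimalSlab η S) (hE : IsEdge S P d e w) (hf : Occ η f)
    (hg : Occ η g) (hfg : ∀ z, m - w ≤ P z → P z < m → f z = g z) {z₀ : ℤ × ℤ} (hz₀ : P z₀ = m)
    (hne : f z₀ ≠ g z₀) (z : ℤ × ℤ) (hz : P z = m) : f z ≠ g z := by
  have hbelow : ∀ y, P y = m → ∀ s ∈ S, s ≠ e → s ≠ e + d → f (s + (y - e)) = g (s + (y - e)) := by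
    intro y hy s hs h1 h2
    have := hE.below s (by simp [hs, h1, h2])
    refine hfg _ ?_ ?_ <;> rw [map_add, map_sub] <;> omega
  have up : ∀ y, P y = m → f y = g y → f (y + d) = g (y + d) := by
    intro y hy h
    have := hS.determined hE.right hf hg (y - e) (fun s hs hst => by
      by_cases hse : s = e
      · rw [hse, add_sub_cancel]; exact h
      · exact hbelow y hy s hs hse hst)
    rwa [show e + d + (y - e) = y + d by abel] at this
  have down : ∀ y, P y = m → f (y + d) = g (y + d) → f y = g y := by
    intro y hy h
    have := hS.determined hE.left hf hg (y - e) (fun s hs hst => by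
      by_cases hse : s = e + d
      · rw [hse, show e + d + (y - e) = y + d by abel]; exact h
      · exact hbelow y hy s hs hst hse)
    rwa [add_sub_cancel] at this
  intro h
  obtain ⟨n, hn⟩ := hE.line (z₀ - z) (by rw [map_sub]; omega)
  have hline : ∀ k : ℤ, P (z + k • d) = m := fun k => by rw [map_add, map_zsmul, hE.dir]; simpa
  have key : ∀ k : ℤ, f (z + k • d) = g (z + k • d) := by
    intro k
    induction k using Int.induction_on with
    | zero => simpa using h
    | succ k ih =>
      rw [add_smul, one_smul, ← add_assoc]
      exact up _ (hline _) ih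
    | pred k ih =>
      refine down _ (hline _) ?_
      rw [add_assoc, ← add_one_zsmul, sub_add_cancel]
      exact ih
  apply hne
  rw [← add_sub_cancel z z₀, hn]
  exact key n

/-- All windows along an edge line of a nonexpansive pair look the same. -/
theorem IsMinimalSlab.edge_windows (hS : IsMinimalSlab η S) (hE : IsEdge S P d e w)
    {f' g' : ℤ × ℤ → A} {m' : ℤ} (hf : Occ η f) (hg : Occ η g) (hf' : Occ η f') (hg' : Occ η g')
    (hfg : ∀ z, m - w ≤ P z → P z < m → f z = g z)
    (hfg' : ∀ z, m' - w ≤ P z → P z < m' → f' z = g' z) {y y' : ℤ × ℤ} (hy : P y = m)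
    (hy' : P y' = m') (hne : f y ≠ g y) (hne' : f' y' ≠ g' y') :
    ∀ s ∈ (S.erase e).erase (e + d), f (s + (y - e)) = f' (s + (y' - e)) := by
  refine ambiguous_unique ((Finset.erase_subset _ _).trans (Finset.erase_subset _ _))
    (hS.edge_step hE) (hf.shift _) (hg.shift _) (hf'.shift _) (hg'.shift _) ?_ ?_
    ⟨e, hE.left.1, by rwa [add_sub_cancel]⟩ ⟨e, hE.left.1, by rwa [add_sub_cancel]⟩
  · intro s hs
    have := hE.below s hs
    refine hfg _ ?_ ?_ <;> rw [map_add, map_sub] <;> omega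
  · intro s hs
    have := hE.below s hs
    refine hfg' _ ?_ ?_ <;> rw [map_add, map_sub] <;> omega

/-- `f` and `g` differ along the whole line, so the windows at `y` and at `y + d` are both ambiguous
and carry the same word; by `fill` these windows reach every level of the strip. -/
theorem IsMinimalSlab.edge_const (hS : IsMinimalSlab η S) (hE : IsEdge S P d e w) (hf : Occ η f)
    (hg : Occ η g) (hfg : ∀ z, m - w ≤ P z → P z < m → f z = g z) {z₀ : ℤ × ℤ} (hz₀ : P z₀ = m)
    (hne : f z₀ ≠ g z₀) (z : ℤ × ℤ) (h1 : m - w ≤ P z) (h2 : P z < m) : f (z + d) = f z := by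
  obtain ⟨s, hs, hPs⟩ := hE.fill (P z - m + P e) (by omega) (by omega)
  have hy : P (z - s + e) = m := by rw [map_add, map_sub]; omega
  have hy' : P (z - s + e + d) = m := by rw [map_add, hE.dir, hy, add_zero]
  have hne' := hS.edge_ne hE hf hg hfg hz₀ hne
  have := hS.edge_windows hE hf hg hf hg hfg hfg hy' hy (hne' _ hy') (hne' _ hy) s hs
  rwa [show s + (z - s + e + d - e) = z + d by abel, show s + (z - s + e - e) = z by abel] at this

/-- Beyond the edge line, a nonexpansive configuration is invariant under twice the edge. -/
theorem IsMinimalSlab.edge_double_period (hS : IsMinimalSlab η S) (hE : IsEdge S P d e w)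
    (hf : Occ η f) (hg : Occ η g) (hfg : ∀ z, m - w ≤ P z → P z < m → f z = g z) {z₀ : ℤ × ℤ}
    (hz₀ : P z₀ = m) (hne : f z₀ ≠ g z₀) (z : ℤ × ℤ) (h1 : m - w ≤ P z) :
    f (z + 2 • d) = f z := by
  have hstrip : ∀ z, m - w ≤ P z → P z < m → f (z + 2 • d) = f z := by
    intro z h1 h2
    have hc := hS.edge_const hE hf hg hfg hz₀ hne
    rw [two_smul, ← add_assoc, hc (z + d) (by rw [map_add, hE.dir]; omega)
      (by rw [map_add, hE.dir]; omega), hc z h1 h2]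
  have hd2 : ∀ z, P (z + 2 • d) = P z := fun z => by rw [map_add, map_nsmul, hE.dir]; simp
  have hd1 : ∀ z, P (z + d) = P z := fun z => by rw [map_add, hE.dir, add_zero]
  have key : ∀ q : ℤ, m ≤ q → ∀ z, m - w ≤ P z → P z < q → f (z + 2 • d) = f z := by
    intro q hq
    induction q, hq using Int.leInduction with
    | base => exact hstrip
    | succ q hq ih =>
      intro z h1 h2
      by_cases h3 : P z < q
      · exact ih z h1 h3
      have hzq : P z = q := by omega
      by_contra hcon
      have hf2 := hf.shift (2 • d)
      have hag : ∀ z, q - w ≤ P z → P z < q → f z = f (z + 2 • d) := fun z h1 h2 =>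
        (ih z (by omega) h2).symm
      have hdiff := hS.edge_ne hE hf hf2 hag hzq (Ne.symm hcon)
      have hzd : P (z + d) = q := by rw [hd1, hzq]
      have hwin := hS.edge_windows hE hf hf2 hf hf2 hag hag hzq hzd (hdiff z hzq) (hdiff _ hzd)
      -- The windows at `z`, `z + d` and `z + 2 • d` extend one word with at most two extensions, so
      -- the middle one repeats a neighbour. Comparison at both ends of the edge makes `f` agree at
      -- `z` and `z + 2 • d`, or at `z + d` and `z + 3 • d`; both are excluded.
      have hex := extensions_le_two ((Finset.erase_subset _ _).trans (Finset.erase_subset _ _))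
        (hS.edge_step hE) (hf.shift (z - e)) (hf2.shift (z - e)) (hf.shift (z + d - e))
        (fun s hs => by
          have := hE.below s hs
          refine hag _ ?_ ?_ <;> rw [map_add, map_sub] <;> omega) hwin
        ⟨e, hE.left.1, by rw [add_sub_cancel]; exact hdiff z hzq⟩
      have e1 : e + d + (z - e) = z + d := by abel
      have e2 : e + d + (z + d - e) = z + 2 • d := by rw [two_smul]; abel
      have e3 : z + d + 2 • d = z + 2 • d + d := by abel
      rcases hex with hex | hex
      · have k1 := hex e hE.left.1
        have k2 := hex (e + d) hE.right.1
        rw [add_sub_cancel, add_sub_cancel] at k1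
        rw [e1, e2] at k2
        exact hcon (k2.trans k1)
      · have k1 := hex e hE.left.1
        have k2 := hex (e + d) hE.right.1
        simp only [add_sub_cancel] at k1
        rw [e1, e2] at k2
        exact hdiff _ hzd (k1.trans k2)
  exact key (max m (P z + 1)) (le_max_left _ _) z h1 (lt_of_lt_of_le (by omega) (le_max_right _ _))

end Edge

/-! ### The hexagon -/

/-- The functional vanishing on the line spanned by `u`. -/
def crossWith (u : ℤ × ℤ) : ℤ × ℤ →+ ℤ :=
  u.2 • AddMonoidHom.fst ℤ ℤ - u.1 • AddMonoidHom.snd ℤ ℤ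

@[simp] theorem crossWith_apply (u z : ℤ × ℤ) : crossWith u z = u.2 * z.1 - u.1 * z.2 := by
  simp [crossWith]

/-- The hexagon with horizontal edges of `L` points and slanted edges `(a, 1)` and `(b, 1)`. -/
noncomputable def hex (a b L : ℤ) : Finset (ℤ × ℤ) :=
  Finset.Ico 0 L ×ˢ {0} ∪ Finset.Ico a (L + b) ×ˢ {1} ∪ Finset.Ico (a + b) (L + a + b) ×ˢ {2}

theorem mem_hex {a b L : ℤ} {z : ℤ × ℤ} : z ∈ hex a b L ↔
    (z.2 = 0 ∧ 0 ≤ z.1 ∧ z.1 < L) ∨ (z.2 = 1 ∧ a ≤ z.1 ∧ z.1 < L + b) ∨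
      (z.2 = 2 ∧ a + b ≤ z.1 ∧ z.1 < L + a + b) := by
  simp only [hex, Finset.mem_union, Finset.mem_product, Finset.mem_Ico, Finset.mem_singleton]
  tauto

theorem isSlab_hex (a b L : ℤ) : IsSlab (hex a b L) := by
  refine ⟨fun s hs => ?_, fun s hs t ht x h1 h2 h3 => ?_⟩
  · rw [mem_hex] at hs; omega
  · rw [mem_hex] at *; dsimp only; omega

theorem IsMinimalSlab.of_map {A : Type*} {η η' : ℤ × ℤ → A} (φ : ℤ × ℤ ≃ ℤ × ℤ)
    (hφ : ∀ T, IsSlab T → IsSlab (T.image φ))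
    (hc : ∀ T, complexity η' T = complexity η (T.image φ)) {S : Finset (ℤ × ℤ)} (hS : IsSlab S)
    (h : IsMinimalSlab η (S.image φ)) : IsMinimalSlab η' S := by
  have hcard : ∀ T : Finset (ℤ × ℤ), (T.image φ).card = T.card := fun T =>
    Finset.card_image_of_injective T φ.injective
  refine ⟨hS, ?_, fun T hT hlt => ?_⟩
  · rw [hc, ← hcard S]; exact h.2.1
  · rw [hc, ← hcard T]
    exact h.2.2 _ (hφ T hT) (by rwa [hcard, hcard])

/-- A configuration of low complexity that is not periodic leads to a hexagon. -/
structure HexSystem {A : Type*} (η : ℤ × ℤ → A) (a b L : ℤ) (p : ℕ) : Prop where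
  lt : a < b
  pos : 1 ≤ L
  minimal : IsMinimalSlab η (hex a b L)
  aperiodic : ∀ h : ℤ × ℤ, h ≠ 0 → ¬ ∀ z, η (z + h) = η z
  left_pair : ∀ ε : ℤ, ε = 1 ∨ ε = -1 → ∃ f g, Occ η f ∧ Occ η g ∧
    (∀ z : ℤ × ℤ, ε * (z.1 - a * z.2) < 0 → f z = g z) ∧ f ≠ g
  right_pair : ∀ ε : ℤ, ε = 1 ∨ ε = -1 → ∃ f g, Occ η f ∧ Occ η g ∧
    (∀ z : ℤ × ℤ, ε * (z.1 - b * z.2) < 0 → f z = g z) ∧ f ≠ g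
  period_pos : 0 < p
  horizontal : ∀ f g, Occ η f → Occ η g →
    ((∀ z : ℤ × ℤ, z.2 < 0 → f z = g z) ∨ (∀ z : ℤ × ℤ, 0 < z.2 → f z = g z)) → f ≠ g →
      ∀ z, f (z + ((p : ℤ), 0)) = f z

/-- The reflection exchanges the two slopes up to sign and turns left edges into right ones, so that
only right edges have to be studied. -/
theorem hexSystem_flipHorz {A : Type*} {η : ℤ × ℤ → A} {a b L : ℤ} {p : ℕ}
    (h : HexSystem η a b L p) : HexSystem (η ∘ flipHorz) (-b) (-a) L p where
  lt := by have := h.lt; omega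
  pos := h.pos
  minimal := by
    classical
    let φ : ℤ × ℤ ≃ ℤ × ℤ :=
      { toFun := fun z => (L - 1 - z.1, z.2)
        invFun := fun z => (L - 1 - z.1, z.2)
        left_inv := fun z => by simp
        right_inv := fun z => by simp }
    have hφ : ∀ z, φ z = (L - 1 - z.1, z.2) := fun _ => rfl
    refine IsMinimalSlab.of_map (η := η) φ (fun T hT => ⟨?_, ?_⟩) (fun T => ?_) (isSlab_hex _ _ _) ?_
    · intro s hs
      obtain ⟨t, ht, rfl⟩ := Finset.mem_image.1 hs
      exact hT.1 t ht
    · intro s hs t ht x h1 h2 h3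
      obtain ⟨s, hs', rfl⟩ := Finset.mem_image.1 hs
      obtain ⟨t, ht', rfl⟩ := Finset.mem_image.1 ht
      simp only [hφ] at h1 h2 h3 ⊢
      have := hT.2 t ht' s hs' (L - 1 - x) h1.symm (by omega) (by omega)
      refine Finset.mem_image.2 ⟨_, this, ?_⟩
      simp [hφ, h1]
    · rw [complexity_comp_equiv, ← complexity_translate η _ (L - 1, 0), Finset.image_image]
      congr 1
      refine Finset.image_congr fun z _ => ?_
      simp only [hφ, Function.comp_apply, flipHorz_apply, Prod.mk_add_mk, add_zero]
      congr 1
      ring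
    · convert h.minimal
      ext ⟨x, y⟩
      simp only [Finset.mem_image, mem_hex, Prod.exists, hφ, Prod.mk.injEq]
      constructor
      · rintro ⟨x', y', h', rfl, rfl⟩
        omega
      · intro h'
        exact ⟨L - 1 - x, y, by omega, by omega, rfl⟩
  aperiodic := by
    intro u hu hper
    refine h.aperiodic (flipHorz u) ((EmbeddingLike.map_ne_zero_iff).2 hu) fun z => ?_
    have := hper (flipHorz z)
    simp only [Function.comp_apply, map_add] at this
    simpa using this
  left_pair := by
    intro ε hε
    obtain ⟨f, g, hf, hg, hfg, hne⟩ := h.right_pair (-ε) (by omega)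
    refine ⟨_, _, hf.comp_equiv flipHorz, hg.comp_equiv flipHorz, fun z hz => hfg _ ?_, fun he => hne ?_⟩
    · simp only [flipHorz_apply]; linarith
    · funext z; simpa using congrFun he (flipHorz z)
  right_pair := by
    intro ε hε
    obtain ⟨f, g, hf, hg, hfg, hne⟩ := h.left_pair (-ε) (by omega)
    refine ⟨_, _, hf.comp_equiv flipHorz, hg.comp_equiv flipHorz, fun z hz => hfg _ ?_, fun he => hne ?_⟩
    · simp only [flipHorz_apply]; linarith
    · funext z; simpa using congrFun he (flipHorz z)
  period_pos := h.period_pos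
  horizontal := by
    intro f g hf hg hfg hne
    have inv : ∀ {f : ℤ × ℤ → A}, Occ (η ∘ flipHorz) f → Occ η (f ∘ flipHorz) := by
      intro f hf
      have := hf.comp_equiv flipHorz
      convert this
      funext z
      simp
    have := h.horizontal _ _ (inv hf) (inv hg)
      (hfg.imp (fun h z hz => h _ hz) (fun h z hz => h _ hz)) (fun he => hne (by
        funext z; simpa using congrFun he (flipHorz z)))
    intro z
    have h2 := this (flipHorz z - ((p : ℤ), 0))
    simp only [Function.comp_apply, sub_add_cancel] at h2
    simp only [flipHorz_apply, Prod.fst_sub, Prod.snd_sub, neg_neg, sub_zero] at h2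
    rw [h2]
    congr 1
    ext <;> simp
    ring

theorem row_le_of_max {u u' s t : ℤ × ℤ} (hu : 0 < u.2) (hu' : 0 < u'.2)
    (hd : u.1 * u'.2 < u'.1 * u.2) (hs : crossWith u t ≤ crossWith u s)
    (ht : crossWith u' s ≤ crossWith u' t) : t.2 ≤ s.2 := by
  simp only [crossWith_apply] at hs ht
  by_contra! hlt
  nlinarith [mul_le_mul_of_nonneg_left hs hu'.le, mul_le_mul_of_nonneg_left ht hu.le,
    mul_pos (sub_pos.2 hlt) (sub_pos.2 hd)]

/-- A minimal slab whose extreme values are tied in two slanted directions is a hexagon. -/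
theorem exists_hex {S : Finset (ℤ × ℤ)} (hS : IsSlab S) {u₁ u₂ : ℤ × ℤ} (h₁ : 0 < u₁.2)
    (h₂ : 0 < u₂.2) (hd : u₁.1 * u₂.2 < u₂.1 * u₁.2)
    (tie : ∀ u, u = u₁ ∨ u = u₂ → ∀ ε : ℤ, ε = 1 ∨ ε = -1 → ∃ s ∈ S, ∃ t ∈ S, s.2 < t.2 ∧
      (ε • crossWith u) s = (ε • crossWith u) t ∧ ∀ r ∈ S, (ε • crossWith u) r ≤ (ε • crossWith u) s) :
    ∃ a b L x, a < b ∧ 1 ≤ L ∧ u₁ = u₁.2 • (a, 1) ∧ u₂ = u₂.2 • (b, 1) ∧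
      S = (hex a b L).image (· + (x, 0)) := by
  obtain ⟨s₁, hs₁, t₁, ht₁, lt₁, eq₁, max₁⟩ := tie u₁ (.inl rfl) 1 (.inl rfl)
  obtain ⟨s₂, hs₂, t₂, ht₂, lt₂, eq₂, max₂⟩ := tie u₂ (.inr rfl) 1 (.inl rfl)
  obtain ⟨s₁', hs₁', t₁', ht₁', lt₁', eq₁', max₁'⟩ := tie u₁ (.inl rfl) (-1) (.inr rfl)
  obtain ⟨s₂', hs₂', t₂', ht₂', lt₂', eq₂', max₂'⟩ := tie u₂ (.inr rfl) (-1) (.inr rfl)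
  simp only [one_smul, neg_smul, AddMonoidHom.neg_apply, neg_inj, neg_le_neg_iff] at *
  have k := row_le_of_max h₁ h₂ hd (max₁ t₂ ht₂) (by rw [← eq₂]; exact max₂ s₁ hs₁)
  have k' := row_le_of_max (u := u₁) (u' := u₂) (s := s₂') (t := t₁') h₁ h₂ hd
    (by rw [← eq₁']; exact max₁' _ hs₂') (max₂' _ ht₁')
  have := hS.1 s₂ hs₂
  have := hS.1 t₁ ht₁
  have := hS.1 s₁' hs₁'
  have := hS.1 t₂' ht₂'
  -- The rows satisfy `s₂ < t₂ ≤ s₁ < t₁` on one side and `s₁' < t₁' ≤ s₂' < t₂'` on the other;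
  -- three rows leave no choice.
  have r1 : s₁.2 = 1 := by omega
  have r2 : t₁.2 = 2 := by omega
  have r3 : s₂.2 = 0 := by omega
  have r4 : t₂.2 = 1 := by omega
  have r1' : s₁'.2 = 0 := by omega
  have r2' : t₁'.2 = 1 := by omega
  have r3' : s₂'.2 = 1 := by omega
  have r4' : t₂'.2 = 2 := by omega
  simp only [crossWith_apply] at *
  have hR0 : ∀ r ∈ S, r.2 = 0 → r.1 ≤ s₂.1 := fun r hr h => by
    have := max₂ r hr
    rw [h, r3] at this
    exact le_of_mul_le_mul_left (by linarith) h₂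
  have hR1 : ∀ r ∈ S, r.2 = 1 → r.1 ≤ s₁.1 := fun r hr h => by
    have := max₁ r hr
    rw [h, r1] at this
    exact le_of_mul_le_mul_left (by linarith) h₁
  have hR1' : ∀ r ∈ S, r.2 = 1 → r.1 ≤ t₂.1 := fun r hr h => by
    have := max₂ r hr
    rw [eq₂, h, r4] at this
    exact le_of_mul_le_mul_left (by linarith) h₂
  have hR2 : ∀ r ∈ S, r.2 = 2 → r.1 ≤ t₁.1 := fun r hr h => by
    have := max₁ r hr
    rw [eq₁, h, r2] at this
    exact le_of_mul_le_mul_left (by linarith) h₁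
  have hL0 : ∀ r ∈ S, r.2 = 0 → s₁'.1 ≤ r.1 := fun r hr h => by
    have := max₁' r hr
    rw [h, r1'] at this
    exact le_of_mul_le_mul_left (by linarith) h₁
  have hL1 : ∀ r ∈ S, r.2 = 1 → t₁'.1 ≤ r.1 := fun r hr h => by
    have := max₁' r hr
    rw [eq₁', h, r2'] at this
    exact le_of_mul_le_mul_left (by linarith) h₁
  have hL1' : ∀ r ∈ S, r.2 = 1 → s₂'.1 ≤ r.1 := fun r hr h => by
    have := max₂' r hr
    rw [h, r3'] at this
    exact le_of_mul_le_mul_left (by linarith) h₂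
  have hL2 : ∀ r ∈ S, r.2 = 2 → t₂'.1 ≤ r.1 := fun r hr h => by
    have := max₂' r hr
    rw [eq₂', h, r4'] at this
    exact le_of_mul_le_mul_left (by linarith) h₂
  have e1 : s₁.1 = t₂.1 := le_antisymm (hR1' _ hs₁ r1) (hR1 _ ht₂ r4)
  have e2 : t₁'.1 = s₂'.1 := le_antisymm (hL1 _ hs₂' r3') (hL1' _ ht₁' r2')
  have a1 : u₁.1 = u₁.2 * (t₁.1 - s₁.1) := by rw [r1, r2] at eq₁; linarith
  have a2 : u₁.1 = u₁.2 * (t₁'.1 - s₁'.1) := by rw [r1', r2'] at eq₁'; linarith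
  have b1 : u₂.1 = u₂.2 * (t₂.1 - s₂.1) := by rw [r3, r4] at eq₂; linarith
  have b2 : u₂.1 = u₂.2 * (t₂'.1 - s₂'.1) := by rw [r3', r4'] at eq₂'; linarith
  have ha : t₁.1 - s₁.1 = t₁'.1 - s₁'.1 := mul_left_cancel₀ h₁.ne' (a1.symm.trans a2)
  have hb : t₂.1 - s₂.1 = t₂'.1 - s₂'.1 := mul_left_cancel₀ h₂.ne' (b1.symm.trans b2)
  have hle := hR0 s₁' hs₁' r1'
  refine ⟨t₁.1 - s₁.1, t₂.1 - s₂.1, s₂.1 - s₁'.1 + 1, s₁'.1, ?_, by omega, ?_, ?_, ?_⟩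
  · by_contra! hcon
    rw [a1, b1] at hd
    nlinarith [mul_nonneg (mul_pos h₁ h₂).le (sub_nonneg.2 hcon)]
  · ext
    · simpa using a1
    · simp
  · ext
    · simpa using b1
    · simp
  · ext ⟨x, y⟩
    simp only [Finset.mem_image, mem_hex, Prod.exists, Prod.mk_add_mk, add_zero, Prod.mk.injEq]
    constructor
    · intro hz
      refine ⟨x - s₁'.1, y, ?_, by omega, rfl⟩
      obtain ⟨hy0, hy2⟩ := hS.1 _ hz
      have i1 := hR0 _ hz
      have i2 := hR1 _ hz
      have i3 := hR2 _ hz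
      have i4 := hL0 _ hz
      have i5 := hL1 _ hz
      have i6 := hL2 _ hz
      dsimp only at *
      omega
    · rintro ⟨x', y', h', rfl, rfl⟩
      rcases h' with ⟨rfl, h3, h4⟩ | ⟨rfl, h3, h4⟩ | ⟨rfl, h3, h4⟩
      · have := hS.2 s₁' hs₁' s₂ hs₂ (x' + s₁'.1) (by omega) (by omega) (by omega)
        rwa [r1'] at this
      · have := hS.2 t₁' ht₁' s₁ hs₁ (x' + s₁'.1) (by omega) (by omega) (by omega)
        rwa [r2'] at this
      · have := hS.2 t₂' ht₂' t₁ ht₁ (x' + s₁'.1) (by omega) (by omega) (by omega)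
        rwa [r4'] at this

/-! ### From aperiodicity to a hexagon -/

theorem exists_injective_int (A : Type*) [Finite A] : ∃ ι : A → ℤ, Function.Injective ι := by
  obtain ⟨φ, hφ⟩ := Countable.exists_injective_nat A
  exact ⟨fun a => φ a, Nat.cast_injective.comp hφ⟩

/-- The drift theorem, stated as the existence of a nonexpansive pair. -/
theorem exists_nonexpansive_pair {A : Type*} [Finite A] {η : ℤ × ℤ → A} {ι : A → ℤ}
    (hι : Function.Injective ι) (hap : ∀ h : ℤ × ℤ, h ≠ 0 → ¬ ∀ z, η (z + h) = η z)
    (P Q : ℤ × ℤ →+ ℤ) (a b h : ℤ × ℤ) (hPa : P a = 0)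
    (hQb : Q b = 0) (hQa : Q a ≠ 0) (hPb : P b ≠ 0) (hPh : 0 < P h) (hQh : 0 < Q h)
    (kill : Kills (ι ∘ η) [h, a, b]) (bad : ¬ Kills (ι ∘ η) [a, b])
    (exP : ∀ f g, Occ η f → Occ η g → (∀ z, P z < 0 → f z = g z) → f ≠ g →
      ∀ z, f (z + a) = f z) :
    ∃ f g, Occ η f ∧ Occ η g ∧ (∀ z, Q z < 0 → f z = g z) ∧ f ≠ g := by
  by_contra! hcon
  obtain ⟨J, hJ, hper⟩ := drift hι P Q a b h hPa hQb hQa hPb hPh hQh (congrFun kill)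
    (by by_contra! hall; exact bad (funext hall))
    (fun f g hf hg hz hfg => by
      by_contra hne
      obtain ⟨z, hz⟩ := hz
      have := exP f g hf hg hfg hne
      rw [shiftDiff_comm] at hz
      have h0 : shiftDiff a (ι ∘ f) = 0 := shiftDiff_eq_zero_iff.2 fun z => by simp [this z]
      rw [h0] at hz
      simp [shiftDiff] at hz)
    (fun f g hf hg hfg => hcon f g hf hg hfg)
  refine hap (J • h) (smul_ne_zero hJ.ne' ?_) hper
  rintro rfl
  simp at hPh

/-- A rectangle of minimal height gives horizontal periods, and a minimal slab `S` detects
nonexpansive directions by ties. If a horizontal and one slanted difference killed `η`, a flat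
direction `(N, 1)` would be nonexpansive without a tie on `S`. With two slanted directions, both are
nonexpansive on both sides, and the four ties make `S` a hexagon. -/
theorem exists_hexSystem {A : Type*} [Finite A] {η : ℤ × ℤ → A}
    (hη : ∃ n k : ℕ, 0 < n ∧ 0 < k ∧ k ≤ 3 ∧ complexity η (rectangle n k) ≤ n * k)
    (hap : ∀ h : ℤ × ℤ, h ≠ 0 → ¬ ∀ z, η (z + h) = η z) :
    ∃ a b L p, HexSystem η a b L p ∧ ∃ (ι : A → ℤ) (u₁ u₂ : ℤ × ℤ) (m : ℤ),
      Function.Injective ι ∧ 0 < u₁.2 ∧ 0 < u₂.2 ∧ u₁ = u₁.2 • (a, 1) ∧ u₂ = u₂.2 • (b, 1) ∧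
      m ≠ 0 ∧ Kills (ι ∘ η) [(m, 0), u₁, u₂] ∧
      ∀ k j : ℤ, k ≠ 0 → j ≠ 0 → ¬ Kills (ι ∘ η) [(k, 0), j • u₁] := by
  classical
  obtain ⟨ι, hι⟩ := exists_injective_int A
  have hfin : (Set.range (ι ∘ η)).Finite := (Set.finite_range ι).subset (Set.range_comp_subset_range _ _)
  have hap' : ∀ h : ℤ × ℤ, h ≠ 0 → ¬ ∀ z, (ι ∘ η) (z + h) = (ι ∘ η) z := fun h h0 hper =>
    hap h h0 fun z => hι (hper z)
  -- a rectangle of minimal height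
  obtain ⟨k, hk3, n, hn, hlow, hmin⟩ : ∃ k, k + 1 ≤ 3 ∧ ∃ n, 0 < n ∧
      complexity η (rectangle n (k + 1)) ≤ n * (k + 1) ∧ n * k + 1 ≤ complexity η (rectangle n k) := by
    have hex : ∃ k, ∃ n, 0 < n ∧ complexity η (rectangle n (k + 1)) ≤ n * (k + 1) := by
      obtain ⟨n, k, hn, hk, -, h⟩ := hη
      exact ⟨k - 1, n, hn, by rwa [Nat.sub_add_cancel hk]⟩
    obtain ⟨n, hn, hlow⟩ := Nat.find_spec hex
    refine ⟨Nat.find hex, ?_, n, hn, hlow, ?_⟩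
    · obtain ⟨n, k, hn, hk, hk3, h⟩ := hη
      have := Nat.find_min' hex (m := k - 1) ⟨n, hn, by rwa [Nat.sub_add_cancel hk]⟩
      omega
    · by_contra! hlt
      rcases Nat.eq_zero_or_pos (Nat.find hex) with h0 | h0
      · rw [h0, show rectangle n 0 = ∅ by simp [rectangle], complexity_empty] at hlt
        omega
      · have := Nat.find_min' hex (m := Nat.find hex - 1)
          ⟨n, hn, by rw [Nat.sub_add_cancel h0]; omega⟩
        omega
  obtain ⟨p, hp, hhor⟩ := exists_horizontal_period η hlow hmin
  obtain ⟨S, hS⟩ := exists_minimalSlab (isSlab_rectangle (n := n) hk3)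
    (by rw [card_rectangle]; exact hlow)
  obtain ⟨F, c, hF, hF0, hrel⟩ := exists_relation η (rectangle n (k + 1))
    (by rw [card_rectangle]; exact hlow) ι
  have hp' : (p : ℤ) ≠ 0 := by exact_mod_cast hp.ne'
  have hmul : ∀ (f : ℤ × ℤ → A) (m : ℤ), (∀ z, f (z + ((p : ℤ), 0)) = f z) →
      ∀ z, f (z + (m * p, 0)) = f z := by
    intro f m hf z
    have := periodic_zsmul hf m z
    simpa using this
  rcases killing_directions hfin hap' (rectangle n (k + 1)) F
    (fun s hs => (isSlab_rectangle hk3).1 s hs) hF hF0 c (hrel η (Occ.refl η)) with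
    ⟨m, u, hm, hu, hkill⟩ | ⟨u₁, u₂, m, h₁, h₂, hd, hm, hkill, hnk⟩
  · exfalso
    -- The factor `p` makes the horizontal direction a period of the configurations controlled by
    -- `hhor`, as `exP` requires.
    have hkill' : Kills (ι ∘ η) [(m * p, 0), u] := by
      have := hkill.zsmul p
      simpa [mul_comm] using this
    -- The part `|u.1| + 1` makes `Q u` positive; the sum prevents ties along `(N, 1)` between
    -- different rows of `S`.
    set N : ℤ := |u.1| + 1 + ∑ s ∈ S, 2 * |s.1| with hN
    have hsum0 : 0 ≤ ∑ s ∈ S, 2 * |s.1| := Finset.sum_nonneg fun _ _ => by positivity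
    have hNu : |u.1| + 1 ≤ N := by omega
    have hNs : ∀ s ∈ S, 2 * |s.1| < N := by
      intro s hs
      have := Finset.single_le_sum (f := fun s : ℤ × ℤ => 2 * |s.1|) (fun _ _ => by positivity) hs
      have := abs_nonneg u.1
      omega
    have habs := le_abs_self u.1
    have hQu : 0 < N * u.2 - u.1 := by nlinarith [abs_nonneg u.1]
    have hbad : ¬ Kills (ι ∘ η) [(m * p, 0), (N, 1)] := by
      intro hbad
      obtain ⟨h, h0, hper⟩ := periodic_of_kills_twice hfin (by simpa using ⟨hm, hp.ne'⟩) hkill' hbad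
        (by simp only [mul_one]; omega)
      exact hap' h h0 hper
    obtain ⟨f, g, hf, hg, hfg, hne⟩ := exists_nonexpansive_pair hι hap (AddMonoidHom.snd ℤ ℤ)
      (-crossWith (N, 1)) (m * p, 0) (N, 1) u rfl (by simp) (by simpa using ⟨hm, hp.ne'⟩)
      (by simp) hu (by simpa using hQu) (hkill'.cons (N, 1)).swap_tail.swap.swap_tail hbad
      (fun f g hf hg hfg hne => hmul f m (hhor f g hf hg (.inl hfg) hne))
    obtain ⟨s, hs, t, ht, hlt, heq, -⟩ := hS.tie _ (by simp) hf hg hfg hne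
    simp only [AddMonoidHom.neg_apply, crossWith_apply, neg_inj, one_mul] at heq
    have hs' := abs_lt.1 (lt_of_le_of_lt (by linarith [abs_nonneg s.1]) (hNs s hs) : |s.1| < N)
    have k1 := hNs s hs
    have k2 := hNs t ht
    have k3 := neg_abs_le s.1
    have k4 := le_abs_self t.1
    nlinarith
  · have hpair : ∀ u w : ℤ × ℤ, u.2 ≠ 0 → w.2 ≠ 0 → crossWith u w ≠ 0 →
        Kills (ι ∘ η) [(m, 0), u, w] → ¬ Kills (ι ∘ η) [(m * p, 0), u] → ∀ ε : ℤ, ε = 1 ∨ ε = -1 →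
        ∃ f g, Occ η f ∧ Occ η g ∧ (∀ z, (ε • crossWith u) z < 0 → f z = g z) ∧ f ≠ g := by
      intro u w hu hw huw hk hnk ε hε
      have hk1 : Kills (ι ∘ η) [(m * p, 0), u, w] := by
        have := hk.zsmul p
        simpa [mul_comm] using this
      -- The signs `δ` and `σ` are chosen so that `δ • w` advances in both half-planes.
      obtain ⟨δ, hδ, hδ'⟩ : ∃ δ : ℤ, (δ = 1 ∨ δ = -1) ∧ 0 < (ε • crossWith u) (δ • w) := by
        have : (ε • crossWith u) w ≠ 0 := by
          rw [AddMonoidHom.smul_apply, smul_eq_mul]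
          exact mul_ne_zero (by omega) huw
        rcases this.lt_or_gt with h | h
        · exact ⟨-1, .inr rfl, by rw [map_zsmul]; simpa using h⟩
        · exact ⟨1, .inl rfl, by rwa [one_smul]⟩
      obtain ⟨σ, hσ, hσ'⟩ : ∃ σ : ℤ, (σ = 1 ∨ σ = -1) ∧ 0 < σ * (δ * w.2) := by
        have : δ * w.2 ≠ 0 := mul_ne_zero (by omega) hw
        rcases this.lt_or_gt with h | h
        · exact ⟨-1, .inr rfl, by omega⟩
        · exact ⟨1, .inl rfl, by omega⟩
      refine exists_nonexpansive_pair hι hap (σ • AddMonoidHom.snd ℤ ℤ) (ε • crossWith u)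
        (m * p, 0) u (δ • w) (by simp) (by simp; right; ring) ?_ ?_ (by simpa using hσ') hδ'
        (hk1.swap_tail.swap.zsmul δ) hnk (fun f g hf hg hfg hne => hmul f m ?_)
      · have : ε ≠ 0 := by omega
        simp [this, hu, hm, hp.ne']
      · have : σ ≠ 0 := by omega
        simp [this, hu]
      · refine hhor f g hf hg ?_ hne
        rcases hσ with rfl | rfl
        · left
          intro z hz
          exact hfg z (by simpa using hz)
        · right
          intro z hz
          exact hfg z (by simpa using hz)
    have hmp : m * p ≠ 0 := mul_ne_zero hm hp'
    have hnk1 := (hnk (m * p) 1 hmp one_ne_zero)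
    simp only [one_smul] at hnk1
    have pair₁ := hpair u₁ u₂ h₁.ne' h₂.ne' (by simp; linarith) hkill hnk1.1
    have pair₂ := hpair u₂ u₁ h₂.ne' h₁.ne' (by simp; linarith) hkill.swap_tail hnk1.2
    have htie : ∀ u, u = u₁ ∨ u = u₂ → ∀ ε : ℤ, ε = 1 ∨ ε = -1 → ∃ s ∈ S, ∃ t ∈ S, s.2 < t.2 ∧
        (ε • crossWith u) s = (ε • crossWith u) t ∧
          ∀ r ∈ S, (ε • crossWith u) r ≤ (ε • crossWith u) s := by
      rintro u hu ε hε
      have hε0 : ε ≠ 0 := by omega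
      rcases hu with rfl | rfl
      · obtain ⟨f, g, hf, hg, hfg, hne⟩ := pair₁ ε hε
        exact hS.tie _ (by simp [hε0, h₁.ne']) hf hg hfg hne
      · obtain ⟨f, g, hf, hg, hfg, hne⟩ := pair₂ ε hε
        exact hS.tie _ (by simp [hε0, h₂.ne']) hf hg hfg hne
    obtain ⟨a, b, L, x, hab, hL, e₁, e₂, hSx⟩ := exists_hex hS.1 h₁ h₂ hd htie
    refine ⟨a, b, L, p, ⟨hab, hL, ?_, hap, ?_, ?_, hp, hhor⟩, ι, u₁, u₂, m, hι, h₁, h₂, e₁, e₂,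
      hm, hkill, fun k j hk hj => (hnk k j hk hj).1⟩
    · refine IsMinimalSlab.of_map (η := η) (Equiv.addRight ((x, 0) : ℤ × ℤ)) (fun T hT => ⟨?_, ?_⟩)
        (fun T => (complexity_translate η T (x, 0)).symm) (isSlab_hex _ _ _) ?_
      · intro s hs
        obtain ⟨t, ht, rfl⟩ := Finset.mem_image.1 hs
        simpa using hT.1 t ht
      · intro s hs t ht y h1 h2 h3
        obtain ⟨s, hs', rfl⟩ := Finset.mem_image.1 hs
        obtain ⟨t, ht', rfl⟩ := Finset.mem_image.1 ht
        simp only [Equiv.coe_addRight, Prod.fst_add, Prod.snd_add, add_zero] at h1 h2 h3 ⊢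
        have := hT.2 s hs' t ht' (y - x) h1 (by omega) (by omega)
        exact Finset.mem_image.2 ⟨_, this, by simp⟩
      · rw [hSx] at hS
        exact hS
    · intro ε hε
      obtain ⟨f, g, hf, hg, hfg, hne⟩ := pair₁ ε hε
      refine ⟨f, g, hf, hg, fun z hz => hfg z ?_, hne⟩
      have : (ε • crossWith u₁) z = u₁.2 * (ε * (z.1 - a * z.2)) := by
        rw [e₁]
        simp
        ring
      rw [this]
      exact mul_neg_of_pos_of_neg h₁ hz
    · intro ε hε
      obtain ⟨f, g, hf, hg, hfg, hne⟩ := pair₂ ε hε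
      refine ⟨f, g, hf, hg, fun z hz => hfg z ?_, hne⟩
      have : (ε • crossWith u₂) z = u₂.2 * (ε * (z.1 - b * z.2)) := by
        rw [e₂]
        simp
        ring
      rw [this]
      exact mul_neg_of_pos_of_neg h₂ hz

/-! ### The right edges and the horizontal pair -/

/-- `L - 1 + b - a` is the number of levels of the hexagon below the edge, and the middle row alone
meets all of them. -/
theorem isEdge_upper {a b L : ℤ} (hab : a < b) (hL : 1 ≤ L) :
    IsEdge (hex a b L) (crossWith (a, 1)) (a, 1) (L - 1 + b, 1) (L - 1 + b - a) where
  dir := by simp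
  line := by
    intro z hz
    refine ⟨z.2, ?_⟩
    simp at hz
    ext
    · simp; linarith
    · simp
  left := by
    refine ⟨by simp [mem_hex]; omega, .inl fun s hs h => ?_⟩
    rw [mem_hex] at hs
    dsimp only at *
    omega
  right := by
    refine ⟨by simp [mem_hex]; omega, .inl fun s hs h => ?_⟩
    rw [mem_hex] at hs
    simp only [Prod.mk_add_mk] at *
    omega
  slab := by
    have h1 : IsRowEnd (hex a b L) (L - 1 + b, 1) := by
      refine ⟨by simp [mem_hex]; omega, .inl fun s hs h => ?_⟩
      rw [mem_hex] at hs
      dsimp only at *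
      omega
    refine ((isSlab_hex a b L).erase h1).erase ⟨?_, .inl fun s hs h => ?_⟩
    · simp [mem_hex]; omega
    · rw [Finset.mem_erase, mem_hex] at hs
      simp only [Prod.mk_add_mk] at *
      omega
  dne := by simp
  below := by
    intro s hs
    simp only [Finset.mem_erase, mem_hex, Prod.mk_add_mk, ne_eq, Prod.ext_iff] at hs
    simp only [crossWith_apply]
    rcases hs with ⟨h1, h2, ⟨h3, h4⟩ | ⟨h3, h4⟩ | ⟨h3, h4⟩⟩ <;> rw [h3] at h1 h2 ⊢ <;> omega
  fill := by
    intro i h1 h2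
    simp only [crossWith_apply] at h1 h2
    refine ⟨(a + i, 1), ?_, by simp⟩
    simp only [Finset.mem_erase, mem_hex, Prod.mk_add_mk, ne_eq, Prod.mk.injEq]
    refine ⟨by omega, by omega, .inr (.inl ⟨trivial, by omega, by omega⟩)⟩

theorem isEdge_lower {a b L : ℤ} (hab : a < b) (hL : 1 ≤ L) :
    IsEdge (hex a b L) (crossWith (b, 1)) (b, 1) (L - 1, 0) (L - 1 + b - a) where
  dir := by simp
  line := by
    intro z hz
    refine ⟨z.2, ?_⟩
    simp at hz
    ext
    · simp; linarith
    · simp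
  left := by
    refine ⟨by simp [mem_hex]; omega, .inl fun s hs h => ?_⟩
    rw [mem_hex] at hs
    dsimp only at *
    omega
  right := by
    refine ⟨by simp [mem_hex]; omega, .inl fun s hs h => ?_⟩
    rw [mem_hex] at hs
    simp only [Prod.mk_add_mk] at *
    omega
  slab := by
    have h1 : IsRowEnd (hex a b L) (L - 1, 0) := by
      refine ⟨by simp [mem_hex]; omega, .inl fun s hs h => ?_⟩
      rw [mem_hex] at hs
      dsimp only at *
      omega
    refine ((isSlab_hex a b L).erase h1).erase ⟨?_, .inl fun s hs h => ?_⟩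
    · simp [mem_hex]; omega
    · rw [Finset.mem_erase, mem_hex] at hs
      simp only [Prod.mk_add_mk] at *
      omega
  dne := by simp
  below := by
    intro s hs
    simp only [Finset.mem_erase, mem_hex, Prod.mk_add_mk, ne_eq, Prod.ext_iff] at hs
    simp only [crossWith_apply]
    rcases hs with ⟨h1, h2, ⟨h3, h4⟩ | ⟨h3, h4⟩ | ⟨h3, h4⟩⟩ <;> rw [h3] at h1 h2 ⊢ <;> omega
  fill := by
    intro i h1 h2
    simp only [crossWith_apply] at h1 h2
    refine ⟨(b + i, 1), ?_, by simp⟩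
    simp only [Finset.mem_erase, mem_hex, Prod.mk_add_mk, ne_eq, Prod.mk.injEq]
    refine ⟨by omega, by omega, .inr (.inl ⟨trivial, by omega, by omega⟩)⟩

/-- Configurations of a nonexpansive pair in the direction `(a, 1)` are periodic. -/
theorem HexSystem.exists_left_period {A : Type*} [Finite A] {η : ℤ × ℤ → A} {a b L : ℤ} {p : ℕ}
    (H : HexSystem η a b L p) : ∃ q : ℕ, 0 < q ∧ ∀ f g, Occ η f → Occ η g →
      (∀ z, crossWith (a, 1) z < 0 → f z = g z) → f ≠ g → ∀ z, f (z + q • (a, 1)) = f z := by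
  obtain ⟨ι, hι⟩ := exists_injective_int A
  obtain ⟨F, c, hF, hF0, hrel⟩ := exists_relation η (hex a b L) H.minimal.2.1 ι
  have hE := isEdge_upper H.lt H.pos
  have hab := H.lt
  obtain ⟨q, hq, hT⟩ := exists_period_of_strip (Set.finite_range ι) (hex a b L) F hF
    (crossWith (a, 1)) (AddMonoidHom.snd ℤ ℤ) (a, 1) (1, 0) (by simp) (by simp) (by simp) (by simp)
    (fun z h1 h2 => by
      simp only [AddMonoidHom.coe_snd] at h2
      simp only [crossWith_apply, h2] at h1
      exact Prod.ext (by simpa using h1) h2) 0 (L - 1 + b - a) (fun s hs _ => by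
      rw [mem_hex] at hs
      simp only [crossWith_apply]
      rcases hs with ⟨h3, h4⟩ | ⟨h3, h4⟩ | ⟨h3, h4⟩ <;> rw [h3] <;> omega)
  refine ⟨q, hq, fun f g hf hg hfg hne z => ?_⟩
  obtain ⟨z₀, hz₀, hfirst⟩ := exists_first_row _ hfg hne
  refine hι (hT q dvd_rfl (ι ∘ f) (fun z => ⟨_, rfl⟩) ⟨c, hrel f hf⟩
    (crossWith (a, 1) z₀ - (L - 1 + b - a)) (fun z h1 h2 => ?_) z)
  have hc : ∀ n : ℕ, f (z + n • (a, 1)) = f z := by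
    intro n
    induction n with
    | zero => simp
    | succ n ih =>
      have hP : crossWith (a, 1) (z + n • (a, 1)) = crossWith (a, 1) z := by
        rw [map_add, map_nsmul, hE.dir, smul_zero, add_zero]
      rw [succ_nsmul, ← add_assoc, H.minimal.edge_const hE hf hg
        (fun y _ hy => hfirst y hy) rfl hz₀ _ (by rw [hP]; exact h1) (by rw [hP]; linarith), ih]
  exact congrArg ι (hc q)

/-- The horizontal direction is nonexpansive as well. -/
theorem HexSystem.exists_bottom_pair {A : Type*} [Finite A] {η : ℤ × ℤ → A} {a b L : ℤ} {p : ℕ}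
    (H : HexSystem η a b L p) {ι : A → ℤ} {u₁ u₂ : ℤ × ℤ} {m : ℤ} (hι : Function.Injective ι)
    (h₁ : 0 < u₁.2) (h₂ : 0 < u₂.2) (e₁ : u₁ = u₁.2 • (a, 1)) (e₂ : u₂ = u₂.2 • (b, 1)) (hm : m ≠ 0)
    (hk : Kills (ι ∘ η) [(m, 0), u₁, u₂])
    (hnk : ∀ k j : ℤ, k ≠ 0 → j ≠ 0 → ¬ Kills (ι ∘ η) [(k, 0), j • u₁]) :
    ∃ f g, Occ η f ∧ Occ η g ∧ (∀ z : ℤ × ℤ, z.2 < 0 → f z = g z) ∧ f ≠ g := by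
  obtain ⟨q, hq, htool⟩ := H.exists_left_period
  have hq0 : (q : ℤ) ≠ 0 := by exact_mod_cast hq.ne'
  -- The roles are exchanged: the period from `exists_left_period` supplies `exP` for the slanted
  -- half-plane, and the half-plane tested is now the lower one.
  refine exists_nonexpansive_pair hι H.aperiodic (crossWith (a, 1)) (AddMonoidHom.snd ℤ ℤ)
    ((q : ℤ) • u₁) (m, 0) u₂ ?_ rfl ?_ (by simpa using hm) ?_ h₂ ?_ ?_ ?_
  · rw [e₁, map_zsmul, map_zsmul]
    simp
  · simpa using ⟨hq.ne', h₁.ne'⟩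
  · rw [e₂, map_zsmul]
    simpa using mul_pos h₂ (sub_pos.2 H.lt)
  · exact (hk.swap.zsmul q).swap_tail.swap
  · exact fun h => hnk m q hm hq0 h.swap
  · intro f g hf hg hfg hne z
    have := periodic_zsmul (htool f g hf hg hfg hne) u₁.2 z
    rwa [show (q : ℤ) • u₁ = u₁.2 • q • (a, 1) by rw [e₁]; ext <;> simp <;> ring]

/-! ### A relation in characteristic two -/

theorem sum_hex {M : Type*} [AddCommMonoid M] (a b L : ℤ) (G : ℤ × ℤ → M) :
    ∑ s ∈ hex a b L, G s = ∑ x ∈ Finset.Ico 0 L, G (x, 0) + ∑ x ∈ Finset.Ico a (L + b), G (x, 1)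
      + ∑ x ∈ Finset.Ico (a + b) (L + a + b), G (x, 2) := by
  rw [hex, Finset.sum_union, Finset.sum_union, Finset.sum_product, Finset.sum_product,
    Finset.sum_product]
  · simp
  · rw [Finset.disjoint_left]
    intro z
    simp only [Finset.mem_product, Finset.mem_singleton]
    omega
  · rw [Finset.disjoint_left]
    intro z
    simp only [Finset.mem_product, Finset.mem_union, Finset.mem_singleton]
    omega

/-- If all rows of a one-dimensional recurrence annihilate a one-sided nonzero sequence, the
recurrence is trivial. -/
theorem eq_zero_of_annihilates_one_sided {R : Type*} [CommRing R] [IsDomain R] {I : Finset ℤ}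
    {c h : ℤ → R} (hc : ∀ t, ∑ i ∈ I, c i * h (i + t) = 0) {t₀ : ℤ} (ht₀ : h t₀ ≠ 0)
    (hlt : ∀ t < t₀, h t = 0) : ∀ i ∈ I, c i = 0 := by
  classical
  by_contra! hcon
  obtain ⟨i, hi, himax⟩ := (I.filter (c · ≠ 0)).exists_max_image id
    (by obtain ⟨i, hi⟩ := hcon; exact ⟨i, by simpa using hi⟩)
  simp only [Finset.mem_filter, id_eq] at hi himax
  have := hc (t₀ - i)
  rw [Finset.sum_eq_single_of_mem i hi.1, add_sub_cancel] at this
  · exact (mul_eq_zero.1 this).elim hi.2 ht₀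
  · intro j hj hji
    by_cases h0 : c j = 0
    · rw [h0, zero_mul]
    · have := himax j ⟨hj, h0⟩
      rw [hlt _ (by omega), mul_zero]

/-- In characteristic two, an edge direction `d` with a nonexpansive pair forces the relation
to vanish on functions of the transversal coordinate. -/
theorem IsMinimalSlab.line_sums {A R : Type*} [Finite A] [CommRing R] [IsDomain R] [CharP R 2]
    {η : ℤ × ℤ → A} {S : Finset (ℤ × ℤ)} (hS : IsMinimalSlab η S) {P : ℤ × ℤ →+ ℤ}
    {d e e' : ℤ × ℤ} {w : ℤ} (hE : IsEdge S P d e w) (hw : 0 ≤ w) (he' : P e' = 1) {φ : A → R}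
    (hφ : Function.Injective φ) {F : ℤ × ℤ → R} {c : R}
    (hrel : ∀ f, Occ η f → ∀ z, ∑ s ∈ S, F s * φ (f (s + z)) = c) {f g : ℤ × ℤ → A}
    (hf : Occ η f) (hg : Occ η g) (hfg : ∀ z, P z < 0 → f z = g z) (hne : f ≠ g) (h : ℤ → R) :
    ∑ s ∈ S, F s * h (P s) = 0 := by
  classical
  obtain ⟨z₀, hz₀, hfirst⟩ := exists_first_row P hfg hne
  set m := P z₀ with hm
  have hP1 : ∀ z, P (z + d) = P z := fun z => by rw [map_add, hE.dir, add_zero]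
  have hne' := hS.edge_ne hE hf hg (fun z _ h => hfirst z h) hm.symm hz₀
  have perf := hS.edge_double_period hE hf hg (fun z _ h => hfirst z h) hm.symm hz₀
  have perg := hS.edge_double_period hE hg hf (fun z _ h => (hfirst z h).symm) hm.symm hz₀.symm
  let Δ : ℤ × ℤ → R := fun z => φ (f z) - φ (g z)
  have hΔlt : ∀ z, P z < m → Δ z = 0 := fun z hz => by simp only [Δ, hfirst z hz, sub_self]
  have hΔne : ∀ z, P z = m → Δ z ≠ 0 := fun z hz h0 => hne' z hz (hφ (sub_eq_zero.1 h0))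
  have hΔper : ∀ z, Δ (z + d + d) = Δ z := by
    intro z
    by_cases hz : P z < m
    · rw [hΔlt z hz, hΔlt _ (by rwa [hP1, hP1])]
    · have e2 : z + d + d = z + 2 • d := by rw [two_smul, add_assoc]
      simp only [Δ, e2, perf z (by omega), perg z (by omega)]
  have hΔrel : ∀ z, ∑ s ∈ S, F s * Δ (s + z) = 0 := by
    intro z
    simp only [Δ, mul_sub, Finset.sum_sub_distrib, hrel f hf, hrel g hg, sub_self]
  -- a nonzero difference that is invariant under the edge
  obtain ⟨Δ', hlt, ⟨z₁, hz₁⟩, hper, hrel'⟩ : ∃ Δ' : ℤ × ℤ → R, (∀ z, P z < m → Δ' z = 0) ∧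
      (∃ z, Δ' z ≠ 0) ∧ (∀ z, Δ' (z + d) = Δ' z) ∧ ∀ z, ∑ s ∈ S, F s * Δ' (s + z) = 0 := by
    -- `Δ` is invariant under `2 • d`, so its difference along `d` changes sign under `d`, that is,
    -- is invariant in characteristic two. Either `Δ` or this difference will do.
    by_cases hD : shiftDiff d Δ = 0
    · exact ⟨Δ, hΔlt, ⟨z₀, hΔne z₀ rfl⟩, shiftDiff_eq_zero_iff.1 hD, hΔrel⟩
    · refine ⟨shiftDiff d Δ, fun z hz => ?_, Function.ne_iff.1 hD, fun z => ?_,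
        shiftDiff_linear_relation hΔrel d⟩
      · rw [shiftDiff, hΔlt z hz, hΔlt _ (by rwa [hP1]), sub_self]
      · rw [shiftDiff, shiftDiff, hΔper, ← neg_sub, CharTwo.neg_eq]
  have hdep : ∀ z, Δ' z = Δ' (P z • e') := by
    intro z
    obtain ⟨n, hn⟩ := hE.line (z - P z • e') (by rw [map_sub, map_zsmul, he']; simp)
    have := periodic_zsmul hper n (P z • e')
    rw [← hn, add_sub_cancel] at this
    exact this
  have hfib : ∀ H : ℤ → R, ∑ s ∈ S, F s * H (P s) =
      ∑ i ∈ S.image P, (∑ s ∈ S with P s = i, F s) * H i := by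
    intro H
    rw [← Finset.sum_fiberwise_of_maps_to (g := P) (t := S.image P)
      (fun s hs => Finset.mem_image_of_mem _ hs)]
    refine Finset.sum_congr rfl fun i _ => ?_
    rw [Finset.sum_mul]
    refine Finset.sum_congr rfl fun s hs => ?_
    rw [(Finset.mem_filter.1 hs).2]
  -- the lowest level at which the difference does not vanish
  have hex : ∃ n : ℕ, Δ' ((m + n) • e') ≠ 0 := by
    have h0 : m ≤ P z₁ := not_lt.1 fun h => hz₁ (hlt _ h)
    refine ⟨(P z₁ - m).toNat, ?_⟩
    rw [Int.toNat_of_nonneg (by omega), add_sub_cancel, ← hdep]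
    exact hz₁
  -- On functions of the level the relation is one-dimensional, with the sums of `F` over lines as
  -- coefficients, and it annihilates a nonzero one-sided sequence.
  have hcoef := eq_zero_of_annihilates_one_sided (I := S.image P)
    (c := fun i => ∑ s ∈ S with P s = i, F s) (h := fun t => Δ' (t • e')) (fun t => by
      rw [← hfib fun i => Δ' ((i + t) • e'), ← hrel' (t • e')]
      refine Finset.sum_congr rfl fun s _ => ?_
      rw [hdep (s + t • e'), map_add, map_zsmul, he']
      simp) (Nat.find_spec hex) (fun t ht => by
      by_cases htm : t < m
      · exact hlt _ (by rw [map_zsmul, he']; simpa using htm)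
      · by_contra hne0
        have := Nat.find_min' hex (m := (t - m).toNat)
          (by rwa [Int.toNat_of_nonneg (by omega), add_sub_cancel])
        omega)
  rw [hfib]
  exact Finset.sum_eq_zero fun i hi => by rw [hcoef i hi, zero_mul]

section Relation

open Polynomial

/-- `(ZMod 2)[X]` is an infinite domain, into which the alphabet embeds, of characteristic two, as
`line_sums` needs. If the top row of the relation vanished, the line sums in both directions would
give the middle row the period `b - a`; having finite support, it would vanish, and the bottom row
with it. -/
theorem HexSystem.exists_relation_top {A : Type*} [Finite A] {η : ℤ × ℤ → A} {a b L : ℤ} {p : ℕ}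
    (H : HexSystem η a b L p) : ∃ (φ : A → (ZMod 2)[X]) (F : ℤ × ℤ → (ZMod 2)[X]) (c : (ZMod 2)[X]),
      Function.Injective φ ∧ (∀ f, Occ η f → ∀ z, ∑ s ∈ hex a b L, F s * φ (f (s + z)) = c) ∧
      (∀ t, t = a ∨ t = b → ∀ h : ℤ → (ZMod 2)[X],
        ∑ s ∈ hex a b L, F s * h (s.1 - t * s.2) = 0) ∧
      ∃ x, a + b ≤ x ∧ x < L + a + b ∧ F (x, 2) ≠ 0 := by
  classical
  obtain ⟨ψ, hψ⟩ := Countable.exists_injective_nat A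
  set φ : A → (ZMod 2)[X] := fun x => Infinite.natEmbedding _ (ψ x) with hφd
  have hφ : Function.Injective φ := (Infinite.natEmbedding _).injective.comp hψ
  obtain ⟨F, c, hF, hF0, hrel⟩ := exists_relation η (hex a b L) H.minimal.2.1 φ
  have hab := H.lt
  have hL := H.pos
  have hline : ∀ t, t = a ∨ t = b → ∀ h : ℤ → (ZMod 2)[X],
      ∑ s ∈ hex a b L, F s * h (s.1 - t * s.2) = 0 := by
    rintro t (rfl | rfl) h
    · obtain ⟨f, g, hf, hg, hfg, hne⟩ := H.left_pair 1 (.inl rfl)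
      have := H.minimal.line_sums (isEdge_upper hab hL) (by omega) (e' := (1, 0)) (by simp) hφ hrel
        hf hg (fun z hz => hfg z (by simpa using hz)) hne h
      simpa using this
    · obtain ⟨f, g, hf, hg, hfg, hne⟩ := H.right_pair 1 (.inl rfl)
      have := H.minimal.line_sums (isEdge_lower hab hL) (by omega) (e' := (1, 0)) (by simp) hφ hrel
        hf hg (fun z hz => hfg z (by simpa using hz)) hne h
      simpa using this
  refine ⟨φ, F, c, hφ, hrel, hline, ?_⟩
  by_contra! htop
  have hpoint : ∀ t, t = a ∨ t = b → ∀ x, F (x, 0) + F (x + t, 1) = 0 := by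
    intro t ht x
    have := hline t ht fun i => if i = x then 1 else 0
    rw [sum_hex] at this
    have e1 : ∀ i, (i - t * 1 = x) ↔ (i = x + t) := fun i => by constructor <;> intro h <;> linarith
    simp only [mul_ite, mul_one, mul_zero, sub_zero, Finset.sum_ite_eq', Finset.mem_Ico] at this
    rw [Finset.sum_eq_zero (s := Finset.Ico (a + b) (L + a + b)), add_zero] at this
    · simp only [sub_eq_iff_eq_add, Finset.sum_ite_eq', Finset.mem_Ico] at this
      have f0 : ¬ (0 ≤ x ∧ x < L) → F (x, 0) = 0 := fun h => hF0 _ (by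
        simp only [mem_hex]; omega)
      have f1 : ¬ (a ≤ x + t ∧ x + t < L + b) → F (x + t, 1) = 0 := fun h => hF0 _ (by
        simp only [mem_hex]; omega)
      by_cases h0 : 0 ≤ x ∧ x < L <;> by_cases h1 : a ≤ x + t ∧ x + t < L + b
      · simpa only [h0, h1, and_self, if_true] using this
      · rw [f1 h1]
        simpa only [h0, h1, and_self, if_true, if_false] using this
      · rw [f0 h0]
        simpa only [h0, h1, and_self, if_true, if_false] using this
      · rw [f0 h0, f1 h1, add_zero]
    · intro i hi
      rw [Finset.mem_Ico] at hi
      simp [htop i hi.1 hi.2]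
  have hper : ∀ x, F (x + (b - a), 1) = F (x, 1) := by
    intro x
    have h1 := hpoint a (.inl rfl) (x - a)
    have h2 := hpoint b (.inr rfl) (x - a)
    rw [← h2, add_right_inj, sub_add_cancel] at h1
    rw [h1]
    congr 2
    ring
  have hpern : ∀ (n : ℕ) x, F (x + n * (b - a), 1) = F (x, 1) := by
    intro n
    induction n with
    | zero => simp
    | succ n ih =>
      intro x
      have h := hper (x + n * (b - a))
      rw [ih x] at h
      rw [← h]
      congr 2
      push_cast
      ring
  have hrow1 : ∀ x, F (x, 1) = 0 := by
    intro x
    rw [← hpern (L + b - x).toNat x]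
    refine hF0 _ ?_
    have : (L + b - x : ℤ) ≤ (L + b - x).toNat := Int.self_le_toNat _
    simp only [mem_hex]
    have : x + ((L + b - x).toNat : ℤ) * (b - a) ≥ L + b := by nlinarith [Int.natCast_nonneg (L + b - x).toNat]
    omega
  obtain ⟨⟨x, y⟩, hs, hne⟩ := hF
  apply hne
  rcases mem_hex.1 hs with ⟨rfl, h⟩ | ⟨rfl, h⟩ | ⟨rfl, h⟩
  · have := hpoint a (.inl rfl) x
    rwa [hrow1, add_zero] at this
  · exact hrow1 x
  · exact htop x h.1 h.2

/-- If the two lower rows of a configuration are shifts of each other, then so are the upper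
two as soon as they are on a long enough window. -/
theorem HexSystem.slope_of_window {A : Type*} [Finite A] {η : ℤ × ℤ → A} {a b L : ℤ} {p : ℕ}
    (H : HexSystem η a b L p) {f : ℤ × ℤ → A} (hf : Occ η f) {t : ℤ} (ht : t = a ∨ t = b)
    (h01 : ∀ x, f (x + t, 1) = f (x, 0)) {x₀ : ℤ}
    (h12 : ∀ x, x₀ ≤ x → x < x₀ + L → f (x + t, 2) = f (x, 1)) (x : ℤ) :
    f (x + t, 2) = f (x, 1) := by
  obtain ⟨φ, F, c, hφ, hrel, hline, i₀, hi₀, hi₀', hFi₀⟩ := H.exists_relation_top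
  obtain ⟨ℓ, hℓ⟩ := Int.eq_ofNat_of_zero_le (show 0 ≤ L by have := H.pos; omega)
  let α : ℤ → (ZMod 2)[X] := fun x => φ (f (x, 2)) - φ (f (x - t, 1))
  have hα : ∀ o, ∑ i ∈ Finset.Ico (0 : ℤ) ℓ, F (i + (a + b), 2) * α (i + o) = c := by
    intro o
    have h1 := hrel f hf (o - (a + b), 0)
    -- The line sums are applied to the bottom row of `f`. Since the middle row is its shift by `t`,
    -- subtraction removes both lower rows from the relation.
    have h2 := hline t ht fun i => φ (f (i + (o - (a + b)), 0))
    rw [← sub_zero (∑ s ∈ hex a b L, _), ← h2, ← Finset.sum_sub_distrib, sum_hex] at h1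
    rw [Finset.sum_eq_zero, Finset.sum_eq_zero, zero_add, zero_add] at h1
    · rw [← h1, show a + b = 0 + (a + b) by ring, show L + a + b = ℓ + (a + b) by rw [hℓ]; ring,
        ← Finset.sum_Ico_add']
      refine Finset.sum_congr rfl fun i _ => ?_
      have e1 : f (i + (a + b) - t * 2 + (o - (a + b)), 0) = f (i + o - t, 1) := by
        rw [← h01]
        congr 2
        ring
      have e2 : i + (a + b) + (o - (a + b)) = i + o := by ring
      simp only [α, Prod.mk_add_mk, add_zero, zero_add, mul_sub, e1, e2]
    · intro i _
      simp only [Prod.mk_add_mk, add_zero, mul_one]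
      rw [← h01 (i - t + (o - (a + b))), show i - t + (o - (a + b)) + t = i + (o - (a + b)) by ring, sub_self]
    · intro i _
      simp
  have hwin : ∀ x, x₀ + t ≤ x → x < x₀ + t + ℓ → α x = 0 := by
    intro x h1 h2
    have := h12 (x - t) (by omega) (by rw [hℓ]; omega)
    rw [sub_add_cancel] at this
    simp only [α, this, sub_self]
  have hc : c = 0 := by
    rw [← hα (x₀ + t)]
    refine Finset.sum_eq_zero fun i hi => ?_
    rw [Finset.mem_Ico] at hi
    rw [hwin _ (by omega) (by omega), mul_zero]
  have := eq_zero_of_window ℓ (fun i => F (i + (a + b), 2))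
    ⟨i₀ - (a + b), by omega, by omega, by rwa [sub_add_cancel]⟩ α
    (fun x => (hα x).trans hc) (x₀ + t) (fun x h1 h2 => hwin x h1 (by omega)) (x + t)
  have h := hφ (sub_eq_zero.1 this)
  rwa [add_sub_cancel_right] at h

end Relation

/-! ### Ambiguous words and short periods -/

section Exit

theorem IsMinimalSlab.exists_edge_pair {A : Type*} [Finite A] {η : ℤ × ℤ → A}
    {S : Finset (ℤ × ℤ)} (hS : IsMinimalSlab η S) {P : ℤ × ℤ →+ ℤ} {d e : ℤ × ℤ} {w : ℤ}
    (hE : IsEdge S P d e w)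
    (h : ∃ f g, Occ η f ∧ Occ η g ∧ (∀ z, P z < 0 → f z = g z) ∧ f ≠ g) :
    ∃ f g, Occ η f ∧ Occ η g ∧ (∀ s ∈ (S.erase e).erase (e + d), f s = g s) ∧ f e ≠ g e ∧
      (∀ z, P e - w ≤ P z → P z < P e → f (z + d) = f z ∧ g (z + d) = g z) := by
  obtain ⟨f, g, hf, hg, hfg, hne⟩ := h
  obtain ⟨z₀, hz₀, hfirst⟩ := exists_first_row P hfg hne
  have cf := hS.edge_const hE hf hg (fun z _ h => hfirst z h) rfl hz₀
  have cg := hS.edge_const hE hg hf (fun z _ h => (hfirst z h).symm) rfl hz₀.symm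
  refine ⟨_, _, hf.shift (z₀ - e), hg.shift (z₀ - e), fun s hs => hfirst _ ?_, ?_, fun z h1 h2 => ?_⟩
  · have := hE.below s hs
    rw [map_add, map_sub]
    omega
  · simpa using hz₀
  · rw [show z + d + (z₀ - e) = z + (z₀ - e) + d by abel]
    have : P (z + (z₀ - e)) = P z + (P z₀ - P e) := by rw [map_add, map_sub]
    exact ⟨cf _ (by omega) (by omega), cg _ (by omega) (by omega)⟩

/-- The only ambiguous word at an edge is invariant along the edge. -/
theorem IsMinimalSlab.edge_word {A : Type*} [Finite A] {η : ℤ × ℤ → A}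
    {S : Finset (ℤ × ℤ)} (hS : IsMinimalSlab η S) {P : ℤ × ℤ →+ ℤ} {d e : ℤ × ℤ} {w : ℤ}
    (hE : IsEdge S P d e w)
    (h : ∃ f g, Occ η f ∧ Occ η g ∧ (∀ z, P z < 0 → f z = g z) ∧ f ≠ g) {f g : ℤ × ℤ → A}
    (hf : Occ η f) (hg : Occ η g) (hfg : ∀ s ∈ (S.erase e).erase (e + d), f s = g s)
    (hne : ∃ s ∈ S, f s ≠ g s) {s : ℤ × ℤ} (hs : s ∈ (S.erase e).erase (e + d))
    (hs' : s + d ∈ (S.erase e).erase (e + d)) : f (s + d) = f s := by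
  obtain ⟨f', g', hf', hg', hfg', hne', hc⟩ := hS.exists_edge_pair hE h
  have := ambiguous_unique ((Finset.erase_subset _ _).trans (Finset.erase_subset _ _))
    (hS.edge_step hE) hf hg hf' hg' hfg hfg' hne ⟨e, hE.left.1, hne'⟩
  rw [this _ hs, this _ hs', (hc s (hE.below s hs).1 (hE.below s hs).2).1]

theorem forall_of_window {D : ℤ → Prop} {L M : ℤ}
    (hr : ∀ x, (∀ i, x ≤ i → i < x + L - 1 → D i) → x + L ≤ M → D (x + L - 1))
    (hl : ∀ x, (∀ i, x < i → i < x + L → D i) → x + L ≤ M → D x) {x₀ : ℤ} (hx₀ : x₀ + L ≤ M)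
    (h : ∀ i, x₀ ≤ i → i < x₀ + L - 1 → D i) (x : ℤ) (hx : x < M) : D x := by
  have up : ∀ q : ℤ, x₀ + L - 1 ≤ q → q ≤ M → ∀ i, x₀ ≤ i → i < q → D i := by
    intro q hq
    induction q, hq using Int.leInduction with
    | base => exact fun _ => h
    | succ q hq ih =>
      intro hqM i h1 h2
      by_cases h3 : i < q
      · exact ih (by omega) i h1 h3
      have := hr (q - L + 1) (fun i h1 h2 => ih (by omega) i (by omega) (by omega)) (by omega)
      rwa [show q - L + 1 + L - 1 = i by omega] at this
  have down : ∀ q : ℤ, q ≤ x₀ → ∀ i, q ≤ i → i < M → D i := by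
    intro q hq
    induction q, hq using Int.leInductionDown with
    | base => exact up M (by omega) le_rfl
    | pred q hq ih =>
      intro i h1 h2
      by_cases h3 : q ≤ i
      · exact ih i h3 h2
      rw [show i = q - 1 by omega]
      exact hl _ (fun i h1 h2 => ih i (by omega) (by omega)) (by omega)
  exact down (min x₀ x) (min_le_left _ _) x (min_le_right _ _) hx

theorem eq_of_window_of_periodic {A : Type*} {u v : ℤ → A} {q : ℕ} (hq : 0 < q)
    (hu : ∀ x, u (x + q) = u x) (hv : ∀ x, v (x + q) = v x) {x₀ L : ℤ} (hL : (q : ℤ) ≤ L - 1)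
    (h : ∀ x, x₀ ≤ x → x < x₀ + L - 1 → u x = v x) (x : ℤ) : u x = v x := by
  have hq' : (0 : ℤ) < q := by exact_mod_cast hq
  have e : x = x₀ + (x - x₀) % q + (x - x₀) / q * q := by
    have := Int.emod_add_mul_ediv (x - x₀) q
    linarith
  have h1 := Int.emod_nonneg (x - x₀) hq'.ne'
  have h2 := Int.emod_lt_of_pos (x - x₀) hq'
  have hu' : Function.Periodic u (q : ℤ) := hu
  have hv' : Function.Periodic v (q : ℤ) := hv
  rw [e, ← smul_eq_mul, hu'.zsmul _ _, hv'.zsmul _ _]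
  exact h _ (by omega) (by omega)

variable {A : Type*} [Finite A] {η : ℤ × ℤ → A} {a b L : ℤ} {p : ℕ}

/-- Both ends of the top row of the hexagon are determined by its other points, so agreement on `L -
1` consecutive points passes to the next point on either side as long as the hexagon stays where the
lower rows agree. -/
theorem HexSystem.forall_row_of_window (H : HexSystem η a b L p) {f g : ℤ × ℤ → A} (hf : Occ η f)
    (hg : Occ η g) {j M : ℤ} (h0 : ∀ x < M - a - b, f (x, j) = g (x, j))
    (h1 : ∀ x < M - a, f (x, j + 1) = g (x, j + 1)) {x₀ : ℤ} (hx₀ : x₀ + L ≤ M)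
    (h : ∀ x, x₀ ≤ x → x < x₀ + L - 1 → f (x, j + 2) = g (x, j + 2)) (x : ℤ) (hx : x < M) :
    f (x, j + 2) = g (x, j + 2) := by
  have hab := H.lt
  have hL := H.pos
  have key : ∀ x, x + L ≤ M → ∀ t : ℤ, t = a + b ∨ t = L - 1 + a + b →
      (∀ i, x ≤ i → i < x + L → i ≠ x - a - b + t → f (i, j + 2) = g (i, j + 2)) →
      f (x - a - b + t, j + 2) = g (x - a - b + t, j + 2) := by
    intro x hx t ht h
    have hend : IsRowEnd (hex a b L) (t, 2) := by
      refine ⟨by rw [mem_hex]; dsimp only; omega, ?_⟩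
      rcases ht with rfl | rfl
      · refine .inr fun s hs h2 => ?_
        rw [mem_hex] at hs
        dsimp only at *
        omega
      · refine .inl fun s hs h2 => ?_
        rw [mem_hex] at hs
        dsimp only at *
        omega
    have := H.minimal.determined hend hf hg (x - a - b, j) (fun ⟨s, r⟩ hs hst => by
      rw [mem_hex] at hs
      dsimp only at hs
      simp only [Prod.mk_add_mk]
      rcases hs with ⟨rfl, h2⟩ | ⟨rfl, h2⟩ | ⟨rfl, h2⟩
      · rw [zero_add]; exact h0 _ (by omega)
      · rw [add_comm 1 j]; exact h1 _ (by omega)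
      · rw [add_comm 2 j]
        refine h _ (by omega) (by omega) fun he => hst ?_
        rw [show s = t by omega])
    simpa only [Prod.mk_add_mk, add_comm 2 j, add_comm t] using this
  refine forall_of_window (D := fun x => f (x, j + 2) = g (x, j + 2)) (fun x h hx => ?_)
    (fun x h hx => ?_) hx₀ h x hx
  · have := key x hx _ (.inr rfl) fun i h1 h2 h3 => h i h1 (by omega)
    rwa [show x - a - b + (L - 1 + a + b) = x + L - 1 by ring] at this
  · have := key x hx _ (.inl rfl) fun i h1 h2 h3 => h i (by omega) h2
    rwa [show x - a - b + (a + b) = x by ring] at this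

/-- The top row has `L` points, but minimality lets it add at most `L - 1` words. The two lower rows
thus show at most `L - 1` words, and the Morse–Hedlund theorem applies. Because `q ≤ L - 1`, windows
of `L - 1` points suffice later to compare rows. -/
theorem HexSystem.exists_period_of_ambiguous (H : HexSystem η a b L p) {f : ℤ × ℤ → A} {j : ℤ}
    (hamb : ∀ x : ℤ, ∃ f' g', Occ η f' ∧ Occ η g' ∧
      (∀ t ∈ hex a b L, t.2 < 2 → f' t = f (t + (x, j))) ∧
      (∀ t ∈ hex a b L, t.2 < 2 → g' t = f (t + (x, j))) ∧ ∃ s ∈ hex a b L, f' s ≠ g' s) :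
    ∃ q : ℕ, 0 < q ∧ (q : ℤ) ≤ L - 1 ∧
      ∀ x, f (x + q, j) = f (x, j) ∧ f (x + q, j + 1) = f (x, j + 1) := by
  have hab := H.lt
  have hL := H.pos
  set T := (hex a b L).filter (·.2 < 2) with hT
  have hTS : T ⊆ hex a b L := Finset.filter_subset _ _
  have hslab : IsSlab T := by
    refine ⟨fun s hs => (isSlab_hex a b L).1 s (hTS hs), fun s hs t ht x h1 h2 h3 => ?_⟩
    rw [hT, Finset.mem_filter] at *
    exact ⟨(isSlab_hex a b L).2 s hs.1 t ht.1 x h1 h2 h3, hs.2⟩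
  obtain ⟨ℓ, hℓ⟩ := Int.eq_ofNat_of_zero_le (show 0 ≤ L - 1 by omega)
  have hcard : T.card + (ℓ + 1) ≤ (hex a b L).card := by
    have hsub : T ∪ Finset.Ico (a + b) (L + a + b) ×ˢ {2} ⊆ hex a b L := by
      refine Finset.union_subset hTS fun s hs => ?_
      simp only [Finset.mem_product, Finset.mem_Ico, Finset.mem_singleton] at hs
      rw [mem_hex]
      omega
    have h := Finset.card_le_card hsub
    rw [Finset.card_union_of_disjoint, Finset.card_product, Int.card_Ico, Finset.card_singleton] at h
    · omega
    · rw [Finset.disjoint_left]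
      intro s hs hs'
      rw [hT, Finset.mem_filter] at hs
      simp only [Finset.mem_product, Finset.mem_singleton] at hs'
      omega
  have hc : complexity η (hex a b L) ≤ complexity η T + ℓ := by
    have := H.minimal.2.2 T hslab (by omega)
    have hlow := H.minimal.2.1
    have hcard' : (hex a b L).card ≤ T.card + (ℓ + 1) := by
      have hsub : hex a b L ⊆ T ∪ Finset.Ico (a + b) (L + a + b) ×ˢ {2} := by
        intro s hs
        rw [Finset.mem_union, hT, Finset.mem_filter]
        simp only [Finset.mem_product, Finset.mem_Ico, Finset.mem_singleton]
        have hs' := hs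
        rw [mem_hex] at hs'
        by_cases h2 : s.2 < 2
        · exact .inl ⟨hs, h2⟩
        · exact .inr (by omega)
      refine (Finset.card_le_card hsub).trans ((Finset.card_union_le _ _).trans ?_)
      rw [Finset.card_product, Int.card_Ico, Finset.card_singleton]
      omega
    omega
  obtain ⟨q, h1, h2, h3⟩ := period_of_ambiguous (f := fun z => f (z + (0, j))) (L := ℓ) hTS hc le_rfl
    (fun x => by
      obtain ⟨f', g', h1, h2, h3, h4, h5⟩ := hamb x
      refine ⟨f', g', h1, h2, fun t ht => ?_, fun t ht => ?_, h5⟩ <;>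
      · rw [hT, Finset.mem_filter] at ht
        first
        | rw [h3 t ht.1 ht.2]
        | rw [h4 t ht.1 ht.2]
        rw [add_assoc, show ((x, 0) + (0, j) : ℤ × ℤ) = (x, j) by simp])
    (fun r : Bool => if r then (a, 1) else (0, 0)) (fun r i hi => by
      rw [hT, Finset.mem_filter, mem_hex]
      cases r <;> simp <;> omega)
  refine ⟨q, h1, by omega, fun x => ⟨?_, ?_⟩⟩
  · simpa using h3 x false
  · have := h3 (x - a) true
    simp only [if_true, Prod.mk_add_mk, add_zero] at this
    rw [add_comm j 1]
    convert this using 2 <;> simp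
    ring

/-- If two configurations agree on two rows and differ on the next one, those two rows have a
short period. -/
theorem HexSystem.exists_short_period (H : HexSystem η a b L p) {f g : ℤ × ℤ → A} (hf : Occ η f)
    (hg : Occ η g) (hp : ∀ z, f (z + ((p : ℤ), 0)) = f z) {j M : ℤ}
    (h0 : ∀ x < M - a - b, f (x, j) = g (x, j)) (h1 : ∀ x < M - a, f (x, j + 1) = g (x, j + 1))
    {x₁ : ℤ} (hx₁ : x₁ < M) (hne : f (x₁, j + 2) ≠ g (x₁, j + 2)) :
    ∃ q : ℕ, 0 < q ∧ (q : ℤ) ≤ L - 1 ∧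
      ∀ x, f (x + q, j) = f (x, j) ∧ f (x + q, j + 1) = f (x, j + 1) := by
  have hab := H.lt
  have hL := H.pos
  refine H.exists_period_of_ambiguous fun x => ?_
  have hp0 : (1 : ℤ) ≤ p := by exact_mod_cast H.period_pos
  -- Agreement is known only to the left of `M`; the period `p` of `f` brings every window there.
  obtain ⟨n, hn⟩ : ∃ n : ℕ, x - n * p + L + a + b ≤ M := by
    refine ⟨(x + L + a + b - M).toNat, ?_⟩
    have := Int.self_le_toNat (x + L + a + b - M)
    nlinarith [Int.natCast_nonneg (x + L + a + b - M).toNat]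
  have hper : ∀ t : ℤ × ℤ, f (t + (x - n * p, j)) = f (t + (x, j)) := by
    intro t
    have := periodic_nsmul hp n (t + (x - n * p, j))
    rw [← this, add_assoc]
    congr 2
    ext <;> simp
  have hrows : ∀ t ∈ hex a b L, t.2 < 2 → g (t + (x - n * p, j)) = f (t + (x - n * p, j)) := by
    rintro ⟨s, r⟩ ht h2
    rw [mem_hex] at ht
    dsimp only at ht h2
    simp only [Prod.mk_add_mk]
    rcases ht with ⟨rfl, h3⟩ | ⟨rfl, h3⟩ | ⟨rfl, h3⟩
    · rw [zero_add]; exact (h0 _ (by omega)).symm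
    · rw [add_comm 1 j]; exact (h1 _ (by omega)).symm
    · omega
  refine ⟨_, _, hf.shift (x - n * p, j), hg.shift (x - n * p, j), fun t _ _ => hper t,
    fun t ht h2 => (hrows t ht h2).trans (hper t), ?_⟩
  by_contra! hcon
  refine hne (H.forall_row_of_window hf hg h0 h1 (x₀ := x - n * p + a + b) (by omega)
    (fun y h2 h3 => ?_) x₁ hx₁)
  have := hcon (y - (x - n * p), 2) (by rw [mem_hex]; dsimp only; omega)
  simpa only [Prod.mk_add_mk, sub_add_cancel, add_comm 2 j] using this

end Exit

/-! ### Slopes read off at the right edges -/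

section Slope

theorem mem_hex_upper {a b L x y : ℤ} :
    (x, y) ∈ ((hex a b L).erase (L - 1 + b, 1)).erase ((L - 1 + b, 1) + (a, 1)) ↔
      (y = 0 ∧ 0 ≤ x ∧ x < L) ∨ (y = 1 ∧ a ≤ x ∧ x < L - 1 + b) ∨
        (y = 2 ∧ a + b ≤ x ∧ x < L - 1 + a + b) := by
  simp only [Finset.mem_erase, mem_hex, Prod.mk_add_mk, ne_eq, Prod.mk.injEq]
  omega

theorem mem_hex_lower {a b L x y : ℤ} :
    (x, y) ∈ ((hex a b L).erase (L - 1, 0)).erase ((L - 1, 0) + (b, 1)) ↔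
      (y = 0 ∧ 0 ≤ x ∧ x < L - 1) ∨ (y = 1 ∧ a ≤ x ∧ x < L - 1 + b) ∨
        (y = 2 ∧ a + b ≤ x ∧ x < L + a + b) := by
  simp only [Finset.mem_erase, mem_hex, Prod.mk_add_mk, ne_eq, Prod.mk.injEq]
  omega

theorem HexSystem.upper_pair {A : Type*} {η : ℤ × ℤ → A} {a b L : ℤ} {p : ℕ}
    (H : HexSystem η a b L p) : ∃ f g, Occ η f ∧ Occ η g ∧
    (∀ z, crossWith (a, 1) z < 0 → f z = g z) ∧ f ≠ g := by
  simpa using H.left_pair 1 (.inl rfl)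

theorem HexSystem.lower_pair {A : Type*} {η : ℤ × ℤ → A} {a b L : ℤ} {p : ℕ}
    (H : HexSystem η a b L p) : ∃ f g, Occ η f ∧ Occ η g ∧
    (∀ z, crossWith (b, 1) z < 0 → f z = g z) ∧ f ≠ g := by
  simpa using H.right_pair 1 (.inl rfl)

variable {A : Type*} [Finite A] {η : ℤ × ℤ → A} {a b L : ℤ} {p : ℕ}

/-- A configuration that reads the ambiguous word of the edge `(a, 1)` on the three lowest rows
has slope `a` there. -/
theorem HexSystem.slope_of_upper_word (H : HexSystem η a b L p) {f k ψ : ℤ × ℤ → A}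
    (hf : Occ η f) (hk : Occ η k) (hψ : Occ η ψ) (hp : ∀ z, f (z + ((p : ℤ), 0)) = f z) {q : ℕ}
    (hq : 0 < q) (hqL : (q : ℤ) ≤ L - 1)
    (hper : ∀ x, f (x + q, 0) = f (x, 0) ∧ f (x + q, 1) = f (x, 1))
    (hfk : ∀ s ∈ ((hex a b L).erase (L - 1 + b, 1)).erase ((L - 1 + b, 1) + (a, 1)), f s = k s)
    (hne : ∃ s ∈ hex a b L, f s ≠ k s) (h1 : ∀ x < L - 1 + b, f (x, 1) = ψ (x, 1))
    (h2 : ∀ x < L - 1 + a + b, f (x, 2) = ψ (x, 2))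
    (h3 : f (L - 1 + a + b, 2) ≠ ψ (L - 1 + a + b, 2)) (x : ℤ) :
    f (x + a, 1) = f (x, 0) ∧ f (x + a, 2) = f (x, 1) := by
  have hab := H.lt
  have hL := H.pos
  have hE := isEdge_upper hab hL
  have h01 : ∀ x, f (x + a, 1) = f (x, 0) := by
    refine eq_of_window_of_periodic (u := fun x => f (x + a, 1)) (v := fun x => f (x, 0)) hq
      (fun x => ?_) (fun x => (hper x).1) (x₀ := 0) hqL fun x h1 h2 => ?_
    · rw [add_right_comm]; exact (hper _).2
    · have := H.minimal.edge_word hE H.upper_pair hf hk hfk hne (s := (x, 0))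
        (mem_hex_upper.2 (by omega)) (mem_hex_upper.2 (by omega))
      simpa using this
  refine ⟨h01 x, ?_⟩
  -- If `f` and `ψ` also agree on row 3 up to the shifted edge, the hexagon moved by `(a, 1)` is
  -- ambiguous too, and its bottom row gives the `L` points needed by `slope_of_window`. Otherwise
  -- rows 1 and 2 have a short period, and the `L - 1` points of the original window suffice.
  by_cases hag : ∀ x < L - 1 + 2 * a + b, f (x, 3) = ψ (x, 3)
  · refine H.slope_of_window hf (.inl rfl) h01 (x₀ := a) (fun y h4 h5 => ?_) x
    have := H.minimal.edge_word hE H.upper_pair (hf.shift (a, 1)) (hψ.shift (a, 1))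
      (fun ⟨s, r⟩ hs => ?_) ⟨(L - 1 + b, 1), by rw [mem_hex]; dsimp only; omega, ?_⟩
      (s := (y - a, 0)) (mem_hex_upper.2 (by omega)) (mem_hex_upper.2 (by omega))
    · simpa using this
    · simp only [Prod.mk_add_mk]
      rcases mem_hex_upper.1 hs with ⟨rfl, h⟩ | ⟨rfl, h⟩ | ⟨rfl, h⟩
      · exact h1 _ (by omega)
      · exact h2 _ (by omega)
      · exact hag _ (by omega)
    · simp only [Prod.mk_add_mk]
      rwa [show L - 1 + b + a = L - 1 + a + b by ring]
  · push Not at hag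
    obtain ⟨x₁, hx₁, hne₁⟩ := hag
    obtain ⟨q', hq', hqL', hper'⟩ := H.exists_short_period hf hψ hp (j := 1)
      (fun x hx => h1 x (by omega)) (fun x hx => h2 x (by omega)) hx₁ hne₁
    refine eq_of_window_of_periodic (u := fun x => f (x + a, 2)) (v := fun x => f (x, 1)) hq'
      (fun x => ?_) (fun x => (hper' x).1) (x₀ := b) hqL' (fun x h4 h5 => ?_) x
    · rw [add_right_comm]; exact (hper' _).2
    · have := H.minimal.edge_word hE H.upper_pair hf hk hfk hne (s := (x, 1))
        (mem_hex_upper.2 (by omega)) (mem_hex_upper.2 (by omega))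
      simpa using this

/-- The same for the edge `(b, 1)`. -/
theorem HexSystem.slope_of_lower_word (H : HexSystem η a b L p) {f k : ℤ × ℤ → A} (hf : Occ η f)
    {q : ℕ} (hq : 0 < q) (hqL : (q : ℤ) ≤ L - 1)
    (hper : ∀ x, f (x + q, 0) = f (x, 0) ∧ f (x + q, 1) = f (x, 1))
    (hfk : ∀ s ∈ ((hex a b L).erase (L - 1, 0)).erase ((L - 1, 0) + (b, 1)), f s = k s)
    (hk : ∀ s ∈ ((hex a b L).erase (L - 1, 0)).erase ((L - 1, 0) + (b, 1)), k (s + (b, 1)) = k s)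
    (x : ℤ) : f (x + b, 1) = f (x, 0) ∧ f (x + b, 2) = f (x, 1) := by
  have hab := H.lt
  have key : ∀ s ∈ ((hex a b L).erase (L - 1, 0)).erase ((L - 1, 0) + (b, 1)),
      s + (b, 1) ∈ ((hex a b L).erase (L - 1, 0)).erase ((L - 1, 0) + (b, 1)) →
      f (s + (b, 1)) = f s := fun s h1 h2 => by rw [hfk _ h1, hfk _ h2, hk _ h1]
  have h01 : ∀ x, f (x + b, 1) = f (x, 0) := by
    refine eq_of_window_of_periodic (u := fun x => f (x + b, 1)) (v := fun x => f (x, 0)) hq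
      (fun x => ?_) (fun x => (hper x).1) (x₀ := 0) hqL fun x h1 h2 => ?_
    · rw [add_right_comm]; exact (hper _).2
    · have := key (x, 0) (mem_hex_lower.2 (by omega)) (mem_hex_lower.2 (by omega))
      simpa using this
  refine ⟨h01 x, H.slope_of_window hf (.inr rfl) h01 (x₀ := a) (fun y h4 h5 => ?_) x⟩
  have := key (y, 1) (mem_hex_lower.2 (by omega)) (mem_hex_lower.2 (by omega))
  simpa using this

/-- `ψ` follows `f` up to the right boundary of the hexagon and leaves it there. If they agree at
the lowest corner, `f` shows the ambiguous word of the upper edge. Otherwise, on the hexagon without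
its upper edge, `f` and `ψ` look like the two members `φ`, `φ'` of a pair for the lower edge. Then
either `f` equals `φ` on the whole hexagon and has slope `b`, or the upper edge is ambiguous for `f`
and `φ` and the slope is `a`. -/
theorem HexSystem.slope_of_exit (H : HexSystem η a b L p) {f g ψ : ℤ × ℤ → A} (hf : Occ η f)
    (hg : Occ η g) (hψ : Occ η ψ) (hp : ∀ z, f (z + ((p : ℤ), 0)) = f z)
    (hfg : ∀ z : ℤ × ℤ, z.2 < 2 → f z = g z) {x₁ : ℤ} (hx₁ : f (x₁, 2) ≠ g (x₁, 2))
    (h0 : ∀ x < L - 1, f (x, 0) = ψ (x, 0)) (h1 : ∀ x < L - 1 + b, f (x, 1) = ψ (x, 1))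
    (h2 : ∀ x < L - 1 + a + b, f (x, 2) = ψ (x, 2))
    (hne : f (L - 1, 0) ≠ ψ (L - 1, 0) ∨ f (L - 1 + b, 1) ≠ ψ (L - 1 + b, 1) ∨
      f (L - 1 + a + b, 2) ≠ ψ (L - 1 + a + b, 2)) :
    ∃ t, (t = a ∨ t = b) ∧ ∀ x, f (x + t, 1) = f (x, 0) ∧ f (x + t, 2) = f (x, 1) := by
  have hab := H.lt
  have hL := H.pos
  have hU := isEdge_upper hab hL
  have hD := isEdge_lower hab hL
  obtain ⟨q, hq, hqL, hper⟩ := H.exists_short_period hf hg hp (j := 0) (M := x₁ + 1) (x₁ := x₁)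
    (fun x _ => hfg _ (by simp)) (fun x _ => hfg _ (by simp)) (by omega) (by simpa using hx₁)
  have hE0 : (L - 1, (0 : ℤ)) ∈ hex a b L := by rw [mem_hex]; dsimp only; omega
  have hE1 : (L - 1 + b, (1 : ℤ)) ∈ hex a b L := by rw [mem_hex]; dsimp only; omega
  have hE2 : (L - 1 + a + b, (2 : ℤ)) ∈ hex a b L := by rw [mem_hex]; dsimp only; omega
  -- configurations that agree on the hexagon without its two upper right corners
  have lift : ∀ {u v : ℤ × ℤ → A}, Occ η u → Occ η v →
      (∀ s ∈ ((hex a b L).erase (L - 1 + b, 1)).erase ((L - 1 + b, 1) + (a, 1)), u s = v s) →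
      u (L - 1 + a + b, 2) = v (L - 1 + a + b, 2) → ∀ s ∈ hex a b L, u s = v s := by
    intro u v hu hv huv h
    have hall : ∀ s ∈ hex a b L, s ≠ (L - 1 + b, 1) → u s = v s := by
      intro s hs hs1
      by_cases hs2 : s = (L - 1 + b, 1) + (a, 1)
      · rw [hs2, Prod.mk_add_mk, show L - 1 + b + a = L - 1 + a + b by ring]
        exact h
      · exact huv s (by simp only [Finset.mem_erase]; exact ⟨hs2, hs1, hs⟩)
    intro s hs
    by_cases hs1 : s = (L - 1 + b, 1)
    · have := H.minimal.determined hU.left hu hv 0 (fun s hs hst => by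
        simpa using hall s hs hst)
      rw [hs1]
      simpa using this
    · exact hall s hs hs1
  by_cases hr0 : f (L - 1, 0) = ψ (L - 1, 0)
  · have hT : ∀ s ∈ ((hex a b L).erase (L - 1 + b, 1)).erase ((L - 1 + b, 1) + (a, 1)),
        f s = ψ s := by
      rintro ⟨s, r⟩ hs
      rcases mem_hex_upper.1 hs with ⟨rfl, h⟩ | ⟨rfl, h⟩ | ⟨rfl, h⟩
      · rcases (show s < L - 1 ∨ s = L - 1 by omega) with h' | rfl
        · exact h0 _ h'
        · exact hr0
      · exact h1 _ (by omega)
      · exact h2 _ (by omega)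
    have hdiff : f (L - 1 + a + b, 2) ≠ ψ (L - 1 + a + b, 2) := by
      intro h
      have hall := lift hf hψ hT h
      have := hall _ hE0
      have := hall _ hE1
      tauto
    exact ⟨a, .inl rfl, H.slope_of_upper_word hf hψ hψ hp hq hqL hper hT ⟨_, hE2, hdiff⟩ h1 h2 hdiff⟩
  · obtain ⟨F, G, hF, hG, hFG, hne0, hcon⟩ := H.minimal.exists_edge_pair hD H.lower_pair
    set T := ((hex a b L).erase (L - 1 + b, 1)).erase ((L - 1 + b, 1) + (a, 1)) with hTd
    set S' := T.erase (L - 1, 0) with hS'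
    have hmem : ∀ x y, (x, y) ∈ S' ↔ (y = 0 ∧ 0 ≤ x ∧ x < L - 1) ∨ (y = 1 ∧ a ≤ x ∧ x < L - 1 + b) ∨
        (y = 2 ∧ a + b ≤ x ∧ x < L - 1 + a + b) := by
      intro x y
      rw [hS', Finset.mem_erase, hTd, mem_hex_upper]
      simp only [ne_eq, Prod.mk.injEq]
      omega
    have hE0T : (L - 1, (0 : ℤ)) ∈ T := mem_hex_upper.2 (by omega)
    have hslab : IsSlab S' := by
      refine hU.slab.erase ⟨hE0T, .inl fun ⟨s, r⟩ hs h => ?_⟩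
      have := mem_hex_upper.1 hs
      dsimp only at *
      omega
    -- `T` has two points fewer than the hexagon and `S'` three. The upper edge is ambiguous, so `T`
    -- has fewer words than the hexagon, and minimality bounds the words on `S'` from below.
    have hTc : complexity η T ≤ complexity η S' + 1 := by
      have e1 : S'.card + 1 = T.card := Finset.card_erase_add_one hE0T
      have e2 : T.card + 1 = ((hex a b L).erase (L - 1 + b, 1)).card := by
        refine Finset.card_erase_add_one ?_
        simp only [Finset.mem_erase, mem_hex, Prod.mk_add_mk, ne_eq, Prod.mk.injEq]
        omega
      have e3 := Finset.card_erase_add_one hE1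
      have e4 := H.minimal.2.2 _ hslab (by omega)
      have e5 := H.minimal.2.1
      have e6 : complexity η T + 1 ≤ complexity η (hex a b L) := by
        have := ambiguous_count η (T := T) (S := hex a b L)
          ((Finset.erase_subset _ _).trans (Finset.erase_subset _ _))
        obtain ⟨u, v, hu, hv, huv, hne, -⟩ := H.minimal.exists_edge_pair hU H.upper_pair
        have := this {fun t : T => u t} (by
          rintro w rfl
          exact ⟨u, v, hu, hv, fun _ => rfl, fun t => (huv t t.2).symm, _, hE1, hne⟩)
        rw [Set.ncard_singleton] at this
        omega
      omega
    have hS'T : S' ⊆ T := Finset.erase_subset _ _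
    have hfψ : ∀ s ∈ S', f s = ψ s := by
      rintro ⟨s, r⟩ hs
      rcases (hmem s r).1 hs with ⟨rfl, h⟩ | ⟨rfl, h⟩ | ⟨rfl, h⟩
      · exact h0 _ h.2
      · exact h1 _ h.2
      · exact h2 _ h.2
    have hFGS : ∀ s ∈ S', F s = G s := by
      rintro ⟨s, r⟩ hs
      exact hFG _ (mem_hex_lower.2 (by have := (hmem s r).1 hs; omega))
    have hFf : ∀ s ∈ S', F s = f s :=
      ambiguous_unique hS'T hTc hF hG hf hψ hFGS hfψ ⟨_, hE0T, hne0⟩ ⟨_, hE0T, hr0⟩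
    have two : ∀ k, Occ η k → (∀ s ∈ S', F s = k s) → (∀ s ∈ T, k s = F s) ∨ ∀ s ∈ T, k s = G s :=
      fun k hk hFk => extensions_le_two hS'T hTc hF hG hk hFGS hFk ⟨_, hE0T, hne0⟩
    obtain ⟨φ, φ', hφ, hφ', heq, hcφ, hfφ, hψφ⟩ : ∃ φ φ', Occ η φ ∧ Occ η φ' ∧
        (∀ s ∈ ((hex a b L).erase (L - 1, 0)).erase ((L - 1, 0) + (b, 1)), φ s = φ' s) ∧
        (∀ s ∈ ((hex a b L).erase (L - 1, 0)).erase ((L - 1, 0) + (b, 1)), φ (s + (b, 1)) = φ s) ∧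
        (∀ s ∈ T, f s = φ s) ∧ ∀ s ∈ T, ψ s = φ' s := by
      have hcF := fun s hs => hcon s (hD.below s hs).1 (hD.below s hs).2
      have hFψ : ∀ s ∈ S', F s = ψ s := fun s hs => (hFf s hs).trans (hfψ s hs)
      rcases two f hf hFf with h | h <;> rcases two ψ hψ hFψ with h' | h'
      · exact absurd ((h _ hE0T).trans (h' _ hE0T).symm) hr0
      · exact ⟨F, G, hF, hG, hFG, fun s hs => (hcF s hs).1, h, h'⟩
      · exact ⟨G, F, hG, hF, fun s hs => (hFG s hs).symm, fun s hs => (hcF s hs).2, h, h'⟩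
      · exact absurd ((h _ hE0T).trans (h' _ hE0T).symm) hr0
    by_cases hS : ∀ s ∈ hex a b L, f s = φ s
    · exact ⟨b, .inr rfl, H.slope_of_lower_word hf hq hqL hper
        (fun s hs => hS s (Finset.mem_of_mem_erase (Finset.mem_of_mem_erase hs))) hcφ⟩
    · push Not at hS
      -- Otherwise `f` and `ψ` would both carry the unique ambiguous word of the upper edge and
      -- agree at the lowest corner.
      have hψS : ∀ s ∈ hex a b L, ψ s = φ' s := by
        by_contra! hcon
        exact hr0 (ambiguous_unique ((Finset.erase_subset _ _).trans (Finset.erase_subset _ _))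
          (H.minimal.edge_step hU) hf hφ hψ hφ' hfφ hψφ hS hcon _ hE0T)
      have hdiff : f (L - 1 + a + b, 2) ≠ ψ (L - 1 + a + b, 2) := by
        intro h
        rw [hψS _ hE2, ← heq _ (mem_hex_lower.2 (by omega))] at h
        obtain ⟨s, hs, hne⟩ := hS
        exact hne (lift hf hφ hfφ h s hs)
      exact ⟨a, .inl rfl, H.slope_of_upper_word hf hφ hψ hp hq hqL hper hfφ hS h1 h2 hdiff⟩

end Slope

/-! ### Exits, slopes and periodicity -/

section Conclusion

theorem exists_first_column {A : Type*} {f g : ℤ × ℤ → A} {o : ℤ → ℤ}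
    (h : ∃ j x, 0 ≤ j ∧ j ≤ 2 ∧ o j ≤ x ∧ f (x, j) ≠ g (x, j)) :
    ∃ c : ℕ, (∃ j, 0 ≤ j ∧ j ≤ 2 ∧ f (c + o j, j) ≠ g (c + o j, j)) ∧
      ∀ j x, 0 ≤ j → j ≤ 2 → o j ≤ x → x < c + o j → f (x, j) = g (x, j) := by
  classical
  have hex : ∃ c : ℕ, ∃ j, 0 ≤ j ∧ j ≤ 2 ∧ f (c + o j, j) ≠ g (c + o j, j) := by
    obtain ⟨j, x, h1, h2, h3, h4⟩ := h
    refine ⟨(x - o j).toNat, j, h1, h2, ?_⟩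
    rwa [Int.toNat_of_nonneg (by omega), sub_add_cancel]
  refine ⟨Nat.find hex, Nat.find_spec hex, fun j x h1 h2 h3 h4 => ?_⟩
  by_contra hne
  refine Nat.find_min hex (m := (x - o j).toNat) (by omega) ⟨j, h1, h2, ?_⟩
  rwa [Int.toNat_of_nonneg (by omega), sub_add_cancel]

/-- Either some configuration follows three rows of `f` up to some column and leaves them there,
or the translates of `η` that follow these rows on a long window follow them forever. -/
theorem exists_exit {A : Type*} [Finite A] {η f : ℤ × ℤ → A} {p : ℕ} (hp : 0 < p)
    (hf : ∀ z, f (z + ((p : ℤ), 0)) = f z) (o : ℤ → ℤ) :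
    (∃ (ψ : ℤ × ℤ → A) (c : ℤ), Occ η ψ ∧
      (∀ j x, 0 ≤ j → j ≤ 2 → x < c + o j → f (x, j) = ψ (x, j)) ∧
      ∃ j, 0 ≤ j ∧ j ≤ 2 ∧ f (c + o j, j) ≠ ψ (c + o j, j)) ∨
    ∃ N : ℕ, ∀ u : ℤ × ℤ,
      (∀ j x, 0 ≤ j → j ≤ 2 → -N ≤ x - o j → x < o j → f (x, j) = η ((x, j) + u)) →
      ∀ j x, 0 ≤ j → j ≤ 2 → o j ≤ x → f (x, j) = η ((x, j) + u) := by
  rw [or_iff_not_imp_right]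
  intro hcon
  push Not at hcon
  choose u hu hu' using hcon
  choose c hc hc' using fun N => exists_first_column (g := fun z => η (z + u N)) (o := o) (by
    obtain ⟨j, x, h⟩ := hu' N
    exact ⟨j, x, h⟩)
  -- Translating by the largest multiple of `p` up to `c N` puts the first deviation within the
  -- first `p` columns, so it survives in the limit, while the rows of `f` are unchanged.
  let F : ℕ → ℤ × ℤ → A := fun N z => η (z + (u N + (((c N / p * p : ℕ) : ℤ), 0)))
  have hF : ∀ N x j, F N (x, j) = η ((x + ((c N / p * p : ℕ) : ℤ), j) + u N) := by
    intro N x j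
    simp only [F]
    congr 1
    ext <;> simp
    ring
  have hfN : ∀ N x j, f (x + ((c N / p * p : ℕ) : ℤ), j) = f (x, j) := by
    intro N x j
    have := periodic_nsmul hf (c N / p) (x, j)
    simpa using this
  have hdiv : ∀ N, c N / p * p + c N % p = c N := fun N => Nat.div_add_mod' _ _
  obtain ⟨ψ, hψ⟩ := exists_ultralimit (Filter.hyperfilter ℕ) F
  have hU : ∀ n : ℕ, ∀ᶠ m in (Filter.hyperfilter ℕ : Filter ℕ), n ≤ m := fun n =>
    Nat.hyperfilter_le_atTop (Filter.eventually_ge_atTop n)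
  have hleft : ∀ j x, 0 ≤ j → j ≤ 2 → x < o j → f (x, j) = ψ (x, j) := by
    intro j x h1 h2 h3
    obtain ⟨N, hN, hN'⟩ := ((hU (o j - x).toNat).and (hψ {(x, j)})).exists
    rw [← hN' _ (Finset.mem_singleton_self _), hF, ← hfN N x j]
    by_cases h4 : x + ((c N / p * p : ℕ) : ℤ) < o j
    · exact hu N j _ h1 h2 (by omega) h4
    · have := hdiv N
      exact hc' N j _ h1 h2 (by omega) (by omega)
  obtain ⟨c₀, h1, h2⟩ := exists_first_column (f := f) (g := ψ) (o := o) (by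
    obtain ⟨N, hN⟩ := (hψ ((Finset.Ico (0 : ℤ) p ×ˢ Finset.Icc (0 : ℤ) 2).image
      fun z => (z.1 + o z.2, z.2))).exists
    obtain ⟨j, h1, h2, h3⟩ := hc N
    refine ⟨j, ((c N % p : ℕ) : ℤ) + o j, h1, h2, by omega, ?_⟩
    rw [← hN _ (Finset.mem_image.2 ⟨(((c N % p : ℕ) : ℤ), j), by
      have := Nat.mod_lt (c N) hp
      simp only [Finset.mem_product, Finset.mem_Ico, Finset.mem_Icc]
      omega, rfl⟩), hF, ← hfN N]
    have := hdiv N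
    rwa [show ((c N % p : ℕ) : ℤ) + o j + ((c N / p * p : ℕ) : ℤ) = c N + o j by omega])
  refine ⟨ψ, c₀, Occ.of_limit (fun N => (Occ.refl η).shift _) hψ, fun j x h3 h4 h5 => ?_, h1⟩
  by_cases h6 : x < o j
  · exact hleft j x h3 h4 h6
  · exact h2 j x h3 h4 (by omega) h5

variable {A : Type*} [Finite A] {η : ℤ × ℤ → A} {a b L : ℤ} {p : ℕ}

/-- The column just right of the hexagon. -/
def rightEnd (a b L j : ℤ) : ℤ := L - 1 + if j = 0 then 0 else if j = 1 then b else a + b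

theorem HexSystem.slope_of_right_exit (H : HexSystem η a b L p) {f g : ℤ × ℤ → A}
    (hf : Occ η f) (hg : Occ η g) (hp : ∀ z, f (z + ((p : ℤ), 0)) = f z)
    (hfg : ∀ z : ℤ × ℤ, z.2 < 2 → f z = g z) {x₁ : ℤ} (hx₁ : f (x₁, 2) ≠ g (x₁, 2))
    (h : ∃ (ψ : ℤ × ℤ → A) (c : ℤ), Occ η ψ ∧
      (∀ j x, 0 ≤ j → j ≤ 2 → x < c + rightEnd a b L j → f (x, j) = ψ (x, j)) ∧
      ∃ j, 0 ≤ j ∧ j ≤ 2 ∧ f (c + rightEnd a b L j, j) ≠ ψ (c + rightEnd a b L j, j)) :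
    ∃ t, (t = a ∨ t = b) ∧ ∀ x, f (x + t, 1) = f (x, 0) ∧ f (x + t, 2) = f (x, 1) := by
  obtain ⟨ψ, c, hψ, hag, hne⟩ := h
  have e0 : rightEnd a b L 0 = L - 1 := by simp [rightEnd]
  have e1 : rightEnd a b L 1 = L - 1 + b := by simp [rightEnd]
  have e2 : rightEnd a b L 2 = L - 1 + a + b := by simp [rightEnd]; ring
  obtain ⟨t, ht, h⟩ := H.slope_of_exit (hf.shift (c, 0)) (hg.shift (c, 0)) (hψ.shift (c, 0))
    (fun z => by rw [add_right_comm]; exact hp _) (fun z hz => hfg _ (by simpa using hz))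
    (x₁ := x₁ - c) (by simpa using hx₁)
    (fun x hx => by
      simp only [Prod.mk_add_mk, add_zero]
      exact hag 0 _ le_rfl (by norm_num) (by rw [e0]; omega))
    (fun x hx => by
      simp only [Prod.mk_add_mk, add_zero]
      exact hag 1 _ (by norm_num) (by norm_num) (by rw [e1]; omega))
    (fun x hx => by
      simp only [Prod.mk_add_mk, add_zero]
      exact hag 2 _ (by norm_num) (by norm_num) (by rw [e2]; omega))
    (by
      obtain ⟨j, h1, h2, h3⟩ := hne
      simp only [Prod.mk_add_mk, add_zero, add_comm _ c]
      rw [← e2, ← e1, ← e0]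
      interval_cases j
      · exact .inl h3
      · exact .inr (.inl h3)
      · exact .inr (.inr h3))
  refine ⟨t, ht, fun x => ?_⟩
  have := h (x - c)
  simp only [Prod.mk_add_mk, add_zero, sub_add_cancel] at this
  rwa [show x - c + t + c = x + t by ring] at this

/-- A configuration whose rows are not determined from below has a slope. -/
theorem HexSystem.exists_slope (H : HexSystem η a b L p) {f g : ℤ × ℤ → A}
    (hf : Occ η f) (hg : Occ η g) (hfg : ∀ z : ℤ × ℤ, z.2 < 2 → f z = g z) {x₁ : ℤ}
    (hx₁ : f (x₁, 2) ≠ g (x₁, 2)) :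
    ∃ t, (t = a ∨ t = b) ∧ ∀ x, f (x + t, 1) = f (x, 0) ∧ f (x + t, 2) = f (x, 1) := by
  have hp := H.horizontal f g hf hg (.inl fun z hz => hfg z (by omega))
    (fun h => hx₁ (congrFun h _))
  have H' := hexSystem_flipHorz H
  have hp' : ∀ z, (f ∘ flipHorz) (z + ((p : ℤ), 0)) = (f ∘ flipHorz) z := by
    intro z
    have := hp (flipHorz (z + ((p : ℤ), 0)))
    simpa using this.symm
  -- An exit on the right gives the slope directly, one on the left after reflection. With neither,
  -- a translate of `η` that follows `f` on a long window follows it on three entire rows; their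
  -- period spreads by the relation and makes `η` periodic.
  rcases exists_exit (η := η) H.period_pos hp (rightEnd a b L) with h | ⟨N, hN⟩
  · exact H.slope_of_right_exit hf hg hp hfg hx₁ h
  rcases exists_exit (η := η ∘ flipHorz) H.period_pos hp' (rightEnd (-b) (-a) L) with h | ⟨N', hN'⟩
  · obtain ⟨t, ht, h⟩ := H'.slope_of_right_exit (hf.comp_equiv flipHorz) (hg.comp_equiv flipHorz) hp'
      (fun z hz => hfg _ hz) (x₁ := -x₁) (by simpa using hx₁) h
    refine ⟨-t, by omega, fun x => ?_⟩
    have := h (-x)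
    simp only [Function.comp_apply, flipHorz_apply, neg_neg] at this
    rwa [show -(-x + t) = x + -t by ring] at this
  exfalso
  obtain ⟨C, hC⟩ : ∃ C : ℕ, ∀ j, (-(C : ℤ) ≤ rightEnd a b L j ∧ rightEnd a b L j ≤ C) ∧
      -(C : ℤ) ≤ rightEnd (-b) (-a) L j ∧ rightEnd (-b) (-a) L j ≤ C := by
    refine ⟨(L - 1).natAbs + a.natAbs + b.natAbs, fun j => ?_⟩
    simp only [rightEnd]
    split_ifs <;> omega
  obtain ⟨u, hu⟩ := hf (Finset.Icc (-(N + N' + C : ℤ)) (N + N' + C) ×ˢ Finset.Icc (0 : ℤ) 2)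
  have hmem : ∀ j x : ℤ, 0 ≤ j → j ≤ 2 → -(N + N' + C : ℤ) ≤ x → x ≤ N + N' + C →
      f (x, j) = η ((x, j) + u) := by
    intro j x h1 h2 h3 h4
    exact hu _ (by simp only [Finset.mem_product, Finset.mem_Icc]; omega)
  have hR := hN u fun j x h1 h2 h3 h4 => by
    have := hC j
    exact hmem j x h1 h2 (by omega) (by omega)
  have hL := hN' (flipHorz u) (fun j x h1 h2 h3 h4 => by
    have := hC j
    have := hmem j (-x) h1 h2 (by omega) (by omega)
    simp only [Function.comp_apply, map_add]
    convert this using 2 <;> simp)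
  have hall : ∀ j x : ℤ, 0 ≤ j → j ≤ 2 → f (x, j) = η ((x, j) + u) := by
    intro j x h1 h2
    have h3 := hC j
    by_cases h4 : rightEnd a b L j ≤ x
    · exact hR j x h1 h2 h4
    by_cases h5 : rightEnd (-b) (-a) L j ≤ -x
    · have := hL j (-x) h1 h2 h5
      simp only [Function.comp_apply, map_add, flipHorz_apply, neg_neg] at this
      exact this
    · exact hmem j x h1 h2 (by omega) (by omega)
  obtain ⟨ι, hι⟩ := exists_injective_int A
  obtain ⟨F, c, hF, -, hrel⟩ := exists_relation η (hex a b L) H.minimal.2.1 ι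
  obtain ⟨p₀, hp₀, hT⟩ := exists_period_of_strip (Set.finite_range ι) (hex a b L) F hF
    (AddMonoidHom.snd ℤ ℤ) (AddMonoidHom.fst ℤ ℤ) (1, 0) (0, 1) (by simp) (by simp) (by simp)
    (by simp) (fun z h1 h2 => Prod.ext h2 h1) 0 3 (fun s hs _ => by
      have := (isSlab_hex a b L).1 s hs
      simp only [AddMonoidHom.coe_snd]
      omega)
  have hper := hT (p₀ * p) (dvd_mul_right _ _) (fun z => ι (η (z + u))) (fun z => ⟨_, rfl⟩)
    ⟨c, hrel _ ((Occ.refl η).shift u)⟩ 0 (fun z h1 h2 => by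
      simp only [AddMonoidHom.coe_snd] at h1 h2
      have h3 := periodic_nsmul hp p₀ z
      have e : z + (p₀ * p) • ((1, 0) : ℤ × ℤ) = (z.1 + p₀ * p, z.2) := by ext <;> simp
      have e' : z + p₀ • (((p : ℤ), 0) : ℤ × ℤ) = (z.1 + p₀ * p, z.2) := by ext <;> simp
      rw [e'] at h3
      rw [e, ← hall _ _ (by omega) (by omega), h3, hall z.2 z.1 (by omega) (by omega)])
  refine H.aperiodic ((p₀ * p) • (1, 0)) ?_ fun z => ?_
  · have := H.period_pos
    simp
    omega
  · have := hι (hper (z - u))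
    rwa [sub_add_cancel, show z - u + (p₀ * p) • ((1, 0) : ℤ × ℤ) + u = z + (p₀ * p) • (1, 0) by abel]
      at this

/-- Both members have a slope at the first differing row. Equal slopes `t = t'` obtain that row from
the same row below; for different slopes the common middle row is the shift of the common bottom row
by `t` and by `t'`, so the two predictions coincide as well. -/
theorem HexSystem.not_bottom_pair (H : HexSystem η a b L p)
    (h : ∃ f g, Occ η f ∧ Occ η g ∧ (∀ z : ℤ × ℤ, z.2 < 0 → f z = g z) ∧ f ≠ g) : False := by
  obtain ⟨f, g, hf, hg, hfg, hne⟩ := h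
  obtain ⟨z₀, hz₀, hfirst⟩ := exists_first_row (AddMonoidHom.snd ℤ ℤ) hfg hne
  simp only [AddMonoidHom.coe_snd] at hfirst
  have hz₀' : f ((z₀.1, 2) + (0, z₀.2 - 2)) ≠ g ((z₀.1, 2) + (0, z₀.2 - 2)) := by simpa using hz₀
  have hag : ∀ z : ℤ × ℤ, z.2 < 2 → f (z + (0, z₀.2 - 2)) = g (z + (0, z₀.2 - 2)) :=
    fun z hz => hfirst _ (by simp only [Prod.snd_add]; omega)
  obtain ⟨t, ht, h1⟩ := H.exists_slope (hf.shift (0, z₀.2 - 2)) (hg.shift (0, z₀.2 - 2)) hag hz₀'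
  obtain ⟨t', ht', h2⟩ := H.exists_slope (hg.shift (0, z₀.2 - 2)) (hf.shift (0, z₀.2 - 2))
    (fun z hz => (hag z hz).symm) hz₀'.symm
  apply hz₀'
  have e1 := (h1 (z₀.1 - t)).2
  have e2 := (h2 (z₀.1 - t')).2
  rw [sub_add_cancel] at e1 e2
  rw [e1, e2, ← hag _ (by simp)]
  by_cases htt : t = t'
  · rw [htt]
  · have e3 := (h1 (z₀.1 - t - t')).1
    have e4 := (h2 (z₀.1 - t - t')).1
    rw [← hag _ (by simp), ← hag _ (by simp)] at e4
    rw [show z₀.1 - t - t' + t = z₀.1 - t' by ring] at e3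
    rw [show z₀.1 - t - t' + t' = z₀.1 - t by ring] at e4
    rw [e3, e4]

/-- A configuration of low complexity on a rectangle of height at most three is periodic. -/
theorem exists_period_of_complexity_le {A : Type*} [Finite A] {η : ℤ × ℤ → A}
    (hη : ∃ n k : ℕ, 0 < n ∧ 0 < k ∧ k ≤ 3 ∧ complexity η (rectangle n k) ≤ n * k) :
    ∃ h : ℤ × ℤ, h ≠ 0 ∧ ∀ z, η (z + h) = η z := by
  by_contra! hap
  obtain ⟨a, b, L, p, H, ι, u₁, u₂, m, hι, h₁, h₂, e₁, e₂, hm, hk, hnk⟩ :=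
    exists_hexSystem hη (fun h hh hper => by
      obtain ⟨z, hz⟩ := hap h hh
      exact hz (hper z))
  exact H.not_bottom_pair (H.exists_bottom_pair hι h₁ h₂ e₁ e₂ hm hk hnk)

end Conclusion

/-! ### From a period to expansive lines -/

section Expansive

variable {A : Type*}

theorem periodic_of_mem_orbitClosure [TopologicalSpace A] [DiscreteTopology A] {η f : ℤ × ℤ → A}
    {h : ℤ × ℤ} (hη : ∀ z, η (z + h) = η z) (hf : f ∈ orbitClosure η) (z : ℤ × ℤ) :
    f (z + h) = f z := by
  have hcl : IsClosed {f : ℤ × ℤ → A | f (z + h) = f z} :=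
    isClosed_eq (continuous_apply (z + h)) (continuous_apply z)
  refine closure_minimal ?_ hcl hf
  rintro _ ⟨u, rfl⟩
  simp only [Set.mem_ofPred_eq, shiftBy]
  rw [add_right_comm, hη]

/-- The fibres form an open cover, and a Lebesgue number of it serves as `δ`. -/
theorem exists_dist_lt_of_isOpen_fiber {X : Type*} [MetricSpace X] [CompactSpace X] {F : X → A}
    (hF : ∀ a, IsOpen (F ⁻¹' {a})) : ∃ δ : ℝ, 0 < δ ∧ ∀ x y, dist x y < δ → F x = F y := by
  obtain ⟨δ, hδ, h⟩ := lebesgue_number_lemma_of_metric (isCompact_univ (X := X)) hF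
    (fun x _ => Set.mem_iUnion.2 ⟨F x, rfl⟩)
  refine ⟨δ, hδ, fun x y hxy => ?_⟩
  obtain ⟨a, ha⟩ := h x (Set.mem_univ x)
  have h1 : F x = a := ha (Metric.mem_ball_self hδ)
  have h2 : F y = a := ha (Metric.mem_ball'.2 hxy)
  rw [h1, h2]

theorem exists_dist_lt [Finite A] [TopologicalSpace A] [DiscreteTopology A] (η : ℤ × ℤ → A)
    (m : MetricSpace (orbitClosure η))
    (hm : m.toPseudoMetricSpace.toUniformSpace.toTopologicalSpace
      = (instTopologicalSpaceSubtype : TopologicalSpace (orbitClosure η))) :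
    ∃ δ : ℝ, 0 < δ ∧ ∀ f g : orbitClosure η, dist f g < δ → f.1 0 = g.1 0 := by
  have hcomp : @CompactSpace (orbitClosure η)
      m.toPseudoMetricSpace.toUniformSpace.toTopologicalSpace := by
    rw [hm]
    exact isCompact_iff_compactSpace.1 isClosed_closure.isCompact
  refine @exists_dist_lt_of_isOpen_fiber A (orbitClosure η) m hcomp (fun f => f.1 0) fun a => ?_
  rw [hm]
  exact (isOpen_discrete {a}).preimage ((continuous_apply (0 : ℤ × ℤ)).comp continuous_subtype_val)

/-- If `h` is not parallel to `l`, each lattice point can be moved by a multiple of `h` to within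
`‖h‖` of `l`. Since all configurations in the orbit closure have the period `h`, their values on
such a strip determine them. -/
theorem direction_eq_span_of_nonexpansive [Finite A] [TopologicalSpace A] [DiscreteTopology A]
    (η : ℤ × ℤ → A) (m : MetricSpace (orbitClosure η))
    (hm : m.toPseudoMetricSpace.toUniformSpace.toTopologicalSpace
      = (instTopologicalSpaceSubtype : TopologicalSpace (orbitClosure η)))
    {h : ℤ × ℤ} (hh : h ≠ 0) (hη : ∀ z, η (z + h) = η z)
    {l : AffineSubspace ℝ (EuclideanSpace ℝ (Fin 2))}
    (hl : IsNonexpansiveLine (orbitClosureAction η) l) :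
    l.direction = Submodule.span ℝ {latticePoint h} := by
  have hh' : latticePoint h ≠ 0 := by
    intro h0
    apply hh
    have h1 := congrFun (congrArg WithLp.ofLp h0) 0
    have h2 := congrFun (congrArg WithLp.ofLp h0) 1
    simp [latticePoint] at h1 h2
    exact Prod.ext h1 h2
  have hspan : Module.finrank ℝ (Submodule.span ℝ {latticePoint h}) = 1 := finrank_span_singleton hh'
  by_contra hdir
  obtain ⟨hline, hnot⟩ := hl
  apply hnot
  refine ⟨hline, ?_⟩
  have hmem : latticePoint h ∉ l.direction := by
    intro hin
    apply hdir
    have hle : Submodule.span ℝ {latticePoint h} ≤ l.direction := by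
      rwa [Submodule.span_singleton_le_iff_mem]
    exact (Submodule.eq_of_le_of_finrank_eq hle (by rw [hspan, hline.2])).symm
  obtain ⟨x₀, hx₀⟩ := hline.1
  have htop : l.direction ⊔ Submodule.span ℝ {latticePoint h} = ⊤ := by
    have hinf : l.direction ⊓ Submodule.span ℝ {latticePoint h} = ⊥ := by
      rw [← disjoint_iff, Submodule.disjoint_span_singleton' hh']
      exact hmem
    have := Submodule.finrank_sup_add_finrank_inf_eq l.direction (Submodule.span ℝ {latticePoint h})
    rw [hinf, finrank_bot, hspan, hline.2] at this
    refine Submodule.eq_top_of_finrank_eq ?_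
    rw [finrank_euclideanSpace_fin]
    omega
  obtain ⟨δ, hδ, hdist⟩ := exists_dist_lt η m hm
  refine ⟨‖latticePoint h‖ + 1, by positivity, δ, hδ, fun f g hfg => ?_⟩
  have hper : ∀ (f : orbitClosure η) (n : ℤ) z, f.1 (z + n • h) = f.1 z := fun f =>
    periodic_zsmul fun z => periodic_of_mem_orbitClosure hη f.2 z
  refine Subtype.ext (funext fun z => ?_)
  obtain ⟨y, hy, v, hv, hyv⟩ := Submodule.mem_sup.1
    (htop ▸ Submodule.mem_top : latticePoint z - x₀ ∈ l.direction ⊔ Submodule.span ℝ {latticePoint h})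
  obtain ⟨c, rfl⟩ := Submodule.mem_span_singleton.1 hv
  -- Subtracting `⌊c⌋ • h` leaves the fractional part of the component along `h`, of length at most
  -- `‖h‖`.
  have key := hfg (z + (-⌊c⌋) • h) (by
    have hpt : x₀ + y ∈ (l : Set (EuclideanSpace ℝ (Fin 2))) := by
      have := AffineSubspace.vadd_mem_of_mem_direction hy hx₀
      rwa [vadd_eq_add, add_comm] at this
    refine (Metric.infDist_le_dist_of_mem hpt).trans_lt ?_
    have e : latticePoint (z + (-⌊c⌋) • h) = latticePoint z - (⌊c⌋ : ℝ) • latticePoint h := by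
      ext i
      fin_cases i <;> simp [latticePoint] <;> ring
    rw [dist_eq_norm, e, show latticePoint z - (⌊c⌋ : ℝ) • latticePoint h - (x₀ + y) =
      Int.fract c • latticePoint h by
        rw [Int.fract, sub_smul, sub_right_comm, ← sub_sub, ← hyv, add_sub_cancel_left], norm_smul]
    have h1 : ‖Int.fract c‖ ≤ 1 := by
      rw [Real.norm_eq_abs, abs_of_nonneg (Int.fract_nonneg c)]
      exact (Int.fract_lt_one c).le
    nlinarith [norm_nonneg (latticePoint h)])
  have := hdist _ _ key
  simp only [orbitClosureAction, shiftBy, zero_add] at this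
  rwa [hper, hper] at this

end Expansive

theorem mainTheorem2 {A : Type*} [Finite A] [TopologicalSpace A] [DiscreteTopology A]
    (η : ℤ × ℤ → A)
    (hη : ∃ n k : ℕ, 0 < n ∧ 0 < k ∧ k ≤ 3 ∧ complexity η (rectangle n k) ≤ n * k)
    (m : MetricSpace (orbitClosure η))
    (hm : m.toPseudoMetricSpace.toUniformSpace.toTopologicalSpace
      = (instTopologicalSpaceSubtype : TopologicalSpace (orbitClosure η)))
    (l₁ l₂ : AffineSubspace ℝ (EuclideanSpace ℝ (Fin 2)))
    (h₁ : @IsNonexpansiveLine (orbitClosure η) m (orbitClosureAction η) l₁)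
    (h₂ : @IsNonexpansiveLine (orbitClosure η) m (orbitClosureAction η) l₂) :
    l₁.Parallel l₂ := by
  obtain ⟨h, hh, hper⟩ := exists_period_of_complexity_le hη
  rw [AffineSubspace.parallel_iff_direction_eq_and_eq_bot_iff_eq_bot,
    direction_eq_span_of_nonexpansive η m hm hh hper h₁,
    direction_eq_span_of_nonexpansive η m hm hh hper h₂]
  have n₁ : l₁ ≠ ⊥ := (AffineSubspace.nonempty_iff_ne_bot _).1 h₁.1.1
  have n₂ : l₂ ≠ ⊥ := (AffineSubspace.nonempty_iff_ne_bot _).1 h₂.1.1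
  exact ⟨rfl, iff_of_false n₁ n₂⟩
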